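/- Let $n\ge 0$ and $[n]=\{1,\dots,n\}$. For $i<j$ in $[n]$ let $w_{ij}\in S_n$ be the permutation that reverses the interval $[i,j]$ and fixes all other points. The cactus group $C_n$ is generated by $s_{ij}$ ($1\le i<j\le n$) with relations $s_{ij}^2=1$; $s_{ij}s_{kl}=s_{kl}s_{ij}$ if $[i,j]\cap[k,l]=\varnothing$; $s_{ij}s_{kl}=s_{w_{ij}(l)w_{ij}(k)}s_{ij}$ if $[k,l]\subseteq[i,j]$. The virtual cactus group $vC_n$ is the quotient of the free product $C_n*S_n$ by the relations $ws_{ij}w^{-1}=s_{w(i)w(j)}$ for all $i<j$ and all $w\in S_n$ with $w(i+k)=w(i)+k$ for $0\le k\le j-i$. The pure virtual cactus group $PvC_n$ is the kernel of the homomorphism $vC_n\to S_n$ with $s_{ij}\mapsto w_{ij}$ and $w\mapsto w$ for $w\in S_n$. Let $L$ be the set of subsets of $[n]$ with at least two elements. For an ordered subset $A=(w(i),w(i+1),\dots,w(j))$ of $[n]$, where $i<j$ and $w\in S_n$, put $s_A=w\,s_{ij}\,w_{ij}\,w^{-1}\in PvC_n$, and let $1_A\in(\mathbb Z/2)^L$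 be the element whose only nonzero coordinate is at the underlying set of $A$. Let $M_n$ be the following cube complex. For each forest $\tau$ of planar rooted trees whose leaves are labelled bijectively by $[n]$, without vertices of valence two and considered up to permutation of the trees, let $E(\tau)$ be the set of its internal edges (those with at least two leaves above them); for $e\in E(\tau)$ let $r_e(\tau)$ be the forest obtained by reversing the planar order at all vertices above $e$, let $d_e(\tau)$ be the forest obtained by collapsing $e$ (cutting the tree into several trees if $e$ is a root edge), and let $1_e\in(\mathbb Z/2)^L$ be the element whose only nonzero coordinate is at the set of labels of the leaves above $e$. Then $$M_n=\bigsqcup_{\tau,\ s\in(\mathbb Z/2)^L}\{\tau\}\times[-1,1]^{E(\tau)}\times\{s\}\Big/\sim,$$ where, for all $e\in E(\tau)$, the coordinate of $e$ being written last, $(\tau,(t,x),s)\sim(r_e(\tau),(t,-x),s+1_e)$ and $(\tau,(t,1),s)\sim(d_e(\tau),t,s)$. A cube complex is special if it is nonpositively curved (the link of each 0-cube is a flag simplicial complex), all its hyperplanes are two-sided, no hyperplane self-intersects or self-osculates, and no two hyperplanes inter-osculate. Here two hyperplanes intersect if they have distinct dual directed 1-cubes that originate from the same 0-cube and form a corner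 of a 2-cube; they osculate if they have distinct dual directed 1-cubes that originate from the same 0-cube and do not form a corner of a 2-cube; and they inter-osculate if they do both. **Corollary.** The virtual cactus group $vC_n$ is virtually special compact: it has a finite-index subgroup that is isomorphic to the fundamental group of a compact connected special cube complex. More precisely, the elements $s_A$ generate $PvC_n$, there is a (necessarily unique) homomorphism $\varphi\colon PvC_n\to(\mathbb Z/2)^L$ with $\varphi(s_A)=1_A$ for all $A$, the kernel of $\varphi$ has finite index in $vC_n$, the cube complex $M_n$ is compact, connected and special, and $\pi_1(M_n)\cong\ker\varphi$ (for every base point). -/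

import Mathlib

/-! ## Cube complexes -/

/-- The cube `[-1,1]^d`. -/
abbrev Cube (d : ℕ) : Type := {t : Fin d → ℝ // ∀ i, t i ∈ Set.Icc (-1 : ℝ) 1}

/-- The isometric embedding of `[-1,1]^k` onto a `k`-dimensional face of `[-1,1]^d` which is given
by an injection `ι` of the coordinates and by signs `σ`: the coordinate `ι j` of the image of `t`
is `σ (ι j) * t j`, and the coordinate `i` is constant, equal to `σ i`, for `i` outside the range
of `ι`. Every isometry of a cube onto a face of a cube has this form. -/
noncomputable def Cube.faceMap {k d : ℕ} (ι : Fin k ↪ Fin d) (σ : Fin d → ℤˣ) (t : Cube k) :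
    Cube d :=
  ⟨fun i => ((σ i : ℤ) : ℝ) * Function.extend ι t.1 1 i, by
    intro i
    have h : Function.extend ι t.1 1 i ∈ Set.Icc (-1 : ℝ) 1 := by
      by_cases hi : ∃ j, ι j = i
      · obtain ⟨j, rfl⟩ := hi
        rw [ι.injective.extend_apply]
        exact t.2 j
      · rw [Function.extend_apply' _ _ _ hi]
        norm_num
    rcases Int.units_eq_one_or (σ i) with hs | hs
    · simpa [hs] using h
    · simp only [Set.mem_Icc, hs, Units.val_neg, Units.val_one, Int.cast_neg, Int.cast_one,
        neg_mul, one_mul] at h ⊢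
      constructor <;> linarith [h.1, h.2]⟩

/-- A cube complex, given by its cubes and their gluing. `cell d` is the set of parametrized
`d`-cubes, that is, of the characteristic maps `[-1,1]^d → X` of the `d`-cubes of the complex `X`
composed with all the isometries of `[-1,1]^d` (so that each `d`-cube gives `2^d * d!` elements of
`cell d`, one for each choice of a corner of the cube, placed at `(1, …, 1)`, and of a numbering of
the `d` edges at this corner). `pull ι σ` is the composition with `Cube.faceMap ι σ`: it restricts
a cube to a face, or reparametrizes it. The last axiom says that no cube is glued to itself by a
nontrivial isometry, so that open cubes embed. -/
structure CubeComplex where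
  cell : ℕ → Type
  pull : ∀ {k d : ℕ}, (Fin k ↪ Fin d) → (Fin d → ℤˣ) → cell d → cell k
  pull_id : ∀ {d : ℕ} (c : cell d), pull (Function.Embedding.refl (Fin d)) 1 c = c
  pull_pull : ∀ {m k d : ℕ} (κ : Fin m ↪ Fin k) (ρ : Fin k → ℤˣ) (ι : Fin k ↪ Fin d)
    (σ : Fin d → ℤˣ) (c : cell d),
    pull κ ρ (pull ι σ c) = pull (κ.trans ι) (σ * Function.extend ι ρ 1) c
  pull_free : ∀ {d : ℕ} (ι : Fin d ↪ Fin d) (σ : Fin d → ℤˣ) (c : cell d),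
    pull ι σ c = c → ι = Function.Embedding.refl (Fin d) ∧ σ = 1

namespace CubeComplex

/-- The disjoint union of all the parametrized cubes. -/
abbrev Points (X : CubeComplex) : Type := Σ c : (Σ d : ℕ, X.cell d), Cube c.1

/-- The gluing: a point `t` of a face (or of a reparametrization) of the cube `c` is identified
with the corresponding point of `c`. -/
inductive Glue (X : CubeComplex) : X.Points → X.Points → Prop
  | mk {k d : ℕ} (ι : Fin k ↪ Fin d) (σ : Fin d → ℤˣ) (c : X.cell d) (t : Cube k) :
      Glue X ⟨⟨k, X.pull ι σ c⟩, t⟩ ⟨⟨d, c⟩, Cube.faceMap ι σ t⟩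

/-- The topological space obtained by gluing the cubes, with the quotient topology. -/
abbrev Space (X : CubeComplex) : Type := Quot X.Glue

/-- The 0-cube at the corner `(1, …, 1)` of a parametrized cube. -/
def corner (X : CubeComplex) {d : ℕ} (c : X.cell d) : X.cell 0 :=
  X.pull (Function.Embedding.ofIsEmpty) 1 c

/-- The `i`-th edge at the corner `(1, …, 1)` of a parametrized cube. A parametrized 1-cube
`e : X.cell 1` is regarded as a directed 1-cube, which originates from `X.corner e`. -/
def edge (X : CubeComplex) {d : ℕ} (c : X.cell d) (i : Fin d) : X.cell 1 :=
  X.pull ⟨fun _ => i, fun _ _ _ => Subsingleton.elim _ _⟩ 1 c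

/-- Reflection of a parametrized cube in the `i`-th coordinate. -/
def reflect (X : CubeComplex) {d : ℕ} (i : Fin d) (c : X.cell d) : X.cell d :=
  X.pull (Function.Embedding.refl (Fin d)) (Pi.mulSingle i (-1)) c

/-- The reverse of a directed 1-cube. -/
def reverse (X : CubeComplex) (e : X.cell 1) : X.cell 1 := X.reflect 0 e

/-- The directed 1-cubes `e₁` and `e₂` are opposite sides of a 2-cube, directed in the same way. -/
def Opposite (X : CubeComplex) (e₁ e₂ : X.cell 1) : Prop :=
  ∃ q : X.cell 2, e₁ = X.edge q 0 ∧ e₂ = X.edge (X.reflect 1 q) 0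

/-- `e₂` is obtained by extending the direction of `e₁` through 2-cubes. -/
def Parallel (X : CubeComplex) : X.cell 1 → X.cell 1 → Prop :=
  Relation.EqvGen X.Opposite

/-- The hyperplanes. Two midpoints of 1-cubes are joined by a 1-dimensional midcube if and only if
the 1-cubes are opposite in a 2-cube, and every midcube contains midpoints of 1-cubes and is
connected through 1-dimensional midcubes; hence the connected components of the union of the
midcubes are the classes of 1-cubes for the equivalence relation generated by opposition in
2-cubes, where directions are forgotten. -/
def Hyperplane (X : CubeComplex) : Type :=
  Quot fun e₁ e₂ : X.cell 1 => X.Opposite e₁ e₂ ∨ e₂ = X.reverse e₁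

/-- The hyperplane dual to a 1-cube. -/
def dual (X : CubeComplex) (e : X.cell 1) : X.Hyperplane := Quot.mk _ e

/-- Two directed 1-cubes (with the same origin) form a corner of a 2-cube. -/
def FormCorner (X : CubeComplex) (e₁ e₂ : X.cell 1) : Prop :=
  ∃ q : X.cell 2, X.edge q 0 = e₁ ∧ X.edge q 1 = e₂

/-- The hyperplane `H` is two-sided: extending a direction of a dual 1-cube to all dual 1-cubes
never gives a 1-cube both of its directions. -/
def TwoSided (X : CubeComplex) (H : X.Hyperplane) : Prop :=
  ∀ e : X.cell 1, X.dual e = H → ¬ X.Parallel e (X.reverse e)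

def Intersect (X : CubeComplex) (H₁ H₂ : X.Hyperplane) : Prop :=
  ∃ e₁ e₂ : X.cell 1, X.dual e₁ = H₁ ∧ X.dual e₂ = H₂ ∧ e₁ ≠ e₂ ∧ X.FormCorner e₁ e₂

def Osculate (X : CubeComplex) (H₁ H₂ : X.Hyperplane) : Prop :=
  ∃ e₁ e₂ : X.cell 1, X.dual e₁ = H₁ ∧ X.dual e₂ = H₂ ∧ e₁ ≠ e₂ ∧
    X.corner e₁ = X.corner e₂ ∧ ¬ X.FormCorner e₁ e₂

/-- Nonpositive curvature: the link of each 0-cube is a flag simplicial complex. The vertices of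
the link of `v` are the directed 1-cubes originating from `v`, and each corner at `v` of a `k`-cube
gives a simplex with the `k` edges of the corner as its vertices. The first two conditions say that
the links are simplicial complexes (the vertices of a simplex are distinct, and a simplex is
determined by its vertices), the third one that they are flag. -/
structure NonpositivelyCurved (X : CubeComplex) : Prop where
  edge_injective : ∀ {k : ℕ} (c : X.cell k), Function.Injective (X.edge c)
  ext_edge : ∀ {k : ℕ} (c c' : X.cell k), X.corner c = X.corner c' →
    (∀ i, X.edge c i = X.edge c' i) → c = c'
  flag : ∀ (v : X.cell 0) {k : ℕ} (e : Fin k → X.cell 1), (∀ i, X.corner (e i) = v) →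
    (∀ i j, i ≠ j → X.FormCorner (e i) (e j)) →
    ∃ c : X.cell k, X.corner c = v ∧ ∀ i, X.edge c i = e i

structure IsSpecial (X : CubeComplex) : Prop where
  nonpositivelyCurved : X.NonpositivelyCurved
  twoSided : ∀ H : X.Hyperplane, X.TwoSided H
  not_selfIntersect : ∀ H : X.Hyperplane, ¬ X.Intersect H H
  not_selfOsculate : ∀ H : X.Hyperplane, ¬ X.Osculate H H
  not_interOsculate : ∀ H₁ H₂ : X.Hyperplane, ¬ (X.Intersect H₁ H₂ ∧ X.Osculate H₁ H₂)

end CubeComplex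

/-- A group is virtually special compact if it has a finite-index subgroup that is isomorphic to
the fundamental group of a compact (connected) special cube complex. -/
def VirtuallySpecialCompact (G : Type*) [Group G] : Prop :=
  ∃ H : Subgroup G, H.FiniteIndex ∧ ∃ X : CubeComplex, X.IsSpecial ∧ CompactSpace X.Space ∧
    PathConnectedSpace X.Space ∧ ∃ x : X.Space, Nonempty (FundamentalGroup X.Space x ≃* H)

/-! ## The virtual cactus group -/

/-- The index set of the generators `s_{ij}`, `i < j`, of the cactus group. -/
abbrev CactusIndex (n : ℕ) : Type := {p : Fin n × Fin n // p.1 < p.2}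

/-- The permutation `w_{ij}`, which reverses the interval `[i,j]` and fixes the other points. -/
def revInterval {n : ℕ} (p : CactusIndex n) : Equiv.Perm (Fin n) :=
  Function.Involutive.toPerm
    (fun m : Fin n => if h : p.1.1 ≤ m ∧ m ≤ p.1.2 then
      ⟨p.1.1 + p.1.2 - m, by have := h.1; have := p.1.2.2; omega⟩ else m)
    (by
      intro m
      apply Fin.ext
      by_cases h : p.1.1 ≤ m ∧ m ≤ p.1.2
      · have h1 : (p.1.1 : ℕ) ≤ m := h.1
        have h2 : (m : ℕ) ≤ p.1.2 := h.2
        beta_reduce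
        rw [dif_pos h, dif_pos ⟨by rw [Fin.le_def]; simp only; omega,
          by rw [Fin.le_def]; simp only; omega⟩]
        simp only
        omega
      · beta_reduce
        rw [dif_neg h, dif_neg h])

theorem revInterval_val {n : ℕ} (p : CactusIndex n) (m : Fin n) :
    ((revInterval p m : Fin n) : ℕ) =
      if (p.1.1 : ℕ) ≤ m ∧ (m : ℕ) ≤ p.1.2 then (p.1.1 : ℕ) + p.1.2 - m else m := by
  simp only [revInterval, Function.Involutive.coe_toPerm, Fin.le_def]
  split_ifs <;> rfl

/-- The relators of the cactus group. -/
inductive CactusRel (n : ℕ) : FreeGroup (CactusIndex n) → Prop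
  | sq (p : CactusIndex n) : CactusRel n (FreeGroup.of p * FreeGroup.of p)
  | comm (p q : CactusIndex n) (h : Disjoint (Set.Icc p.1.1 p.1.2) (Set.Icc q.1.1 q.1.2)) :
      CactusRel n (FreeGroup.of p * FreeGroup.of q * (FreeGroup.of q * FreeGroup.of p)⁻¹)
  | nest (p q r : CactusIndex n) (h : Set.Icc q.1.1 q.1.2 ⊆ Set.Icc p.1.1 p.1.2)
      (h₁ : r.1.1 = revInterval p q.1.2) (h₂ : r.1.2 = revInterval p q.1.1) :
      CactusRel n (FreeGroup.of p * FreeGroup.of q * (FreeGroup.of r * FreeGroup.of p)⁻¹)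

/-- The cactus group `C_n`. -/
abbrev Cactus (n : ℕ) : Type := PresentedGroup {r | CactusRel n r}

/-- The generator `s_{ij}` of the cactus group. -/
def Cactus.s {n : ℕ} (p : CactusIndex n) : Cactus n := PresentedGroup.of p

/-- The relators `w s_{ij} w⁻¹ s_{w(i)w(j)}⁻¹` of the virtual cactus group, for all `i < j` and all
`w` such that `w (i + k) = w i + k` for `0 ≤ k ≤ j - i`. -/
inductive VCactusRel (n : ℕ) : Monoid.Coprod (Cactus n) (Equiv.Perm (Fin n)) → Prop
  | mk (w : Equiv.Perm (Fin n)) (p r : CactusIndex n)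
      (h : ∀ m ∈ Set.Icc p.1.1 p.1.2, (w m : ℕ) + p.1.1 = w p.1.1 + m)
      (h₁ : r.1.1 = w p.1.1) (h₂ : r.1.2 = w p.1.2) :
      VCactusRel n (Monoid.Coprod.inr w * Monoid.Coprod.inl (Cactus.s p) *
        (Monoid.Coprod.inr w)⁻¹ * (Monoid.Coprod.inl (Cactus.s r))⁻¹)

/-- The virtual cactus group `vC_n`. -/
abbrev VCactus (n : ℕ) : Type :=
  Monoid.Coprod (Cactus n) (Equiv.Perm (Fin n)) ⧸ Subgroup.normalClosure {r | VCactusRel n r}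

namespace VCactus

/-- The generator `s_{ij}` of the virtual cactus group. -/
def s {n : ℕ} (p : CactusIndex n) : VCactus n :=
  QuotientGroup.mk (Monoid.Coprod.inl (Cactus.s p))

/-- The permutation `w` as an element of the virtual cactus group. -/
def perm {n : ℕ} (w : Equiv.Perm (Fin n)) : VCactus n := QuotientGroup.mk (Monoid.Coprod.inr w)

theorem revInterval_mul_self {n : ℕ} (p : CactusIndex n) : revInterval p * revInterval p = 1 := by
  ext m
  have := p.2
  simp only [Equiv.Perm.mul_apply, revInterval_val, Equiv.Perm.one_apply]
  split_ifs <;> omega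

theorem revInterval_comm {n : ℕ} (p q : CactusIndex n)
    (h : Disjoint (Set.Icc p.1.1 p.1.2) (Set.Icc q.1.1 q.1.2)) :
    revInterval p * revInterval q = revInterval q * revInterval p := by
  have hp : (p.1.1 : ℕ) < p.1.2 := p.2
  have hq : (q.1.1 : ℕ) < q.1.2 := q.2
  have h' : (p.1.2 : ℕ) < q.1.1 ∨ (q.1.2 : ℕ) < p.1.1 := by
    by_contra hc
    push Not at hc
    rw [Set.disjoint_left] at h
    by_cases h1 : (p.1.1 : ℕ) ≤ q.1.1
    · exact h (a := q.1.1) ⟨h1, hc.1⟩ ⟨le_refl _, hq.le⟩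
    · exact h (a := p.1.1) ⟨le_refl _, hp.le⟩ ⟨(not_le.1 h1).le, hc.2⟩
  ext m
  simp only [Equiv.Perm.mul_apply, revInterval_val]
  split_ifs <;> omega

theorem revInterval_nest {n : ℕ} (p q r : CactusIndex n)
    (h : Set.Icc q.1.1 q.1.2 ⊆ Set.Icc p.1.1 p.1.2)
    (h₁ : r.1.1 = revInterval p q.1.2) (h₂ : r.1.2 = revInterval p q.1.1) :
    revInterval p * revInterval q = revInterval r * revInterval p := by
  have hp : (p.1.1 : ℕ) < p.1.2 := p.2
  have hq : (q.1.1 : ℕ) < q.1.2 := q.2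
  have ha : (p.1.1 : ℕ) ≤ q.1.1 := (h (Set.left_mem_Icc.2 hq.le)).1
  have hb : (q.1.2 : ℕ) ≤ p.1.2 := (h (Set.right_mem_Icc.2 hq.le)).2
  have e₁ := congrArg Fin.val h₁
  have e₂ := congrArg Fin.val h₂
  rw [revInterval_val, if_pos (by omega)] at e₁ e₂
  ext m
  simp only [Equiv.Perm.mul_apply, revInterval_val, e₁, e₂]
  split_ifs <;> omega

theorem revInterval_conj {n : ℕ} (w : Equiv.Perm (Fin n)) (p r : CactusIndex n)
    (h : ∀ m ∈ Set.Icc p.1.1 p.1.2, (w m : ℕ) + p.1.1 = w p.1.1 + m)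
    (h₁ : r.1.1 = w p.1.1) (h₂ : r.1.2 = w p.1.2) :
    w * revInterval p = revInterval r * w := by
  have hp : (p.1.1 : ℕ) < p.1.2 := p.2
  have hj := h p.1.2 (Set.right_mem_Icc.2 hp.le)
  ext m
  simp only [Equiv.Perm.mul_apply]
  by_cases hm : (p.1.1 : ℕ) ≤ m ∧ (m : ℕ) ≤ p.1.2
  · have e := revInterval_val p m
    rw [if_pos hm] at e
    have h3 := h m ⟨hm.1, hm.2⟩
    have h4 := h (revInterval p m) ⟨by rw [Fin.le_def]; omega, by rw [Fin.le_def]; omega⟩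
    rw [revInterval_val, h₁, h₂]
    split_ifs <;> omega
  · have e : revInterval p m = m := by
      apply Fin.ext
      rw [revInterval_val, if_neg hm]
    rw [e, revInterval_val, h₁, h₂, if_neg]
    rintro ⟨h3, h4⟩
    apply hm
    have hlt : (p.1.1 : ℕ) + (w m - w p.1.1) < n := by
      have := p.1.2.2
      omega
    have h5 := h ⟨(p.1.1 : ℕ) + (w m - w p.1.1), hlt⟩
      ⟨by rw [Fin.le_def]; simp, by rw [Fin.le_def]; simp only; omega⟩
    have h6 : w ⟨(p.1.1 : ℕ) + (w m - w p.1.1), hlt⟩ = w m := by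
      apply Fin.ext
      simp only at h5
      omega
    have h7 := congrArg Fin.val (w.injective h6)
    simp only at h7
    omega

/-- The homomorphism `C_n → S_n`, `s_{ij} ↦ w_{ij}`. -/
def cactusToPerm (n : ℕ) : Cactus n →* Equiv.Perm (Fin n) :=
  PresentedGroup.toGroup (f := revInterval) (by
    rintro _ (⟨p⟩ | ⟨p, q, h⟩ | ⟨p, q, r, h, h₁, h₂⟩)
    · simpa using revInterval_mul_self p
    · simpa only [map_mul, map_inv, FreeGroup.lift_apply_of, mul_inv_eq_one] using
        revInterval_comm p q h
    · simpa only [map_mul, map_inv, FreeGroup.lift_apply_of, mul_inv_eq_one] using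
        revInterval_nest p q r h h₁ h₂)

/-- The homomorphism `vC_n → S_n`, `s_{ij} ↦ w_{ij}`, `w ↦ w`. -/
def toPerm (n : ℕ) : VCactus n →* Equiv.Perm (Fin n) :=
  QuotientGroup.lift _ (Monoid.Coprod.lift (cactusToPerm n) (MonoidHom.id _)) (by
    intro x hx
    refine Subgroup.normalClosure_le_normal ?_ hx
    rintro _ ⟨w, p, r, h, h₁, h₂⟩
    have e := revInterval_conj w p r h h₁ h₂
    simp only [SetLike.mem_coe, MonoidHom.mem_ker, map_mul, map_inv, Monoid.Coprod.lift_apply_inl,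
      Monoid.Coprod.lift_apply_inr, MonoidHom.id_apply, cactusToPerm, Cactus.s,
      PresentedGroup.toGroup.of, e]
    group)

theorem toPerm_s {n : ℕ} (p : CactusIndex n) : toPerm n (s p) = revInterval p := by
  simp only [toPerm, s, QuotientGroup.lift_mk, Monoid.Coprod.lift_apply_inl, cactusToPerm,
    Cactus.s, PresentedGroup.toGroup.of]

theorem toPerm_perm {n : ℕ} (w : Equiv.Perm (Fin n)) : toPerm n (perm w) = w := by
  simp only [toPerm, perm, QuotientGroup.lift_mk, Monoid.Coprod.lift_apply_inr,
    MonoidHom.id_apply]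

end VCactus

/-- The pure virtual cactus group `PvC_n`. -/
abbrev PVCactus (n : ℕ) : Subgroup (VCactus n) := (VCactus.toPerm n).ker

/-- The element `s_A = w s_{ij} w_{ij} w⁻¹` of `PvC_n`, where `A` is the ordered subset
`(w(i), w(i+1), …, w(j))` of the set of labels. It depends only on `A`, by the defining relations
of `vC_n`, and each ordered subset with at least two elements arises in this way. -/
def PVCactus.gen {n : ℕ} (w : Equiv.Perm (Fin n)) (p : CactusIndex n) : PVCactus n :=
  ⟨VCactus.perm w * VCactus.s p * VCactus.perm (revInterval p) * (VCactus.perm w)⁻¹, by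
    simp only [MonoidHom.mem_ker, map_mul, map_inv, VCactus.toPerm_s, VCactus.toPerm_perm]
    rw [mul_assoc w, VCactus.revInterval_mul_self, mul_one, mul_inv_cancel]⟩

/-- The set `L` of the subsets of the set of labels with at least two elements. -/
abbrev LabelSet (n : ℕ) : Type := {S : Finset (Fin n) // 2 ≤ S.card}

/-- The set of the elements `w(i), w(i+1), …, w(j)`. -/
def imageInterval {n : ℕ} (w : Equiv.Perm (Fin n)) (p : CactusIndex n) : LabelSet n :=
  ⟨(Finset.Icc p.1.1 p.1.2).map w.toEmbedding, by
    have : (p.1.1 : ℕ) < p.1.2 := p.2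
    rw [Finset.card_map, Fin.card_Icc]
    omega⟩

/-! ## Planar forests and the complex `M_n` -/

/-- An ordered subset of the set of labels: a subset with a strict linear order on it. -/
@[ext]
structure OrdSubset (n : ℕ) where
  carrier : Finset (Fin n)
  lt : Fin n → Fin n → Prop
  mem_left : ∀ a b, lt a b → a ∈ carrier
  mem_right : ∀ a b, lt a b → b ∈ carrier
  irrefl : ∀ a, ¬ lt a a
  trans : ∀ a b c, lt a b → lt b c → lt a c
  total : ∀ a ∈ carrier, ∀ b ∈ carrier, a ≠ b → lt a b ∨ lt b a

/-- `A` is an interval of the ordered set `B`, with the induced order. -/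
structure OrdSubset.IsIntervalOf {n : ℕ} (A B : OrdSubset n) : Prop where
  subset : A.carrier ⊆ B.carrier
  lt_iff : ∀ a ∈ A.carrier, ∀ b ∈ A.carrier, (A.lt a b ↔ B.lt a b)
  convex : ∀ a ∈ A.carrier, ∀ b ∈ A.carrier, ∀ c, B.lt a c → B.lt c b → c ∈ A.carrier

/-- A planar forest with leaves labelled by `n` labels and with `d` internal edges, up to
permutation of its trees, together with a numbering `e_1, …, e_d` of its internal edges. It is
recorded by the ordered sets `ord i` of the labels of the leaves above `e_i`, in the order of a
depth-first search: a family of ordered sets arises from a planar forest (which is then unique up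
to permutation of its trees, and whose internal edges correspond bijectively to the members of the
family) if and only if each of the sets has at least two elements and any two of them are different
as sets, and either disjoint or nested as intervals with the same order. (The edges ascending from
the upper vertex of `e_i` are the edges `e_j` for the maximal proper subsets `ord j` of `ord i`, and
the edges to the remaining leaves, ordered as in `ord i`.) -/
@[ext]
structure PlanarForest (n d : ℕ) where
  ord : Fin d → OrdSubset n
  two_le : ∀ i, 2 ≤ (ord i).carrier.card
  carrier_injective : Function.Injective fun i => (ord i).carrier
  compat : ∀ i j, Disjoint (ord i).carrier (ord j).carrier ∨ (ord i).IsIntervalOf (ord j) ∨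
    (ord j).IsIntervalOf (ord i)

namespace PlanarForest

variable {n d : ℕ}

/-- The type of the internal edge `e_i`: the set of the labels of the leaves above it. -/
def type (τ : PlanarForest n d) (i : Fin d) : LabelSet n := ⟨(τ.ord i).carrier, τ.two_le i⟩

/-- The sign which tells whether the order of `a` and `b` is reversed (`-1`) or kept (`1`) when
the forest is flipped at all the edges `e_i` with `σ i = -1`. A flip at `e_i` reverses all the
vertices above `e_i`, so it reverses the order of `a` and `b` if and only if the leaves `a` and `b`
both lie above `e_i`. -/
def sgn (τ : PlanarForest n d) (σ : Fin d → ℤˣ) (a b : Fin n) : ℤˣ :=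
  ∏ i, if a ∈ (τ.ord i).carrier ∧ b ∈ (τ.ord i).carrier then σ i else 1

theorem sgn_comm (τ : PlanarForest n d) (σ : Fin d → ℤˣ) (a b : Fin n) :
    τ.sgn σ a b = τ.sgn σ b a := by
  simp only [sgn, and_comm]

theorem sgn_eq_of_sep (τ : PlanarForest n d) (σ : Fin d → ℤˣ) {i : Fin d} {a b c : Fin n}
    (ha : a ∈ (τ.ord i).carrier) (hb : b ∈ (τ.ord i).carrier) (hc : c ∉ (τ.ord i).carrier) :
    τ.sgn σ a c = τ.sgn σ b c := by
  have key : ∀ k x y, x ∈ (τ.ord i).carrier → y ∈ (τ.ord i).carrier →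
      x ∈ (τ.ord k).carrier → c ∈ (τ.ord k).carrier → y ∈ (τ.ord k).carrier := by
    intro k x y hx hy hxk hck
    rcases τ.compat i k with h | h | h
    · exact absurd hxk (Finset.disjoint_left.1 h hx)
    · exact h.subset hy
    · exact absurd (h.subset hck) hc
  refine Finset.prod_congr rfl fun k _ => ?_
  have : (a ∈ (τ.ord k).carrier ∧ c ∈ (τ.ord k).carrier) ↔
      (b ∈ (τ.ord k).carrier ∧ c ∈ (τ.ord k).carrier) :=
    ⟨fun h => ⟨key k a b ha hb h.1 h.2, h.2⟩, fun h => ⟨key k b a hb ha h.1 h.2, h.2⟩⟩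
  simp only [this]

theorem lt_iff_of_sep (τ : PlanarForest n d) {i j : Fin d} {a b c : Fin n}
    (ha : a ∈ (τ.ord i).carrier) (hb : b ∈ (τ.ord i).carrier) (hc : c ∉ (τ.ord i).carrier)
    (haj : a ∈ (τ.ord j).carrier) (hcj : c ∈ (τ.ord j).carrier) :
    ((τ.ord j).lt a c ↔ (τ.ord j).lt b c) ∧ ((τ.ord j).lt c a ↔ (τ.ord j).lt c b) := by
  have hij : (τ.ord i).IsIntervalOf (τ.ord j) := by
    rcases τ.compat i j with h | h | h
    · exact absurd haj (Finset.disjoint_left.1 h ha)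
    · exact h
    · exact absurd (h.subset hcj) hc
  have hac : a ≠ c := by rintro rfl; exact hc ha
  have hbc : b ≠ c := by rintro rfl; exact hc hb
  have ta := (τ.ord j).total a haj c hcj hac
  have tb := (τ.ord j).total b (hij.subset hb) c hcj hbc
  have h1 : ¬ ((τ.ord j).lt a c ∧ (τ.ord j).lt c b) := fun h => hc (hij.convex a ha b hb c h.1 h.2)
  have h2 : ¬ ((τ.ord j).lt b c ∧ (τ.ord j).lt c a) := fun h => hc (hij.convex b hb a ha c h.1 h.2)
  have h3 : ¬ ((τ.ord j).lt a c ∧ (τ.ord j).lt c a) :=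
    fun h => (τ.ord j).irrefl a ((τ.ord j).trans _ _ _ h.1 h.2)
  have h4 : ¬ ((τ.ord j).lt b c ∧ (τ.ord j).lt c b) :=
    fun h => (τ.ord j).irrefl b ((τ.ord j).trans _ _ _ h.1 h.2)
  tauto

/-- The order above `e_j` after the flips. -/
def flipLt (τ : PlanarForest n d) (σ : Fin d → ℤˣ) (j : Fin d) (a b : Fin n) : Prop :=
  if τ.sgn σ a b = 1 then (τ.ord j).lt a b else (τ.ord j).lt b a

theorem flipLt_iff_of_sep (τ : PlanarForest n d) (σ : Fin d → ℤˣ) {i j : Fin d} {a b c : Fin n}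
    (ha : a ∈ (τ.ord i).carrier) (hb : b ∈ (τ.ord i).carrier) (hc : c ∉ (τ.ord i).carrier)
    (haj : a ∈ (τ.ord j).carrier) (hcj : c ∈ (τ.ord j).carrier) :
    (τ.flipLt σ j a c ↔ τ.flipLt σ j b c) ∧ (τ.flipLt σ j c a ↔ τ.flipLt σ j c b) := by
  have h := τ.lt_iff_of_sep ha hb hc haj hcj
  simp only [flipLt, τ.sgn_comm σ c, τ.sgn_eq_of_sep σ ha hb hc, h.1, h.2, and_self]

theorem flipLt_mem (τ : PlanarForest n d) (σ : Fin d → ℤˣ) {j : Fin d} {a b : Fin n}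
    (h : τ.flipLt σ j a b) : a ∈ (τ.ord j).carrier ∧ b ∈ (τ.ord j).carrier := by
  unfold flipLt at h
  split_ifs at h
  · exact ⟨(τ.ord j).mem_left _ _ h, (τ.ord j).mem_right _ _ h⟩
  · exact ⟨(τ.ord j).mem_right _ _ h, (τ.ord j).mem_left _ _ h⟩

theorem flipLt_asymm (τ : PlanarForest n d) (σ : Fin d → ℤˣ) {j : Fin d} {a b : Fin n}
    (h : τ.flipLt σ j a b) : ¬ τ.flipLt σ j b a := by
  unfold flipLt at h ⊢
  rw [τ.sgn_comm σ b a]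
  split_ifs at h ⊢ <;> exact fun h' => (τ.ord j).irrefl _ ((τ.ord j).trans _ _ _ h h')

theorem flipLt_trans (τ : PlanarForest n d) (σ : Fin d → ℤˣ) {j : Fin d} {a b c : Fin n}
    (hab : τ.flipLt σ j a b) (hbc : τ.flipLt σ j b c) : τ.flipLt σ j a c := by
  obtain ⟨ha, hb⟩ := τ.flipLt_mem σ hab
  obtain ⟨-, hc⟩ := τ.flipLt_mem σ hbc
  by_cases h1 : ∃ i, a ∈ (τ.ord i).carrier ∧ b ∈ (τ.ord i).carrier ∧ c ∉ (τ.ord i).carrier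
  · obtain ⟨i, h1, h2, h3⟩ := h1
    exact (τ.flipLt_iff_of_sep σ h1 h2 h3 ha hc).1.2 hbc
  by_cases h2 : ∃ i, b ∈ (τ.ord i).carrier ∧ c ∈ (τ.ord i).carrier ∧ a ∉ (τ.ord i).carrier
  · obtain ⟨i, h1, h2, h3⟩ := h2
    exact (τ.flipLt_iff_of_sep σ h1 h2 h3 hb ha).2.1 hab
  by_cases h3 : ∃ i, a ∈ (τ.ord i).carrier ∧ c ∈ (τ.ord i).carrier ∧ b ∉ (τ.ord i).carrier
  · obtain ⟨i, h1, h2, h3⟩ := h3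
    exact absurd hbc (τ.flipLt_asymm σ ((τ.flipLt_iff_of_sep σ h1 h2 h3 ha hb).1.1 hab))
  push Not at h1 h2 h3
  have e1 : τ.sgn σ a b = τ.sgn σ a c := by
    refine Finset.prod_congr rfl fun k _ => ?_
    have : (a ∈ (τ.ord k).carrier ∧ b ∈ (τ.ord k).carrier) ↔
        (a ∈ (τ.ord k).carrier ∧ c ∈ (τ.ord k).carrier) :=
      ⟨fun h => ⟨h.1, h1 k h.1 h.2⟩, fun h => ⟨h.1, h3 k h.1 h.2⟩⟩
    simp only [this]
  have e2 : τ.sgn σ b c = τ.sgn σ a c := by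
    refine Finset.prod_congr rfl fun k _ => ?_
    have : (b ∈ (τ.ord k).carrier ∧ c ∈ (τ.ord k).carrier) ↔
        (a ∈ (τ.ord k).carrier ∧ c ∈ (τ.ord k).carrier) :=
      ⟨fun h => ⟨h2 k h.1 h.2, h.2⟩, fun h => ⟨h3 k h.1 h.2, h.2⟩⟩
    simp only [this]
  unfold flipLt at hab hbc ⊢
  rw [e1] at hab
  rw [e2] at hbc
  split_ifs at hab hbc ⊢
  · exact (τ.ord j).trans _ _ _ hab hbc
  · exact (τ.ord j).trans _ _ _ hbc hab

/-- Flip the forest `τ` at all the edges `e_i` with `σ i = -1`, then delete (collapse) the edges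
whose index is not in the range of `ι`, and renumber the remaining ones by `ι`. -/
def pull {k : ℕ} (ι : Fin k ↪ Fin d) (σ : Fin d → ℤˣ) (τ : PlanarForest n d) :
    PlanarForest n k where
  ord j :=
    { carrier := (τ.ord (ι j)).carrier
      lt := τ.flipLt σ (ι j)
      mem_left := fun _ _ h => (τ.flipLt_mem σ h).1
      mem_right := fun _ _ h => (τ.flipLt_mem σ h).2
      irrefl := fun _ h => τ.flipLt_asymm σ h h
      trans := fun _ _ _ h h' => τ.flipLt_trans σ h h'
      total := fun a ha b hb hab => by
        unfold flipLt
        rw [τ.sgn_comm σ b a]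
        have := (τ.ord (ι j)).total a ha b hb hab
        split_ifs <;> tauto }
  two_le j := τ.two_le (ι j)
  carrier_injective := fun _ _ h => ι.injective (τ.carrier_injective h)
  compat := by
    have key : ∀ i j, (τ.ord i).IsIntervalOf (τ.ord j) →
        (∀ a ∈ (τ.ord i).carrier, ∀ b ∈ (τ.ord i).carrier,
          (τ.flipLt σ i a b ↔ τ.flipLt σ j a b)) ∧
        (∀ a ∈ (τ.ord i).carrier, ∀ b ∈ (τ.ord i).carrier, ∀ c,
          τ.flipLt σ j a c → τ.flipLt σ j c b → c ∈ (τ.ord i).carrier) := by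
      intro i j h
      refine ⟨fun a ha b hb => ?_, fun a ha b hb c hac hcb => ?_⟩
      · simp only [flipLt, h.lt_iff a ha b hb, h.lt_iff b hb a ha]
      · by_contra hc
        have hm := τ.flipLt_mem σ hac
        exact τ.flipLt_asymm σ hcb ((τ.flipLt_iff_of_sep σ ha hb hc hm.1 hm.2).1.1 hac)
    intro i j
    rcases τ.compat (ι i) (ι j) with h | h | h
    · exact Or.inl h
    · exact Or.inr (Or.inl ⟨h.subset, (key _ _ h).1, (key _ _ h).2⟩)
    · exact Or.inr (Or.inr ⟨h.subset, (key _ _ h).1, (key _ _ h).2⟩)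

theorem prod_extend {M : Type*} [CommMonoid M] {k : ℕ} (ι : Fin k ↪ Fin d)
    (f : Fin d → ℤˣ → M) (hf : ∀ i, f i 1 = 1) (ρ : Fin k → ℤˣ) :
    ∏ i, f i (Function.extend ι ρ 1 i) = ∏ j, f (ι j) (ρ j) := by
  symm
  refine Fintype.prod_of_injective ι ι.injective _ _ (fun i hi => ?_) (fun j => ?_)
  · rw [Function.extend_apply' _ _ _ hi, Pi.one_apply, hf]
  · rw [ι.injective.extend_apply]

theorem sgn_mul_extend {k : ℕ} (τ : PlanarForest n d) (ι : Fin k ↪ Fin d) (σ : Fin d → ℤˣ)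
    (ρ : Fin k → ℤˣ) (a b : Fin n) :
    τ.sgn (σ * Function.extend ι ρ 1) a b = τ.sgn σ a b * (τ.pull ι σ).sgn ρ a b := by
  have h := prod_extend ι
    (fun i u => if a ∈ (τ.ord i).carrier ∧ b ∈ (τ.ord i).carrier then u else (1 : ℤˣ))
    (by simp) ρ
  have h' : (τ.pull ι σ).sgn ρ a b =
      ∏ j, if a ∈ (τ.ord (ι j)).carrier ∧ b ∈ (τ.ord (ι j)).carrier then ρ j else 1 := rfl
  rw [h', ← h, sgn, sgn, ← Finset.prod_mul_distrib]
  refine Finset.prod_congr rfl fun i _ => ?_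
  split_ifs <;> simp

theorem pull_id (τ : PlanarForest n d) : τ.pull (Function.Embedding.refl (Fin d)) 1 = τ := by
  ext j
  · rfl
  · simp [pull, flipLt, sgn]

theorem pull_pull {m k : ℕ} (κ : Fin m ↪ Fin k) (ρ : Fin k → ℤˣ) (ι : Fin k ↪ Fin d)
    (σ : Fin d → ℤˣ) (τ : PlanarForest n d) :
    (τ.pull ι σ).pull κ ρ = τ.pull (κ.trans ι) (σ * Function.extend ι ρ 1) := by
  ext j a b
  · rfl
  · change (τ.pull ι σ).flipLt ρ (κ j) a b ↔ τ.flipLt _ (ι (κ j)) a b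
    have h : ∀ x y, ((τ.pull ι σ).ord (κ j)).lt x y = τ.flipLt σ (ι (κ j)) x y := fun _ _ => rfl
    unfold flipLt
    rw [sgn_mul_extend, h, h]
    unfold flipLt
    rw [τ.sgn_comm σ b a]
    rcases Int.units_eq_one_or (τ.sgn σ a b) with h1 | h1 <;>
      rcases Int.units_eq_one_or ((τ.pull ι σ).sgn ρ a b) with h2 | h2 <;>
      simp [h1, h2]

end PlanarForest

/-- The cube complex `M_n`. The group `(ℤ/2)^L` is written multiplicatively, as `L → {1, -1}`, so
that `1_e` is `Pi.mulSingle (type of e) (-1)`. The cube of dimension `d` labelled by a forest `τ`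
and a parameter `s`, whose positive subcube is `(τ, s)`, is parametrized by means of the numbering
of the internal edges of `τ`. Its reflection in the coordinate of `e` is labelled by
`(r_e(τ), s + 1_e)`, and its face where the coordinate of `e` is `1` by `(d_e(τ), s)`. -/
def cactusCover (n : ℕ) : CubeComplex where
  cell d := PlanarForest n d × (LabelSet n → ℤˣ)
  pull ι σ c := (c.1.pull ι σ, c.2 * ∏ i, Pi.mulSingle (c.1.type i) (σ i))
  pull_id c := by simp [PlanarForest.pull_id]
  pull_pull κ ρ ι σ c := by
    refine Prod.ext (PlanarForest.pull_pull κ ρ ι σ c.1) ?_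
    have h := PlanarForest.prod_extend ι
      (fun i u => (Pi.mulSingle (c.1.type i) u : LabelSet n → ℤˣ)) (by simp) ρ
    simp only [Pi.mul_apply, Pi.mulSingle_mul, Finset.prod_mul_distrib, h, mul_assoc]
    rfl
  pull_free ι σ c h := by
    have h1 := congrArg Prod.fst h
    have h2 := congrArg Prod.snd h
    refine ⟨?_, ?_⟩
    · ext1 j
      apply c.1.carrier_injective
      exact congrArg (fun τ : PlanarForest n _ => (τ.ord j).carrier) h1
    · funext j
      have h3 := congrFun (mul_eq_left.1 h2) (c.1.type j)
      rw [Finset.prod_apply, Finset.prod_eq_single j] at h3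
      · simpa using h3
      · intro i _ hij
        apply Pi.mulSingle_eq_of_ne
        intro he
        exact hij (c.1.carrier_injective (congrArg Subtype.val he)).symm
      · simp

/-! ## The fundamental group of a space with a cover by small sets -/

open scoped Topology

namespace Path.Homotopic.Quotient

variable {X : Type*} [TopologicalSpace X] {x y z : X}

/-! The complex has one 0-cube for each element of `(ℤ/2)^L`. From every 0-cube starts one directed
1-cube for each ordered subset with at least two elements, and following it adds `1_A`. Hence an
edge path from a fixed 0-cube is a word in the ordered subsets. Its elementary homotopies are
backtracking and passage across 2-cubes, and it is closed if and only if its types cancel in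
`(ℤ/2)^L`. This leads to the group `EdgeGroup`, generated by the ordered subsets with exactly these
relations, and both sides of the claimed isomorphism are compared with it.

Topological side (`fundamentalGroup_equiv_ker`): `π₁` is the kernel of `types : EdgeGroup →
(ℤ/2)^L`. The complex is covered by open neighbourhoods of the 0-cubes, each with a motion that
takes it to its 0-cube inside itself. Products of generators along paths in a cube depend only on
the ends of the path, so they form a locally constant `EdgeGroup`-valued cocycle on this cover. The
covering space of the cocycle assigns to each path class a holonomy in `EdgeGroup`. Conversely
`EdgeGroup` acts on path classes by extending them along 1-cubes. The action reaches every class,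
because a path can be subdivided into small pieces, and it is free, because holonomy recovers the
group element (`SmallCover.fundamentalGroup_equiv`).

Algebraic side (`PVCactus.equivEdgeGroup`): `PvC_n` is isomorphic to `EdgeGroup` by `s_A ↔ A`. The
virtual cactus group maps to `EdgeGroup ⋊ S_n` by sending `s_{ij}` to the ordered set `(i, …, j)`
paired with `w_{ij}`, and there is a map back. An ordered subset is a block of consecutive entries
of some permutation, its frame. Two frames of the same set differ by a permutation that translates
an interval, which is what the mixed relations of `vC_n` absorb. Two compatible ordered subsets have
a common frame, in which the square relation is one of the commutation or nesting relations of the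
cactus group.

Specialness: a forest is a pairwise compatible family of ordered subsets, so links are flag. Along a
hyperplane three things are constant: the underlying set `S`; its order, corrected for each pair by
the signs `s_B` of all `B` containing the pair; and the signs `s_B` of the sets `B` that cross `S`,
since 2-cubes only change signs of sets disjoint from `S` or nested with it. The first excludes
self-intersections, the first two exclude self-osculations, and all three exclude inter-osculations
(`isIntervalOf_of_invariant_eq`). Two-sidedness comes from the sign `s_S`, which only reversal of a
dual 1-cube changes. -/

theorem trans_symm_cancel (p : Path.Homotopic.Quotient x y)
    (q : Path.Homotopic.Quotient x z) : p.trans (p.symm.trans q) = q := by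
  rw [← trans_assoc, trans_symm, refl_trans]

theorem symm_trans_cancel (p : Path.Homotopic.Quotient x y)
    (q : Path.Homotopic.Quotient y z) : p.symm.trans (p.trans q) = q := by
  rw [← trans_assoc, symm_trans, refl_trans]

theorem trans_left_cancel {p : Path.Homotopic.Quotient x y} {q r : Path.Homotopic.Quotient y z}
    (h : p.trans q = p.trans r) : q = r := by
  rw [← symm_trans_cancel p q, h, symm_trans_cancel]

end Path.Homotopic.Quotient

/-- An open cover of a space by sets `W v` that are simply connected relative to the space, with
compatible paths `r v x` from a base point of `W v` to its points, and a locally constant cocycle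
with values in `P`. -/
structure SmallCover (X : Type) [TopologicalSpace X] (P : Type) [Group P] where
  V : Type
  W : V → Set X
  isOpen : ∀ v, IsOpen (W v)
  cover : ∀ x, ∃ v, x ∈ W v
  base : V → X
  base_mem : ∀ v, base v ∈ W v
  r : ∀ v x, x ∈ W v → Path (base v) x
  r_mem : ∀ v x hx t, r v x hx t ∈ W v
  r_trans : ∀ v x y (hx : x ∈ W v) (hy : y ∈ W v) (γ : Path x y), (∀ t, γ t ∈ W v) →
    (Path.Homotopic.Quotient.mk (r v x hx)).trans (Path.Homotopic.Quotient.mk γ) =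
      Path.Homotopic.Quotient.mk (r v y hy)
  c : V → V → X → P
  c_locally_const : ∀ v w, ∀ x ∈ W v ∩ W w, ∀ᶠ y in 𝓝 x, c v w y = c v w x
  c_mul : ∀ v w z, ∀ x ∈ W v ∩ W w ∩ W z, c v w x * c w z x = c v z x

namespace SmallCover

variable {X : Type} [TopologicalSpace X] {P : Type} [Group P] (C : SmallCover X P)

theorem c_self {v : C.V} {x : X} (hx : x ∈ C.W v) : C.c v v x = 1 := by
  have := C.c_mul v v v x ⟨⟨hx, hx⟩, hx⟩
  simpa using this

/-- The class of the path `r v x`. -/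
def R (v : C.V) (x : X) (hx : x ∈ C.W v) : Path.Homotopic.Quotient (C.base v) x :=
  Path.Homotopic.Quotient.mk (C.r v x hx)

theorem R_trans {v : C.V} {x y : X} (hx : x ∈ C.W v) (hy : y ∈ C.W v) (γ : Path x y)
    (h : ∀ t, γ t ∈ C.W v) : (C.R v x hx).trans (Path.Homotopic.Quotient.mk γ) = C.R v y hy :=
  C.r_trans v x y hx hy γ h

/-- The path `r` at the base point need not be constant. Applying `r_trans` to this path itself
shows that its class is idempotent, hence trivial. -/
theorem R_base (v : C.V) : C.R v (C.base v) (C.base_mem v) = Path.Homotopic.Quotient.refl _ := by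
  have := C.R_trans (C.base_mem v) (C.base_mem v) (C.r v _ (C.base_mem v)) (C.r_mem v _ _)
  refine Path.Homotopic.Quotient.trans_left_cancel (p := C.R v (C.base v) (C.base_mem v)) ?_
  rw [Path.Homotopic.Quotient.trans_refl]
  exact this

/-- The class of the path between base points through a point of the intersection. -/
noncomputable def step (v w : C.V) (x : X) (hx : x ∈ C.W v ∩ C.W w) :
    Path.Homotopic.Quotient (C.base v) (C.base w) :=
  (C.R v x hx.1).trans (C.R w x hx.2).symm

theorem step_eq (v w : C.V) (x : X) (hx : x ∈ C.W v ∩ C.W w) :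
    C.step v w x hx = (C.R v x hx.1).trans (C.R w x hx.2).symm := rfl

/-! ### The covering space of a cocycle and its monodromy -/

section Covering

open Classical in
/-- The covering space defined by the cocycle. -/
noncomputable def core [TopologicalSpace P] [DiscreteTopology P] : FiberBundleCore C.V X P where
  baseSet := C.W
  isOpen_baseSet := C.isOpen
  indexAt x := (C.cover x).choose
  mem_baseSet_at x := (C.cover x).choose_spec
  coordChange v w x a := a * C.c v w x
  coordChange_self v x hx a := by rw [C.c_self hx, mul_one]
  continuousOn_coordChange v w := by
    rintro ⟨x, a⟩ ⟨hx, -⟩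
    refine ContinuousAt.continuousWithinAt ?_
    have : (fun p : X × P => p.2 * C.c v w p.1) =ᶠ[𝓝 (x, a)] fun p => p.2 * C.c v w x := by
      have h := (continuousAt_fst (p := (x, a))).eventually (C.c_locally_const v w x hx)
      filter_upwards [h] with p hp
      rw [hp]
    exact ContinuousAt.congr (by fun_prop) this.symm
  coordChange_comp v w z x hx a := by rw [mul_assoc, C.c_mul v w z x hx]

theorem isCoveringMap [TopologicalSpace P] [DiscreteTopology P] : IsCoveringMap C.core.proj :=
  FiberBundle.isCoveringMap (F := P) (E := C.core.Fiber)

variable [TopologicalSpace P] [DiscreteTopology P]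

/-- The point of the fibre over `x` with coordinate `a` in the chart `v`. -/
noncomputable def pt (v : C.V) (x : X) (a : P) : C.core.proj ⁻¹' {x} :=
  ⟨⟨x, C.core.coordChange v (C.core.indexAt x) x a⟩, rfl⟩

theorem pt_eq {v w : C.V} {x : X} (hx : x ∈ C.W v ∩ C.W w) (a : P) :
    C.pt v x a = C.pt w x (a * C.c v w x) := by
  have : a * C.c v (C.core.indexAt x) x = a * C.c v w x * C.c w (C.core.indexAt x) x := by
    rw [mul_assoc, C.c_mul v w _ x ⟨hx, C.core.mem_baseSet_at x⟩]
  exact Subtype.ext (congrArg (fun b : P => (⟨x, b⟩ : C.core.TotalSpace)) this)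

/-- The coordinate in the chart `v`. -/
noncomputable def coord (v : C.V) {x : X} (e : C.core.proj ⁻¹' {x}) : P :=
  HMul.hMul (α := P) (β := P) e.1.2 (C.c (C.core.indexAt e.1.1) v e.1.1)

theorem coord_pt {v : C.V} {x : X} (hx : x ∈ C.W v) (a : P) : C.coord v (C.pt v x a) = a := by
  change a * C.c v (C.core.indexAt x) x * C.c (C.core.indexAt x) v x = a
  rw [mul_assoc, C.c_mul v _ v x ⟨⟨hx, C.core.mem_baseSet_at x⟩, hx⟩, C.c_self hx, mul_one]

theorem pt_coord {v : C.V} {x : X} (hx : x ∈ C.W v) (e : C.core.proj ⁻¹' {x}) :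
    C.pt v x (C.coord v e) = e := by
  obtain ⟨⟨y, b⟩, rfl⟩ := e
  obtain ⟨a, rfl⟩ : ∃ a : P, a = b := ⟨b, rfl⟩
  replace hx : y ∈ C.W v := hx
  have : a * C.c (C.core.indexAt y) v y * C.c v (C.core.indexAt y) y = a := by
    rw [mul_assoc, C.c_mul _ v _ y ⟨⟨C.core.mem_baseSet_at y, hx⟩, C.core.mem_baseSet_at y⟩,
      C.c_self (C.core.mem_baseSet_at y), mul_one]
  exact Subtype.ext (congrArg (fun b : P => (⟨y, b⟩ : C.core.TotalSpace)) this)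

/-- Points with the constant coordinate `a` in the chart `v` form a lift of a path inside `W v`;
uniqueness of lifts does the rest. -/
theorem monodromy_pt {v : C.V} {x y : X} (γ : Path x y) (h : ∀ t, γ t ∈ C.W v) (a : P) :
    C.isCoveringMap.monodromy (Path.Homotopic.Quotient.mk γ) (C.pt v x a) = C.pt v y a := by
  have cont : Continuous fun t => ((C.pt v (γ t) a).1 : C.core.TotalSpace) := by
    have h1 : Continuous fun t => (γ t, a) := by fun_prop
    have h2 := (C.core.localTriv v).continuousOn_invFun.comp_continuous h1 (fun t => by
      exact (C.core.localTriv v).mk_mem_target.2 (h t))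
    exact h2
  have key := C.isCoveringMap.eq_liftPath_iff' (γ := (γ : C(unitInterval, X))) (e := (C.pt v x a).1)
    (show γ 0 = x from γ.source) (Γ := ⟨_, cont⟩)
  have h3 := key.2 ⟨funext fun t => rfl, by
    change (C.pt v (γ 0) a).1 = _
    rw [γ.source]⟩
  refine Subtype.ext ?_
  have h4 := congrArg (fun f : C(unitInterval, C.core.TotalSpace) => f 1) h3
  simp only [ContinuousMap.coe_mk] at h4
  change C.isCoveringMap.liftPath _ _ _ 1 = _
  rw [γ.target] at h4
  exact h4.symm

theorem monodromy_R {v : C.V} {x : X} (hx : x ∈ C.W v) (a : P) :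
    C.isCoveringMap.monodromy (C.R v x hx) (C.pt v (C.base v) a) = C.pt v x a :=
  C.monodromy_pt _ (C.r_mem v x hx) a

theorem monodromy_R_symm {v : C.V} {x : X} (hx : x ∈ C.W v) (a : P) :
    C.isCoveringMap.monodromy (C.R v x hx).symm (C.pt v x a) = C.pt v (C.base v) a := by
  rw [← C.monodromy_R hx a, ← C.isCoveringMap.monodromy_trans_apply, Path.Homotopic.Quotient.trans_symm,
    C.isCoveringMap.monodromy_refl, id]

/-- The coordinate stays constant in the chart `v` on the way to `x` and in the chart `w` on the way
from `x`, so only the change of charts at `x` contributes. -/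
theorem monodromy_step {v w : C.V} {x : X} (hx : x ∈ C.W v ∩ C.W w) (a : P) :
    C.isCoveringMap.monodromy (C.step v w x hx) (C.pt v (C.base v) a) =
      C.pt w (C.base w) (a * C.c v w x) := by
  rw [step, C.isCoveringMap.monodromy_trans_apply, C.monodromy_R, C.pt_eq hx, C.monodromy_R_symm]

end Covering

/-- The holonomy of a class is the coordinate of the end of its lift that starts at `1`. It serves
to tell apart the path classes produced by different elements of `P`. -/
theorem exists_holonomy (v₀ : C.V) :
    ∃ hol : (Σ v, Path.Homotopic.Quotient (C.base v₀) (C.base v)) → P, hol ⟨v₀, Path.Homotopic.Quotient.refl _⟩ = 1 ∧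
      ∀ v w x (hx : x ∈ C.W v ∩ C.W w) (p : Path.Homotopic.Quotient (C.base v₀) (C.base v)),
        hol ⟨w, p.trans (C.step v w x hx)⟩ = hol ⟨v, p⟩ * C.c v w x := by
  -- The discrete topology makes the bundle with fibre `P` a covering.
  let _ : TopologicalSpace P := ⊥
  have : DiscreteTopology P := ⟨rfl⟩
  refine ⟨fun ω => C.coord ω.1 (C.isCoveringMap.monodromy ω.2 (C.pt v₀ (C.base v₀) 1)), ?_, ?_⟩
  · simp only [C.isCoveringMap.monodromy_refl, id]
    exact C.coord_pt (C.base_mem v₀) 1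
  · intro v w x hx p
    simp only [C.isCoveringMap.monodromy_trans_apply]
    rw [← C.pt_coord (C.base_mem v) (C.isCoveringMap.monodromy p (C.pt v₀ (C.base v₀) 1)),
      C.monodromy_step, C.coord_pt (C.base_mem w), C.coord_pt (C.base_mem v)]

/-! ### Group actions on path classes -/

section Action

variable (v₀ : C.V) (act : P →* (Equiv.Perm (Σ v, Path.Homotopic.Quotient (C.base v₀) (C.base v)))ᵐᵒᵖ)

/-- Up to homotopy every path is a chain of steps: a fine subdivision puts each piece into one set
of the cover, and the values of the cocycle at the division points multiply to `g`. -/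
theorem exists_act_eq_subpath
    (hact : ∀ v w x (hx : x ∈ C.W v ∩ C.W w) (p : Path.Homotopic.Quotient (C.base v₀) (C.base v)),
      (act (C.c v w x)).unop ⟨v, p⟩ = ⟨w, p.trans (C.step v w x hx)⟩)
    {y : X} (γ : Path (C.base v₀) y) (w : C.V) (hw : y ∈ C.W w) :
    ∃ g, (act g).unop ⟨v₀, Path.Homotopic.Quotient.refl _⟩ =
      ⟨w, (Path.Homotopic.Quotient.mk γ).trans (C.R w y hw).symm⟩ := by
  obtain ⟨t, t0, tmono, ⟨m, hm⟩, ht⟩ := exists_monotone_Icc_subset_open_cover_unitInterval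
    (c := fun v => γ ⁻¹' C.W v) (fun v => (C.isOpen v).preimage γ.continuous) (fun s _ => by
      obtain ⟨v, hv⟩ := C.cover (γ s)
      exact Set.mem_iUnion.2 ⟨v, hv⟩)
  -- The final chart `w` is left arbitrary: the induction hypothesis is used for the set `v`
  -- containing the next piece, and the chart changes from `v` to `w` only at the end of that piece.
  have key : ∀ (n : ℕ) (w : C.V) (hw : γ (t n) ∈ C.W w), ∃ g,
      (act g).unop ⟨v₀, Path.Homotopic.Quotient.refl _⟩ =
        ⟨w, ((Path.Homotopic.Quotient.mk (γ.subpath 0 (t n))).cast γ.source.symm rfl).trans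
          (C.R w _ hw).symm⟩ := by
    intro n
    induction n with
    | zero =>
      intro w hw
      rw [t0] at hw
      have hw' : C.base v₀ ∈ C.W w := by simpa using hw
      refine ⟨C.c v₀ w (C.base v₀), ?_⟩
      rw [hact _ _ _ (Set.mem_inter (C.base_mem v₀) hw'), Path.Homotopic.Quotient.refl_trans, C.step_eq, C.R_base,
        Path.Homotopic.Quotient.refl_trans]
      congr 1
      have : ∀ (s : unitInterval) (hs : s = 0) (h : γ s ∈ C.W w),
          ((Path.Homotopic.Quotient.mk (γ.subpath 0 s)).cast γ.source.symm rfl).trans (C.R w _ h).symm =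
            (C.R w _ hw').symm := by
        rintro s rfl h
        have : ∀ (x : X) (hx : x = C.base v₀) (h : x ∈ C.W w),
          ((Path.Homotopic.Quotient.refl x).cast hx.symm rfl).trans (C.R w _ h).symm =
            (C.R w _ hw').symm := by
          rintro x rfl h
          rw [Path.Homotopic.Quotient.cast_rfl_rfl, Path.Homotopic.Quotient.refl_trans]
        rw [Path.subpath_self]
        exact this _ γ.source h
      exact (this _ t0 _).symm
    | succ n ih =>
      intro w hw
      obtain ⟨v, hv⟩ := ht n
      have hle := tmono n.le_succ
      have hn : γ (t n) ∈ C.W v := hv ⟨le_rfl, hle⟩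
      have hn1 : γ (t (n + 1)) ∈ C.W v := hv ⟨hle, le_rfl⟩
      obtain ⟨g, hg⟩ := ih v hn
      refine ⟨g * C.c v w (γ (t (n + 1))), ?_⟩
      rw [map_mul, MulOpposite.unop_mul, Equiv.Perm.mul_apply, hg, hact _ _ _ (Set.mem_inter hn1 hw)]
      congr 1
      have h1 : Path.Homotopic.Quotient.mk (γ.subpath 0 (t (n + 1))) =
          (Path.Homotopic.Quotient.mk (γ.subpath 0 (t n))).trans
            (Path.Homotopic.Quotient.mk (γ.subpath (t n) (t (n + 1)))) := by
        rw [← Path.Homotopic.Quotient.mk_trans]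
        exact (Path.Homotopic.Quotient.eq.2 ⟨Path.Homotopy.subpathTransSubpath γ _ _ _⟩).symm
      have h2 := C.R_trans hn hn1 (γ.subpath (t n) (t (n + 1))) (fun s => by
        have : γ.subpath (t n) (t (n + 1)) s ∈ Set.range (γ.subpath (t n) (t (n + 1))) := ⟨s, rfl⟩
        rw [γ.range_subpath_of_le _ _ hle] at this
        obtain ⟨u, hu, hus⟩ := this
        rw [← hus]
        exact hv hu)
      have h3 : ∀ {a b c d : X} (hab : b = a) (p : Path.Homotopic.Quotient a c) (q : Path.Homotopic.Quotient c d),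
          (p.trans q).cast hab rfl = (p.cast hab rfl).trans q := by
        rintro a b c d rfl p q
        rw [Path.Homotopic.Quotient.cast_rfl_rfl, Path.Homotopic.Quotient.cast_rfl_rfl]
      rw [h1, h3, C.step_eq, ← h2]
      simp only [Path.Homotopic.Quotient.trans_assoc, Path.Homotopic.Quotient.symm_trans_cancel]
  have h1 : ∀ s (_ : s = 1) (hs : γ s ∈ C.W w),
      (⟨w, ((Path.Homotopic.Quotient.mk (γ.subpath 0 s)).cast γ.source.symm rfl).trans (C.R w _ hs).symm⟩ :
        Σ v, Path.Homotopic.Quotient (C.base v₀) (C.base v)) =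
      ⟨w, (Path.Homotopic.Quotient.mk γ).trans (C.R w y hw).symm⟩ := by
    rintro s rfl hs
    congr 1
    have : ∀ (x : X) (hx : x = y) (h : x ∈ C.W w),
        ((Path.Homotopic.Quotient.mk γ).cast rfl hx).trans (C.R w _ h).symm =
          (Path.Homotopic.Quotient.mk γ).trans (C.R w _ hw).symm := by
      rintro x rfl h
      rw [Path.Homotopic.Quotient.cast_rfl_rfl]
    rw [Path.subpath_zero_one, Path.Homotopic.Quotient.mk_cast, Path.Homotopic.Quotient.cast_cast]
    exact this _ γ.target hs
  have hm' : γ (t m) ∈ C.W w := by rw [hm m le_rfl]; simpa using hw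
  obtain ⟨g, hg⟩ := key m w hm'
  exact ⟨g, hg.trans (h1 _ (hm m le_rfl) _)⟩

/-- The fundamental group of a space with a small cover and a cocycle with values in `P`, if the
cocycle is realised by a transitive action on path classes. -/
theorem fundamentalGroup_equiv
    (hact : ∀ v w x (hx : x ∈ C.W v ∩ C.W w) (p : Path.Homotopic.Quotient (C.base v₀) (C.base v)),
      (act (C.c v w x)).unop ⟨v, p⟩ = ⟨w, p.trans (C.step v w x hx)⟩)
    (S : Set P) (hS : Subgroup.closure S = ⊤)
    (hSc : ∀ a ∈ S, ∀ v, ∃ w, ∃ x ∈ C.W v ∩ C.W w, C.c v w x = a)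
    (K : Subgroup P)
    (hK : ∀ g, g ∈ K ↔ ((act g).unop ⟨v₀, Path.Homotopic.Quotient.refl _⟩).1 = v₀) :
    Nonempty (FundamentalGroup X (C.base v₀) ≃* K) := by
  obtain ⟨hol, hol1, hol2⟩ := C.exists_holonomy v₀
  have act_mul : ∀ g h ω, (act (g * h)).unop ω = (act h).unop ((act g).unop ω) := fun g h ω => by
    rw [map_mul, MulOpposite.unop_mul, Equiv.Perm.mul_apply]
  have act_one : ∀ ω, (act 1).unop ω = ω := fun ω => by simp
  have act_inv : ∀ g ω, (act g).unop ((act g⁻¹).unop ω) = ω := fun g ω => by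
    rw [← act_mul, inv_mul_cancel, act_one]
  -- Equivariance of the holonomy is checked on generators, each of which is a value of the cocycle
  -- at every `v`. It makes the action free, since `g` is the holonomy of the image of the trivial
  -- class under `g`.
  have hol_act : ∀ g ω, hol ((act g).unop ω) = hol ω * g := by
    intro g
    have hg : g ∈ Subgroup.closure S := by rw [hS]; trivial
    induction hg using Subgroup.closure_induction with
    | mem a ha =>
      rintro ⟨v, p⟩
      obtain ⟨w, x, hx, rfl⟩ := hSc a ha v
      rw [hact v w x hx, hol2]
    | one => intro ω; rw [act_one, mul_one]
    | mul g h _ _ hg hh => intro ω; rw [act_mul, hh, hg, mul_assoc]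
    | inv g _ hg =>
      intro ω
      rw [eq_mul_inv_iff_mul_eq, ← hg, act_inv]
  let L : Path.Homotopic.Quotient (C.base v₀) (C.base v₀) →
      (Σ v, Path.Homotopic.Quotient (C.base v₀) (C.base v)) →
      Σ v, Path.Homotopic.Quotient (C.base v₀) (C.base v) := fun q ω => ⟨ω.1, q.trans ω.2⟩
  -- The action modifies paths at their end, so it commutes with prefixing a loop. This makes `f`
  -- below multiplicative.
  have act_left : ∀ g q ω, (act g).unop (L q ω) = L q ((act g).unop ω) := by
    intro g q
    have hg : g ∈ Subgroup.closure S := by rw [hS]; trivial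
    induction hg using Subgroup.closure_induction with
    | mem a ha =>
      rintro ⟨v, p⟩
      obtain ⟨w, x, hx, rfl⟩ := hSc a ha v
      rw [hact v w x hx, hact v w x hx]
      simp only [L, Path.Homotopic.Quotient.trans_assoc]
    | one => intro ω; rw [act_one, act_one]
    | mul g h _ _ hg hh => intro ω; rw [act_mul, act_mul, hg, hh]
    | inv g _ hg =>
      intro ω
      apply (act g).unop.injective
      rw [act_inv, hg, act_inv]
  have trans : ∀ p : Path.Homotopic.Quotient (C.base v₀) (C.base v₀), ∃ g,
      (act g).unop ⟨v₀, Path.Homotopic.Quotient.refl _⟩ = ⟨v₀, p⟩ := by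
    intro p
    obtain ⟨γ, rfl⟩ := Path.Homotopic.Quotient.mk_surjective p
    obtain ⟨g, hg⟩ := C.exists_act_eq_subpath v₀ act hact γ v₀ (C.base_mem v₀)
    refine ⟨g, hg.trans ?_⟩
    rw [C.R_base]
    congr 1
    refine Path.Homotopic.Quotient.trans_left_cancel (p := (Path.Homotopic.Quotient.mk γ).symm) ?_
    rw [Path.Homotopic.Quotient.symm_trans_cancel, Path.Homotopic.Quotient.symm_trans]
    have := Path.Homotopic.Quotient.symm_trans (Path.Homotopic.Quotient.refl (C.base v₀))
    rwa [Path.Homotopic.Quotient.trans_refl] at this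
  choose f hf using trans
  have hfK : ∀ p, f p ∈ K := fun p => (hK _).2 (by rw [hf])
  have hf_mul : ∀ p q, f (p.trans q) = f p * f q := by
    intro p q
    have h : (act (f p * f q)).unop ⟨v₀, Path.Homotopic.Quotient.refl _⟩ =
        (act (f (p.trans q))).unop ⟨v₀, Path.Homotopic.Quotient.refl _⟩ := by
      rw [act_mul, hf, hf]
      have := act_left (f q) p ⟨v₀, Path.Homotopic.Quotient.refl _⟩
      simp only [hf, L, Path.Homotopic.Quotient.trans_refl] at this
      exact this
    have := congrArg hol h
    rw [hol_act, hol_act, hol1, one_mul, one_mul] at this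
    exact this.symm
  have hf_inj : Function.Injective f := by
    intro p q h
    have h1 := hf p
    rw [h, hf q] at h1
    simpa using h1.symm
  have hf_surj : ∀ g ∈ K, ∃ p, f p = g := by
    intro g hg
    have hg' := (hK g).1 hg
    obtain ⟨p, hp⟩ : ∃ p, (act g).unop ⟨v₀, Path.Homotopic.Quotient.refl _⟩ =
        (⟨v₀, p⟩ : Σ v, Path.Homotopic.Quotient (C.base v₀) (C.base v)) := by
      generalize (act g).unop ⟨v₀, Path.Homotopic.Quotient.refl _⟩ = ω at hg'
      obtain ⟨v, p⟩ := ω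
      obtain rfl : v = v₀ := hg'
      exact ⟨p, rfl⟩
    refine ⟨p, ?_⟩
    have h := (hf p).trans hp.symm
    have := congrArg hol h
    rwa [hol_act, hol_act, hol1, one_mul, one_mul] at this
  -- The product `p * q` in `FundamentalGroup` is the concatenation of `q` followed by `p`, so `f`
  -- reverses products and the inverse is needed.
  let F : FundamentalGroup X (C.base v₀) →* K :=
    { toFun := fun p => ⟨(f p)⁻¹, K.inv_mem (hfK p)⟩
      map_one' := by
        have := hf_mul (Path.Homotopic.Quotient.refl _) (Path.Homotopic.Quotient.refl _)
        rw [Path.Homotopic.Quotient.refl_trans, left_eq_mul] at this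
        exact Subtype.ext (inv_eq_one.2 this)
      map_mul' := fun p q => Subtype.ext (by
        change (f (Path.Homotopic.Quotient.trans q p))⁻¹ = (f p)⁻¹ * (f q)⁻¹
        rw [hf_mul, mul_inv_rev]) }
  refine ⟨MulEquiv.ofBijective F ⟨?_, ?_⟩⟩
  · intro p q h
    exact hf_inj (inv_injective (congrArg Subtype.val h))
  · rintro ⟨g, hg⟩
    obtain ⟨p, hp⟩ := hf_surj g⁻¹ (K.inv_mem hg)
    refine ⟨p, Subtype.ext ?_⟩
    change (f p)⁻¹ = g
    rw [hp, inv_inv]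

end Action

end SmallCover

/-! ## Faces and flips of planar forests -/

/-- The embedding of a one-element index set. -/
def Fin.singleEmb {d : ℕ} (i : Fin d) : Fin 1 ↪ Fin d :=
  ⟨fun _ => i, fun _ _ _ => Subsingleton.elim _ _⟩

namespace PlanarForest

variable {n d k : ℕ}

theorem ext_ord {τ τ' : PlanarForest n d} (h : ∀ i, τ.ord i = τ'.ord i) : τ = τ' := by
  cases τ; cases τ'
  congr
  exact funext h

/-- Thus a 0-cube of the complex amounts to its parameter in `(ℤ/2)^L`. -/
instance : Subsingleton (PlanarForest n 0) := ⟨fun _ _ => ext_ord fun i => i.elim0⟩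

theorem sgn_one (τ : PlanarForest n d) (a b : Fin n) : τ.sgn 1 a b = 1 := by simp [sgn]

theorem sgn_mulSingle (τ : PlanarForest n d) (i : Fin d) (u : ℤˣ) (a b : Fin n) :
    τ.sgn (Pi.mulSingle i u) a b =
      if a ∈ (τ.ord i).carrier ∧ b ∈ (τ.ord i).carrier then u else 1 := by
  rw [sgn, Finset.prod_eq_single i]
  · rw [Pi.mulSingle_eq_same]
  · intro j _ hj
    rw [Pi.mulSingle_eq_of_ne hj, ite_self]
  · simp

theorem flipLt_one (τ : PlanarForest n d) (i : Fin d) : τ.flipLt 1 i = (τ.ord i).lt := by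
  funext a b
  rw [flipLt, sgn_one, if_pos rfl]

theorem pull_one_ord (τ : PlanarForest n d) (ι : Fin k ↪ Fin d) (j : Fin k) :
    (τ.pull ι 1).ord j = τ.ord (ι j) := OrdSubset.ext rfl (τ.flipLt_one _)

/-- The reversal of the planar order at the vertices above the edges `i` with `σ i = -1`. -/
def flip (σ : Fin d → ℤˣ) (τ : PlanarForest n d) : PlanarForest n d :=
  τ.pull (Function.Embedding.refl _) σ

/-- The reversal of the planar order at the vertices above the edge `i`. -/
def flipAt (i : Fin d) (τ : PlanarForest n d) : PlanarForest n d := τ.flip (Pi.mulSingle i (-1))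

/-- The forest with a single internal edge, obtained by collapsing the other ones. -/
def edge (τ : PlanarForest n d) (i : Fin d) : PlanarForest n 1 := τ.pull (Fin.singleEmb i) 1

theorem edge_ord (τ : PlanarForest n d) (i : Fin d) (j : Fin 1) : (τ.edge i).ord j = τ.ord i :=
  τ.pull_one_ord _ _

theorem flipAt_lt (τ : PlanarForest n d) (i j : Fin d) (a b : Fin n) :
    ((τ.flipAt i).ord j).lt a b ↔
      if a ∈ (τ.ord i).carrier ∧ b ∈ (τ.ord i).carrier then (τ.ord j).lt b a
      else (τ.ord j).lt a b := by
  change τ.flipLt _ j a b ↔ _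
  rw [flipLt, sgn_mulSingle]
  split_ifs <;> simp_all

theorem type_injective (τ : PlanarForest n d) : Function.Injective τ.type := fun _ _ h =>
  τ.carrier_injective (congrArg Subtype.val h)

theorem eq_of_ord_zero {e e' : PlanarForest n 1} (h : e.ord 0 = e'.ord 0) : e = e' :=
  ext_ord fun i => by rw [Subsingleton.elim i 0, h]

/-- Ordered subsets that can be the ordered sets above two edges of a planar forest. -/
def Compat (e e' : PlanarForest n 1) : Prop :=
  (e.ord 0).carrier ≠ (e'.ord 0).carrier ∧
    (Disjoint (e.ord 0).carrier (e'.ord 0).carrier ∨ (e.ord 0).IsIntervalOf (e'.ord 0) ∨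
      (e'.ord 0).IsIntervalOf (e.ord 0))

theorem compat_edge (τ : PlanarForest n d) {i j : Fin d} (h : i ≠ j) :
    Compat (τ.edge i) (τ.edge j) := by
  rw [Compat, edge_ord, edge_ord]
  exact ⟨fun h' => h (τ.carrier_injective h'), τ.compat i j⟩

/-- The forest with given edges, pairwise compatible. -/
def ofEdges (e : Fin k → PlanarForest n 1) (h : ∀ i j, i ≠ j → Compat (e i) (e j)) :
    PlanarForest n k where
  ord i := (e i).ord 0
  two_le i := (e i).two_le 0
  carrier_injective i j hij := by
    by_contra hne
    exact (h i j hne).1 hij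
  compat i j := by
    by_cases hij : i = j
    · subst hij
      exact Or.inr (Or.inl ⟨subset_rfl, fun _ _ _ _ => Iff.rfl,
        fun a _ b _ c hac _ => ((e i).ord 0).mem_right _ _ hac⟩)
    · exact (h i j hij).2

theorem ofEdges_edge (e : Fin k → PlanarForest n 1) (h : ∀ i j, i ≠ j → Compat (e i) (e j))
    (i : Fin k) : (ofEdges e h).edge i = e i :=
  eq_of_ord_zero (edge_ord _ _ _)

end PlanarForest

/-! ## The cube complex is special -/

namespace cactusCover

open PlanarForest

variable {n d k : ℕ}

theorem pull_one (c : (cactusCover n).cell d) (ι : Fin k ↪ Fin d) :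
    (cactusCover n).pull ι 1 c = (c.1.pull ι 1, c.2) := by
  refine Prod.ext rfl ?_
  change c.2 * ∏ i, Pi.mulSingle (c.1.type i) ((1 : Fin d → ℤˣ) i) = c.2
  simp

theorem edge_eq (c : (cactusCover n).cell d) (i : Fin d) :
    (cactusCover n).edge c i = (c.1.edge i, c.2) := pull_one c _

theorem corner_eq_iff (c : (cactusCover n).cell d) (c' : (cactusCover n).cell k) :
    (cactusCover n).corner c = (cactusCover n).corner c' ↔ c.2 = c'.2 := by
  rw [CubeComplex.corner, CubeComplex.corner, pull_one, pull_one]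
  exact ⟨congrArg Prod.snd, fun h => Prod.ext (Subsingleton.elim (α := PlanarForest n 0) _ _) h⟩

theorem prod_mulSingle_mulSingle (τ : PlanarForest n d) (i : Fin d) (u : ℤˣ) :
    (∏ j, Pi.mulSingle (τ.type j) ((Pi.mulSingle i u : Fin d → ℤˣ) j) : LabelSet n → ℤˣ) =
      Pi.mulSingle (τ.type i) u := by
  rw [Finset.prod_eq_single i]
  · rw [Pi.mulSingle_eq_same]
  · intro j _ hj
    rw [Pi.mulSingle_eq_of_ne hj, Pi.mulSingle_one]
  · simp

theorem reflect_eq (c : (cactusCover n).cell d) (i : Fin d) :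
    (cactusCover n).reflect i c = (c.1.flipAt i, c.2 * Pi.mulSingle (c.1.type i) (-1)) :=
  Prod.ext rfl (congrArg (c.2 * ·) (prod_mulSingle_mulSingle c.1 i (-1)))

/-- A square with a given corner is a forest with two internal edges, that is, a compatible pair of
ordered subsets. Passing to a face with coordinates `1` does not change the parameter. -/
theorem formCorner_iff (e e' : (cactusCover n).cell 1) :
    (cactusCover n).FormCorner e e' ↔ e.2 = e'.2 ∧ Compat e.1 e'.1 := by
  constructor
  · rintro ⟨q, rfl, rfl⟩
    rw [edge_eq, edge_eq]
    exact ⟨rfl, compat_edge _ (by decide)⟩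
  · rintro ⟨hs, hc⟩
    have hsymm : Compat e'.1 e.1 := ⟨hc.1.symm, by
      rcases hc.2 with h | h | h
      · exact Or.inl h.symm
      · exact Or.inr (Or.inr h)
      · exact Or.inr (Or.inl h)⟩
    have h : ∀ i j, i ≠ j → Compat (![e.1, e'.1] i) (![e.1, e'.1] j) := by
      intro i j hij
      fin_cases i <;> fin_cases j <;> first | exact absurd rfl hij | assumption
    exact ⟨(ofEdges ![e.1, e'.1] h, e.2),
      (edge_eq _ _).trans (Prod.ext (ofEdges_edge _ h 0) rfl),
      (edge_eq _ _).trans (Prod.ext (ofEdges_edge _ h 1) hs)⟩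

/-- The link of every 0-cube has the ordered subsets as vertices and the pairwise compatible
families as simplices. Flagness holds because the axioms of a planar forest involve at most two
edges at a time. -/
theorem nonpositivelyCurved (n : ℕ) : (cactusCover n).NonpositivelyCurved where
  edge_injective c i j h := by
    rw [edge_eq, edge_eq] at h
    have h1 := congrArg (fun e : PlanarForest n 1 => (e.ord 0).carrier) (congrArg Prod.fst h)
    simp only [edge_ord] at h1
    exact c.1.carrier_injective h1
  ext_edge c c' hc h := by
    refine Prod.ext (ext_ord fun i => ?_) ((corner_eq_iff _ _).1 hc)
    have h1 := h i
    rw [edge_eq, edge_eq] at h1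
    have h2 := congrArg (fun e : PlanarForest n 1 => e.ord 0) (congrArg Prod.fst h1)
    simpa only [edge_ord] using h2
  flag v k e he h := by
    have hv : ∀ (d : ℕ) (c : (cactusCover n).cell d),
        (cactusCover n).corner c = v ↔ c.2 = v.2 := by
      intro d c
      rw [CubeComplex.corner, pull_one]
      exact ⟨congrArg Prod.snd,
        fun h => Prod.ext (Subsingleton.elim (α := PlanarForest n 0) _ _) h⟩
    have hc : ∀ i j, i ≠ j → Compat (e i).1 (e j).1 := fun i j hij =>
      ((formCorner_iff _ _).1 (h i j hij)).2
    exact ⟨(ofEdges (fun i => (e i).1) hc, v.2), (hv _ _).2 rfl, fun i =>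
      (edge_eq _ _).trans (Prod.ext (ofEdges_edge _ hc i) ((hv _ _).1 (he i)).symm)⟩

/-- The sign by which the order of `a` and `b` differs from their order at the vertex `1`. -/
def twist (s : LabelSet n → ℤˣ) (a b : Fin n) : ℤˣ :=
  ∏ B : LabelSet n, if a ∈ B.1 ∧ b ∈ B.1 then s B else 1

theorem twist_mul (s t : LabelSet n → ℤˣ) (a b : Fin n) :
    twist (s * t) a b = twist s a b * twist t a b := by
  rw [twist, twist, twist, ← Finset.prod_mul_distrib]
  refine Finset.prod_congr rfl fun B _ => ?_
  split_ifs <;> simp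

theorem twist_mulSingle (S : LabelSet n) (u : ℤˣ) (a b : Fin n) :
    twist (Pi.mulSingle S u) a b = if a ∈ S.1 ∧ b ∈ S.1 then u else 1 := by
  rw [twist, Finset.prod_eq_single S]
  · rw [Pi.mulSingle_eq_same]
  · intro B _ hB
    rw [Pi.mulSingle_eq_of_ne hB, ite_self]
  · simp

theorem twist_comm (s : LabelSet n → ℤˣ) (a b : Fin n) : twist s a b = twist s b a := by
  simp only [twist, and_comm]

/-- The subsets `B` and `C` are neither disjoint nor nested. -/
def Crosses (B C : Finset (Fin n)) : Prop := ¬ Disjoint B C ∧ ¬ B ⊆ C ∧ ¬ C ⊆ B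

open Classical in
/-- A complete invariant of the hyperplane dual to a 1-cube. -/
noncomputable def hyperplaneInvariant (e : (cactusCover n).cell 1) :
    Finset (Fin n) × (Fin n → Fin n → Prop) × (LabelSet n → ℤˣ) :=
  ((e.1.ord 0).carrier,
    fun a b => if twist e.2 a b = 1 then (e.1.ord 0).lt a b else (e.1.ord 0).lt b a,
    fun B => if Crosses B.1 (e.1.ord 0).carrier then e.2 B else 1)

-- Crossing a hyperplane of type `B` reverses the order of the pairs inside `B`, and the twist
-- changes sign on just these pairs, so the corrected order survives. Only the coordinate `B` of the
-- parameter changes, and it is not recorded because `B` does not cross the carrier. This covers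
-- both opposite sides of a square and, with `B` equal to the carrier, reversal.
open Classical in
theorem hyperplaneInvariant_eq_of_flip {e e' : (cactusCover n).cell 1} (B : LabelSet n)
    (h1 : (e'.1.ord 0).carrier = (e.1.ord 0).carrier)
    (h2 : ∀ a b, (e'.1.ord 0).lt a b ↔
      if a ∈ B.1 ∧ b ∈ B.1 then (e.1.ord 0).lt b a else (e.1.ord 0).lt a b)
    (h3 : e'.2 = e.2 * Pi.mulSingle B (-1)) (h4 : ¬ Crosses B.1 (e.1.ord 0).carrier) :
    hyperplaneInvariant e = hyperplaneInvariant e' := by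
  refine Prod.ext h1.symm (Prod.ext ?_ ?_)
  · funext a b
    simp only [hyperplaneInvariant]
    rw [h3, twist_mul, twist_mulSingle, h2 a b, h2 b a]
    simp only [and_comm (a := b ∈ B.1)]
    rcases Int.units_eq_one_or (twist e.2 a b) with h | h <;> rw [h] <;> split_ifs <;> simp_all
  · funext C
    change (if Crosses C.1 (e.1.ord 0).carrier then e.2 C else 1) =
      if Crosses C.1 (e'.1.ord 0).carrier then e'.2 C else 1
    by_cases hC : Crosses C.1 (e.1.ord 0).carrier
    · have hne : C ≠ B := by rintro rfl; exact h4 hC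
      have : e'.2 C = e.2 C := by
        rw [h3]
        exact (congrArg (e.2 C * ·) (Pi.mulSingle_eq_of_ne hne _)).trans (mul_one _)
      simp only [h1, this]
    · simp only [h1, if_neg hC]

theorem opposite_iff (e e' : (cactusCover n).cell 1) : (cactusCover n).Opposite e e' ↔
    ∃ (τ : PlanarForest n 2) (s : LabelSet n → ℤˣ), e = (τ.edge 0, s) ∧
      e' = ((τ.flipAt 1).edge 0, s * Pi.mulSingle (τ.type 1) (-1)) := by
  constructor
  · rintro ⟨q, rfl, rfl⟩
    exact ⟨q.1, q.2, edge_eq _ _, by rw [edge_eq, reflect_eq]⟩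
  · rintro ⟨τ, s, rfl, rfl⟩
    refine ⟨(τ, s), (edge_eq (d := 2) (τ, s) 0).symm, ((edge_eq _ _).trans ?_).symm⟩
    rw [reflect_eq (d := 2) (τ, s) 1]

theorem hyperplaneInvariant_eq_of_dual_eq {e e' : (cactusCover n).cell 1}
    (h : (cactusCover n).dual e = (cactusCover n).dual e') :
    hyperplaneInvariant e = hyperplaneInvariant e' := by
  refine congrArg (Quot.lift hyperplaneInvariant ?_) h
  rintro e e' (h | rfl)
  · obtain ⟨τ, s, rfl, rfl⟩ := (opposite_iff _ _).1 h
    refine hyperplaneInvariant_eq_of_flip (τ.type 1) ?_ ?_ rfl ?_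
    · rw [edge_ord, edge_ord]; rfl
    · intro a b
      rw [edge_ord, edge_ord, flipAt_lt]; rfl
    · rw [edge_ord]
      rintro ⟨ha, hb, hc⟩
      rcases τ.compat 1 0 with h | h | h
      · exact ha h
      · exact hb h.subset
      · exact hc h.subset
  · rw [CubeComplex.reverse, reflect_eq]
    exact hyperplaneInvariant_eq_of_flip (e.1.type 0) rfl (fun a b => flipAt_lt _ _ _ _ _) rfl
      fun h => h.2.1 subset_rfl

/-- The sign at the type of the 1-cube itself distinguishes its directions: a square changes the
sign of another type only, while reversal changes this one. -/
theorem twoSided (H : (cactusCover n).Hyperplane) : (cactusCover n).TwoSided H := by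
  intro e _ h
  have key : ∀ e e' : (cactusCover n).cell 1, (cactusCover n).Parallel e e' →
      e.2 (e.1.type 0) = e'.2 (e'.1.type 0) := by
    intro e e' h
    induction h with
    | rel e e' h =>
      obtain ⟨τ, s, rfl, rfl⟩ := (opposite_iff _ _).1 h
      have h1 : (τ.edge 0).type 0 = τ.type 0 := Subtype.ext (by simp only [type, edge_ord])
      have h2 : ((τ.flipAt 1).edge 0).type 0 = τ.type 0 :=
        Subtype.ext (by simp only [type, edge_ord]; rfl)
      have h3 : τ.type 0 ≠ τ.type 1 := fun h => by simpa using τ.type_injective h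
      simp only [h1, h2, Pi.mul_apply, Pi.mulSingle_eq_of_ne h3, mul_one]
    | refl => rfl
    | symm _ _ _ h => exact h.symm
    | trans _ _ _ _ _ h h' => exact h.trans h'
  have h1 := key _ _ h
  rw [CubeComplex.reverse, reflect_eq] at h1
  change e.2 (e.1.type 0) =
    e.2 (e.1.type 0) * (Pi.mulSingle (e.1.type 0) (-1) : LabelSet n → ℤˣ) (e.1.type 0) at h1
  rw [Pi.mulSingle_eq_same, left_eq_mul] at h1
  exact absurd h1 (by decide)

theorem carrier_eq_of_invariant_eq {e e' : (cactusCover n).cell 1}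
    (h : hyperplaneInvariant e = hyperplaneInvariant e') :
    (e.1.ord 0).carrier = (e'.1.ord 0).carrier := congrArg Prod.fst h

theorem lt_iff_of_invariant_eq {e e' : (cactusCover n).cell 1}
    (h : hyperplaneInvariant e = hyperplaneInvariant e') (a b : Fin n) :
    (e'.1.ord 0).lt a b ↔
      if twist e.2 a b * twist e'.2 a b = 1 then (e.1.ord 0).lt a b else (e.1.ord 0).lt b a := by
  have h1 := congrFun (congrFun (congrArg (fun x => x.2.1) h) a) b
  have h2 := congrFun (congrFun (congrArg (fun x => x.2.1) h) b) a
  simp only [hyperplaneInvariant, twist_comm _ b a] at h1 h2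
  rcases Int.units_eq_one_or (twist e.2 a b) with h | h <;>
    rcases Int.units_eq_one_or (twist e'.2 a b) with h' | h' <;> simp_all

theorem eq_of_invariant_eq_of_crosses {e e' : (cactusCover n).cell 1}
    (h : hyperplaneInvariant e = hyperplaneInvariant e') (B : LabelSet n)
    (hB : Crosses B.1 (e.1.ord 0).carrier) : e.2 B = e'.2 B := by
  have h1 := congrFun (congrArg (fun x => x.2.2) h) B
  have hB' : Crosses B.1 (e'.1.ord 0).carrier := carrier_eq_of_invariant_eq h ▸ hB
  simpa only [hyperplaneInvariant, if_pos hB, if_pos hB'] using h1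

/-- At a common 0-cube the two twists cancel, so a hyperplane has at most one dual directed 1-cube
originating there. This excludes self-osculation. -/
theorem eq_of_invariant_eq {e e' : (cactusCover n).cell 1}
    (h : hyperplaneInvariant e = hyperplaneInvariant e') (hs : e.2 = e'.2) : e = e' := by
  refine Prod.ext (eq_of_ord_zero (OrdSubset.ext (carrier_eq_of_invariant_eq h) ?_)) hs
  funext a b
  have := lt_iff_of_invariant_eq h a b
  rw [← hs, Int.units_mul_self, if_pos rfl] at this
  exact propext this.symm

/-- Between the two 0-cubes, only signs of sets that do not cross the smaller set can change.
Reversals by such sets keep the smaller set on one side of each outside label, so it remains an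
interval of the larger one. -/
theorem isIntervalOf_of_invariant_eq {e₁ e₂ f₁ f₂ : (cactusCover n).cell 1}
    (h₁ : hyperplaneInvariant e₁ = hyperplaneInvariant f₁)
    (h₂ : hyperplaneInvariant e₂ = hyperplaneInvariant f₂) (he : e₁.2 = e₂.2) (hf : f₁.2 = f₂.2)
    (h : (e₁.1.ord 0).IsIntervalOf (e₂.1.ord 0)) : (f₁.1.ord 0).IsIntervalOf (f₂.1.ord 0) := by
  have hc₁ := carrier_eq_of_invariant_eq h₁
  have hc₂ := carrier_eq_of_invariant_eq h₂
  refine ⟨hc₁ ▸ hc₂ ▸ h.subset, ?_, ?_⟩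
  · intro a ha b hb
    rw [← hc₁] at ha hb
    rw [lt_iff_of_invariant_eq h₁, lt_iff_of_invariant_eq h₂, he, hf, h.lt_iff a ha b hb,
      h.lt_iff b hb a ha]
  · intro a ha b hb c hac hcb
    by_contra hc
    rw [← hc₁] at ha hb hc
    -- The relative twist is a product over the sets `B` whose signs differ at the two 0-cubes. Such
    -- a `B` does not cross the smaller set; if it contains `c`, which lies outside, and one element
    -- of the smaller set, it contains all of that set. So `a` and `b` have the same relative twist
    -- with `c`.
    have hU : twist e₂.2 a c * twist f₂.2 a c = twist e₂.2 c b * twist f₂.2 c b := by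
      rw [twist_comm _ c b, twist_comm _ c b, ← twist_mul, ← twist_mul]
      refine Finset.prod_congr rfl fun B _ => ?_
      by_cases hB : Crosses B.1 (e₁.1.ord 0).carrier
      · have : (e₂.2 * f₂.2) B = 1 := by
          rw [← he, ← hf, Pi.mul_apply, eq_of_invariant_eq_of_crosses h₁ B hB, Int.units_mul_self]
        rw [this, ite_self, ite_self]
      · have key : ∀ x ∈ (e₁.1.ord 0).carrier, ∀ y ∈ (e₁.1.ord 0).carrier,
            x ∈ B.1 ∧ c ∈ B.1 → y ∈ B.1 ∧ c ∈ B.1 := by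
          rintro x hx y hy ⟨hxB, hcB⟩
          refine ⟨?_, hcB⟩
          by_contra hyB
          exact hB ⟨Finset.not_disjoint_iff.2 ⟨x, hxB, hx⟩, fun hs => hc (hs hcB),
            fun hs => hyB (hs hy)⟩
        have : (a ∈ B.1 ∧ c ∈ B.1) ↔ (b ∈ B.1 ∧ c ∈ B.1) := ⟨key a ha b hb, key b hb a ha⟩
        simp only [this]
    rw [lt_iff_of_invariant_eq h₂, hU] at hac
    rw [lt_iff_of_invariant_eq h₂] at hcb
    -- Both comparisons are kept or both are reversed; either way `c` was already between `a` and
    -- `b`.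
    split_ifs at hac hcb
    · exact hc (h.convex a ha b hb c hac hcb)
    · exact hc (h.convex b hb a ha c hcb hac)

theorem not_interOsculate (H₁ H₂ : (cactusCover n).Hyperplane) :
    ¬ ((cactusCover n).Intersect H₁ H₂ ∧ (cactusCover n).Osculate H₁ H₂) := by
  rintro ⟨⟨e₁, e₂, rfl, rfl, -, he⟩, ⟨f₁, f₂, h₁, h₂, -, hf, hn⟩⟩
  replace h₁ := hyperplaneInvariant_eq_of_dual_eq h₁.symm
  replace h₂ := hyperplaneInvariant_eq_of_dual_eq h₂.symm
  obtain ⟨hes, hne, hc⟩ := (formCorner_iff _ _).1 he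
  have hfs := (corner_eq_iff _ _).1 hf
  have hc₁ := carrier_eq_of_invariant_eq h₁
  have hc₂ := carrier_eq_of_invariant_eq h₂
  refine hn ((formCorner_iff _ _).2 ⟨hfs, hc₁ ▸ hc₂ ▸ hne, ?_⟩)
  rcases hc with h | h | h
  · exact Or.inl (hc₁ ▸ hc₂ ▸ h)
  · exact Or.inr (Or.inl (isIntervalOf_of_invariant_eq h₁ h₂ hes hfs h))
  · exact Or.inr (Or.inr (isIntervalOf_of_invariant_eq h₂ h₁ hes.symm hfs.symm h))

theorem isSpecial (n : ℕ) : (cactusCover n).IsSpecial where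
  nonpositivelyCurved := nonpositivelyCurved n
  twoSided := twoSided
  not_selfIntersect H := by
    rintro ⟨e, e', h, h', -, hc⟩
    exact ((formCorner_iff _ _).1 hc).2.1 (carrier_eq_of_invariant_eq
      (hyperplaneInvariant_eq_of_dual_eq (h.trans h'.symm)))
  not_selfOsculate H := by
    rintro ⟨e, e', h, h', hne, hc, -⟩
    exact hne (eq_of_invariant_eq (hyperplaneInvariant_eq_of_dual_eq (h.trans h'.symm))
      ((corner_eq_iff _ _).1 hc))
  not_interOsculate := not_interOsculate

end cactusCover

/-! ## The edge group and transport along cubes -/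

namespace PlanarForest

variable {n d k m : ℕ}

theorem pull_flip (τ : PlanarForest n d) (σ : Fin d → ℤˣ) (ι : Fin k ↪ Fin d)
    (ρ : Fin d → ℤˣ) : (τ.flip σ).pull ι ρ = τ.pull ι (σ * ρ) := by
  rw [flip, pull_pull]
  congr 1
  have : (Function.extend (Function.Embedding.refl (Fin d)) ρ 1) = ρ := by
    funext i
    exact (Function.Embedding.refl (Fin d)).injective.extend_apply ρ 1 i
  rw [this]

theorem flip_mul (τ : PlanarForest n d) (σ ρ : Fin d → ℤˣ) :
    (τ.flip σ).flip ρ = τ.flip (σ * ρ) := pull_flip _ _ _ _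

theorem flip_one (τ : PlanarForest n d) : τ.flip 1 = τ := τ.pull_id

theorem flip_pull (τ : PlanarForest n d) (ι : Fin k ↪ Fin d) (σ : Fin d → ℤˣ)
    (ρ : Fin k → ℤˣ) : (τ.pull ι σ).flip ρ = τ.pull ι (σ * Function.extend ι ρ 1) := by
  rw [flip, pull_pull]; rfl

theorem edge_pull (τ : PlanarForest n d) (ι : Fin k ↪ Fin d) (σ : Fin d → ℤˣ) (j : Fin k) :
    (τ.pull ι σ).edge j = τ.pull (Fin.singleEmb (ι j)) σ := by
  rw [edge, pull_pull]
  congr 1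
  have : (Function.extend ι (1 : Fin k → ℤˣ) 1) = 1 := by
    funext i
    by_cases hi : ∃ j, ι j = i
    · obtain ⟨j, rfl⟩ := hi
      rw [ι.injective.extend_apply]; rfl
    · rw [Function.extend_apply' _ _ _ hi]
  rw [this, mul_one]

theorem edge_flip (τ : PlanarForest n d) (σ : Fin d → ℤˣ) (j : Fin d) :
    (τ.flip σ).edge j = τ.pull (Fin.singleEmb j) σ := edge_pull _ _ _ _

end PlanarForest

open PlanarForest

/-- The relators of the edge group: a 1-cube followed by its reverse, and the boundaries of the
2-cubes. -/
inductive EdgeRel (n : ℕ) : FreeGroup (PlanarForest n 1) → Prop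
  | inv (e : PlanarForest n 1) : EdgeRel n (FreeGroup.of e * FreeGroup.of (e.flipAt 0))
  | square (q : PlanarForest n 2) :
      EdgeRel n (FreeGroup.of (q.edge 0) * FreeGroup.of ((q.flipAt 0).edge 1) *
        (FreeGroup.of (q.edge 1) * FreeGroup.of ((q.flipAt 1).edge 0))⁻¹)

/-- The group generated by the ordered subsets with at least two elements. -/
abbrev EdgeGroup (n : ℕ) : Type := PresentedGroup {r | EdgeRel n r}

namespace EdgeGroup

variable {n d k : ℕ}

/-- The generator of the edge group given by an ordered subset. -/
def of (e : PlanarForest n 1) : EdgeGroup n := PresentedGroup.of e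

theorem closure_range_of : Subgroup.closure (Set.range (of : PlanarForest n 1 → EdgeGroup n)) = ⊤ :=
  PresentedGroup.closure_range_of _

/-- The universal property of the edge group. -/
def lift {G : Type*} [Group G] (f : PlanarForest n 1 → G)
    (h1 : ∀ e, f e * f (e.flipAt 0) = 1)
    (h2 : ∀ q : PlanarForest n 2,
      f (q.edge 0) * f ((q.flipAt 0).edge 1) = f (q.edge 1) * f ((q.flipAt 1).edge 0)) :
    EdgeGroup n →* G :=
  PresentedGroup.toGroup (f := f) (by
    rintro _ (⟨e⟩ | ⟨q⟩)
    · simpa using h1 e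
    · simpa only [map_mul, map_inv, FreeGroup.lift_apply_of, mul_inv_eq_one] using h2 q)

@[simp]
theorem lift_of {G : Type*} [Group G] (f : PlanarForest n 1 → G) (h1 h2) (e : PlanarForest n 1) :
    lift f h1 h2 (of e) = f e := PresentedGroup.toGroup.of _

theorem hom_ext {G : Type*} [Group G] {f g : EdgeGroup n →* G} (h : ∀ e, f (of e) = g (of e)) :
    f = g := PresentedGroup.ext h

theorem of_mul_of_flipAt (e : PlanarForest n 1) : of e * of (e.flipAt 0) = 1 := by
  have := PresentedGroup.one_of_mem (rels := {r | EdgeRel n r}) (EdgeRel.inv e)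
  rwa [map_mul] at this

theorem of_square_two (q : PlanarForest n 2) :
    of (q.edge 0) * of ((q.flipAt 0).edge 1) = of (q.edge 1) * of ((q.flipAt 1).edge 0) := by
  have := PresentedGroup.one_of_mem (rels := {r | EdgeRel n r}) (EdgeRel.square q)
  rwa [map_mul, map_inv, mul_inv_eq_one, map_mul, map_mul] at this

/-- The embedding of a two-element index set. -/
def pairEmb {i j : Fin d} (h : i ≠ j) : Fin 2 ↪ Fin d :=
  ⟨![i, j], by
    intro a b hab
    fin_cases a <;> fin_cases b <;> simp_all [Ne.symm h]⟩

theorem extend_mulSingle (ι : Fin k ↪ Fin d) (j : Fin k) (u : ℤˣ) :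
    Function.extend ι (Pi.mulSingle j u) 1 = Pi.mulSingle (ι j) u := by
  funext i
  by_cases hi : ∃ j, ι j = i
  · obtain ⟨l, rfl⟩ := hi
    rw [ι.injective.extend_apply]
    by_cases hl : l = j
    · subst hl; simp
    · rw [Pi.mulSingle_eq_of_ne hl, Pi.mulSingle_eq_of_ne (ι.injective.ne hl)]
  · rw [Function.extend_apply' _ _ _ hi, Pi.mulSingle_eq_of_ne (fun h => hi ⟨j, h.symm⟩)]
    rfl

/-- The defining squares come from forests with two edges; restricting to the edges `i` and `j`
gives the relation in any cube. -/
theorem of_square (τ : PlanarForest n d) {i j : Fin d} (h : i ≠ j) :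
    of (τ.edge i) * of ((τ.flipAt i).edge j) = of (τ.edge j) * of ((τ.flipAt j).edge i) := by
  have := of_square_two (τ.pull (pairEmb h) 1)
  simp only [flipAt, flip_pull, edge_pull, extend_mulSingle, one_mul] at this
  have h0 : pairEmb h 0 = i := rfl
  have h1 : pairEmb h 1 = j := rfl
  rw [h0, h1] at this
  simp only [flipAt, edge_flip]
  exact this

theorem of_edge_mul (τ : PlanarForest n d) (i : Fin d) :
    of (τ.edge i) * of ((τ.flipAt i).edge i) = 1 := by
  have := of_mul_of_flipAt (τ.edge i)
  have h0 : Fin.singleEmb i 0 = i := rfl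
  rwa [flipAt, edge, flip_pull, extend_mulSingle, one_mul, ← edge, h0, ← edge_flip] at this

/-- The transport along the edge `i`. -/
def transportAt (i : Fin d) : Equiv.Perm (PlanarForest n d × EdgeGroup n) :=
  Function.Involutive.toPerm (fun x => (x.1.flipAt i, x.2 * of (x.1.edge i))) (by
    rintro ⟨τ, g⟩
    refine Prod.ext ?_ ?_
    · change (τ.flipAt i).flipAt i = τ
      rw [flipAt, flipAt, flip_mul, ← Pi.mulSingle_mul, Int.units_mul_self, Pi.mulSingle_one,
        flip_one]
    · change g * of (τ.edge i) * of ((τ.flipAt i).edge i) = g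
      rw [mul_assoc, of_edge_mul, mul_one])

/-- On the group component this is exactly the square relation. The commuting involutions yield an
action of `(ℤ/2)^d`, which is why the product of generators along a path in a cube depends only on
the ends. -/
theorem transportAt_commute {i j : Fin d} (h : i ≠ j) :
    Commute (transportAt (n := n) i) (transportAt j) := by
  refine Equiv.ext ?_
  rintro ⟨τ, g⟩
  refine Prod.ext ?_ ?_
  · change (τ.flipAt j).flipAt i = (τ.flipAt i).flipAt j
    rw [flipAt, flipAt, flip_mul, flipAt, flipAt, flip_mul, mul_comm]
  · change g * of (τ.edge j) * of ((τ.flipAt j).edge i) =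
      g * of (τ.edge i) * of ((τ.flipAt i).edge j)
    rw [mul_assoc, mul_assoc, of_square τ h]

/-- The homomorphism from the group of order two given by the transport along the edge `i`. -/
def transportHom (i : Fin d) : ℤˣ →* Equiv.Perm (PlanarForest n d × EdgeGroup n) where
  toFun u := if u = 1 then 1 else transportAt i
  map_one' := if_pos rfl
  map_mul' u v := by
    have h : transportAt (n := n) i * transportAt i = 1 :=
      Equiv.ext (Function.Involutive.toPerm_involutive _)
    rcases Int.units_eq_one_or u with rfl | rfl <;>
      rcases Int.units_eq_one_or v with rfl | rfl <;> simp [h]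

theorem transportHom_commute : Pairwise fun i j : Fin d => ∀ u v : ℤˣ,
    Commute (transportHom (n := n) i u) (transportHom j v) := by
  intro i j h u v
  change Commute (if u = 1 then 1 else transportAt i) (if v = 1 then 1 else transportAt j)
  split_ifs
  · exact Commute.one_left _
  · exact Commute.one_left _
  · exact Commute.one_right _
  · exact transportAt_commute h

/-- The transport along the diagonal of a face of a cube. -/
noncomputable def transport :
    (Fin d → ℤˣ) →* Equiv.Perm (PlanarForest n d × EdgeGroup n) :=
  MonoidHom.noncommPiCoprod transportHom transportHom_commute

theorem transport_mulSingle (i : Fin d) :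
    transport (n := n) (Pi.mulSingle i (-1)) = transportAt i := by
  rw [transport, MonoidHom.noncommPiCoprod_mulSingle]
  change (if (-1 : ℤˣ) = 1 then 1 else transportAt i) = transportAt i
  exact if_neg (by decide)

theorem signs_induction {p : (Fin d → ℤˣ) → Prop} (σ : Fin d → ℤˣ) (h1 : p 1)
    (h : ∀ i σ, p σ → p (Pi.mulSingle i (-1) * σ)) : p σ := by
  have key : ∀ s : Finset (Fin d), p (∏ i ∈ s, Pi.mulSingle i (σ i)) := by
    intro s
    induction s using Finset.induction_on with
    | empty => exact h1
    | insert i s hi ih =>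
      rw [Finset.prod_insert hi]
      rcases Int.units_eq_one_or (σ i) with hs | hs
      · rwa [hs, Pi.mulSingle_one, one_mul]
      · rw [hs]
        exact h i _ ih
  rw [← Finset.univ_prod_mulSingle σ]
  exact key _

/-- The product of the generators along a path in a cube from the vertex `1` to `σ`. -/
noncomputable def val (τ : PlanarForest n d) (σ : Fin d → ℤˣ) : EdgeGroup n :=
  (transport σ (τ, 1)).2

/-- Transport multiplies the group component on the right, so it is determined by its values at
group component `1`. -/
theorem transport_apply (σ : Fin d → ℤˣ) (τ : PlanarForest n d) (g : EdgeGroup n) :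
    transport σ (τ, g) = (τ.flip σ, g * val τ σ) := by
  have key : ∀ g, transport σ (τ, g) = (τ.flip σ, g * (transport σ (τ, 1)).2) := by
    induction σ using signs_induction with
    | h1 => intro g; rw [map_one, flip_one]; simp
    | h i σ ih =>
      intro g
      rw [map_mul, Equiv.Perm.mul_apply, Equiv.Perm.mul_apply, ih, transport_mulSingle]
      generalize (transport σ (τ, 1)).2 = a at ih
      rw [ih]
      refine Prod.ext ?_ ?_
      · change (τ.flip σ).flipAt i = _
        rw [flipAt, flip_mul, mul_comm]
      · change g * a * of _ = g * (1 * a * of _)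
        rw [one_mul, mul_assoc]
  exact key g

theorem val_one (τ : PlanarForest n d) : val τ 1 = 1 := by
  rw [val, map_one]; rfl

theorem val_mulSingle (τ : PlanarForest n d) (i : Fin d) :
    val τ (Pi.mulSingle i (-1)) = of (τ.edge i) := by
  rw [val, transport_mulSingle]
  exact one_mul _

theorem val_mul (τ : PlanarForest n d) (σ ρ : Fin d → ℤˣ) :
    val τ (σ * ρ) = val τ σ * val (τ.flip σ) ρ := by
  -- Permutations compose from right to left; the signs are swapped so that `σ` acts first.
  rw [val, mul_comm, map_mul, Equiv.Perm.mul_apply, transport_apply, transport_apply, one_mul]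

/-- A path in a face is also a path in the cube. This compatibility lets the cocycle be defined cube
by cube. -/
theorem val_pull_one (τ : PlanarForest n d) (ι : Fin k ↪ Fin d) (ρ : Fin k → ℤˣ) :
    val (τ.pull ι 1) ρ = val τ (Function.extend ι ρ 1) := by
  have ext_mul : ∀ ρ ρ' : Fin k → ℤˣ, Function.extend ι (ρ * ρ') 1 =
      Function.extend ι ρ 1 * Function.extend ι ρ' 1 := by
    intro ρ ρ'
    have := Function.extend_mul ι ρ ρ' (1 : Fin d → ℤˣ) 1
    rwa [mul_one] at this
  induction ρ using signs_induction generalizing τ with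
  | h1 =>
    have : Function.extend ι (1 : Fin k → ℤˣ) 1 = 1 := Function.extend_one ι
    rw [this, val_one, val_one]
  | h i ρ ih =>
    rw [ext_mul, extend_mulSingle, val_mul, val_mul, val_mulSingle, val_mulSingle, flip_pull,
      one_mul, extend_mulSingle, ← ih, pull_flip, mul_one, edge_pull]
    rfl

end EdgeGroup

/-! ## The topology of the complex -/

namespace cactusCover

variable {n d k : ℕ}

/-- The real number `1` or `-1`. -/
def sgnR (u : ℤˣ) : ℝ := ((u : ℤ) : ℝ)

theorem sgnR_mul (u v : ℤˣ) : sgnR (u * v) = sgnR u * sgnR v := by simp [sgnR]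

@[simp] theorem sgnR_one : sgnR 1 = 1 := by simp [sgnR]

@[simp] theorem sgnR_neg_one : sgnR (-1) = -1 := by simp [sgnR]

theorem sgnR_mul_self (u : ℤˣ) : sgnR u * sgnR u = 1 := by
  rw [← sgnR_mul, Int.units_mul_self, sgnR_one]

theorem sgnR_mul_mul (u : ℤˣ) (x : ℝ) : sgnR u * (sgnR u * x) = x := by
  rw [← mul_assoc, sgnR_mul_self, one_mul]

theorem eq_of_neg_half_lt {u v : ℤˣ} (h : -(1 / 2 : ℝ) < sgnR u * sgnR v) : u = v := by
  rcases Int.units_eq_one_or u with rfl | rfl <;> rcases Int.units_eq_one_or v with rfl | rfl <;>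
    first | rfl | norm_num at h

/-- The point of the complex with given coordinates in the cube labelled by `τ` and `s`. -/
def point (τ : PlanarForest n d) (s : LabelSet n → ℤˣ) (t : Cube d) : (cactusCover n).Space :=
  Quot.mk _ ⟨⟨d, (τ, s)⟩, t⟩

theorem exists_eq_point (x : (cactusCover n).Space) :
    ∃ (d : ℕ) (τ : PlanarForest n d) (s : LabelSet n → ℤˣ) (t : Cube d), x = point τ s t := by
  obtain ⟨⟨⟨d, τ, s⟩, t⟩, rfl⟩ := Quot.exists_rep x
  exact ⟨d, τ, s, t, rfl⟩

/-- The product of the elements `1_e` over the edges with a negative sign. -/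
def shift (τ : PlanarForest n d) (σ : Fin d → ℤˣ) : LabelSet n → ℤˣ :=
  ∏ i, Pi.mulSingle (τ.type i) (σ i)

theorem shift_apply (τ : PlanarForest n d) (σ : Fin d → ℤˣ) (S : LabelSet n) :
    shift τ σ S = ∏ i, if τ.type i = S then σ i else 1 := by
  rw [shift, Finset.prod_apply]
  refine Finset.prod_congr rfl fun i _ => ?_
  rw [Pi.mulSingle_apply]
  simp only [eq_comm]

theorem prod_type {M : Type*} [CommMonoid M] (τ : PlanarForest n d) (f : Fin d → M) (i : Fin d) :
    (∏ j, if τ.type j = τ.type i then f j else 1) = f i := by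
  rw [Finset.prod_eq_single i]
  · rw [if_pos rfl]
  · intro j _ hj
    exact if_neg fun h => hj (τ.type_injective h)
  · simp

theorem prod_not_type {M : Type*} [CommMonoid M] (τ : PlanarForest n d) (f : Fin d → M)
    {S : LabelSet n} (hS : ∀ i, τ.type i ≠ S) :
    (∏ j, if τ.type j = S then f j else 1) = 1 :=
  Finset.prod_eq_one fun i _ => if_neg (hS i)

theorem shift_type (τ : PlanarForest n d) (σ : Fin d → ℤˣ) (i : Fin d) :
    shift τ σ (τ.type i) = σ i := by rw [shift_apply, prod_type]

theorem shift_not_type (τ : PlanarForest n d) (σ : Fin d → ℤˣ) {S : LabelSet n}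
    (hS : ∀ i, τ.type i ≠ S) : shift τ σ S = 1 := by rw [shift_apply, prod_not_type τ σ hS]

theorem shift_one (τ : PlanarForest n d) : shift τ 1 = 1 := by simp [shift]

theorem point_pull (τ : PlanarForest n d) (s : LabelSet n → ℤˣ) (ι : Fin k ↪ Fin d)
    (σ : Fin d → ℤˣ) (t : Cube k) :
    point (τ.pull ι σ) (s * shift τ σ) t = point τ s (Cube.faceMap ι σ t) :=
  Quot.sound (CubeComplex.Glue.mk (X := cactusCover n) ι σ (τ, s) t)

/-- Functions on the complex. -/
theorem point_lift {A : Type*} (f : ∀ {d : ℕ}, PlanarForest n d → (LabelSet n → ℤˣ) → Cube d → A)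
    (h : ∀ {k d : ℕ} (τ : PlanarForest n d) (s : LabelSet n → ℤˣ) (ι : Fin k ↪ Fin d)
      (σ : Fin d → ℤˣ) (t : Cube k),
      f (τ.pull ι σ) (s * shift τ σ) t = f τ s (Cube.faceMap ι σ t)) :
    ∃ F : (cactusCover n).Space → A, ∀ {d : ℕ} (τ : PlanarForest n d) s t,
      F (point τ s t) = f τ s t := by
  refine ⟨Quot.lift (fun x => f x.1.2.1 x.1.2.2 x.2) ?_, fun _ _ _ => rfl⟩
  rintro _ _ ⟨ι, σ, c, t⟩
  exact h c.1 c.2 ι σ t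

theorem continuous_of_point {A : Type*} [TopologicalSpace A] {F : (cactusCover n).Space → A}
    (h : ∀ {d : ℕ} (τ : PlanarForest n d) s, Continuous fun t => F (point τ s t)) :
    Continuous F := by
  refine isQuotientMap_quot_mk.continuous_iff.2 (continuous_sigma fun c => ?_)
  exact h c.2.1 c.2.2

theorem continuous_point (τ : PlanarForest n d) (s : LabelSet n → ℤˣ) :
    Continuous (point τ s) :=
  continuous_quot_mk.comp (continuous_sigmaMk (σ := fun c : (Σ d : ℕ, (cactusCover n).cell d) =>
    Cube c.1) (i := ⟨d, (τ, s)⟩))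

theorem isOpen_of_point {U : Set (cactusCover n).Space}
    (h : ∀ {d : ℕ} (τ : PlanarForest n d) s, IsOpen {t | point τ s t ∈ U}) : IsOpen U := by
  refine isQuotientMap_quot_mk.isOpen_preimage.1 (isOpen_sigma_iff.2 fun c => ?_)
  exact h c.2.1 c.2.2

theorem faceMap_apply_emb (ι : Fin k ↪ Fin d) (σ : Fin d → ℤˣ) (t : Cube k) (j : Fin k) :
    (Cube.faceMap ι σ t).1 (ι j) = sgnR (σ (ι j)) * t.1 j := by
  change _ * Function.extend ι t.1 1 (ι j) = _
  rw [ι.injective.extend_apply]; rfl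

theorem faceMap_apply_of_notMem (ι : Fin k ↪ Fin d) (σ : Fin d → ℤˣ) (t : Cube k) {i : Fin d}
    (hi : ¬ ∃ j, ι j = i) : (Cube.faceMap ι σ t).1 i = sgnR (σ i) := by
  change _ * Function.extend ι t.1 1 i = _
  rw [Function.extend_apply' _ _ _ hi, Pi.one_apply, mul_one]; rfl

/-! ### Coordinate functions and neighbourhoods of the 0-cubes -/

/-- Together these functions map the complex to `[-1,1]^L`, with the 0-cube `v` going to the corner
`v`. At most one edge has type `S`, so the product has at most one proper factor, and the sign `s S`
compensates for reflections in that edge. -/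
theorem exists_coord (S : LabelSet n) : ∃ y : (cactusCover n).Space → ℝ,
    ∀ {d : ℕ} (τ : PlanarForest n d) s (t : Cube d),
      y (point τ s t) = sgnR (s S) * ∏ i, if τ.type i = S then t.1 i else 1 := by
  refine point_lift (fun τ s t => sgnR (s S) * ∏ i, if τ.type i = S then t.1 i else 1) ?_
  intro k d τ s ι σ t
  have ht : ∀ j, (τ.pull ι σ).type j = τ.type (ι j) := fun _ => rfl
  rw [Pi.mul_apply, sgnR_mul, mul_assoc]
  congr 1
  by_cases hS : ∃ i, τ.type i = S
  · obtain ⟨i, rfl⟩ := hS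
    rw [shift_type, prod_type]
    by_cases hi : ∃ j, ι j = i
    · obtain ⟨j, rfl⟩ := hi
      rw [← ht j, prod_type, faceMap_apply_emb]
    · rw [faceMap_apply_of_notMem _ _ _ hi, prod_not_type, mul_one]
      intro j hj
      exact hi ⟨j, τ.type_injective hj⟩
  · have hS' : ∀ i, τ.type i ≠ S := fun i h => hS ⟨i, h⟩
    rw [shift_not_type _ _ hS', prod_not_type _ _ hS', prod_not_type _ _ fun j => hS' (ι j),
      sgnR_one, one_mul]

/-- The coordinate function of the complex which is equal to `1` or `-1` on the faces that are not
crossed by hyperplanes of type `S`. -/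
noncomputable def coord (S : LabelSet n) : (cactusCover n).Space → ℝ := (exists_coord S).choose

theorem coord_type (τ : PlanarForest n d) (s : LabelSet n → ℤˣ) (t : Cube d) (i : Fin d) :
    coord (τ.type i) (point τ s t) = sgnR (s (τ.type i)) * t.1 i := by
  rw [coord, (exists_coord (τ.type i)).choose_spec, prod_type]

theorem coord_not_type (τ : PlanarForest n d) (s : LabelSet n → ℤˣ) (t : Cube d) {S : LabelSet n}
    (hS : ∀ i, τ.type i ≠ S) : coord S (point τ s t) = sgnR (s S) := by
  rw [coord, (exists_coord S).choose_spec, prod_not_type _ _ hS, mul_one]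

theorem continuous_coord (S : LabelSet n) : Continuous (coord S) := by
  refine continuous_of_point fun {d} τ s => ?_
  by_cases hS : ∃ i, τ.type i = S
  · obtain ⟨i, rfl⟩ := hS
    simp only [coord_type]
    exact continuous_const.mul ((continuous_apply i).comp continuous_subtype_val)
  · simp only [coord_not_type τ s _ fun i h => hS ⟨i, h⟩]
    fun_prop

theorem coord_mem_Icc (S : LabelSet n) (x : (cactusCover n).Space) :
    coord S x ∈ Set.Icc (-1 : ℝ) 1 := by
  obtain ⟨d, τ, s, t, rfl⟩ := exists_eq_point x
  by_cases hS : ∃ i, τ.type i = S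
  · obtain ⟨i, rfl⟩ := hS
    rw [coord_type]
    have := t.2 i
    rcases Int.units_eq_one_or (s (τ.type i)) with h | h <;> rw [h] <;>
      simp only [sgnR_one, sgnR_neg_one, Set.mem_Icc] at * <;> constructor <;> linarith [this.1, this.2]
  · rw [coord_not_type τ s _ fun i h => hS ⟨i, h⟩]
    rcases Int.units_eq_one_or (s S) with h | h <;> rw [h] <;> simp

/-- A neighbourhood of the 0-cube `v`. -/
def nbhd (v : LabelSet n → ℤˣ) : Set (cactusCover n).Space :=
  {x | ∀ S, -(1 / 2 : ℝ) < sgnR (v S) * coord S x}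

theorem isOpen_nbhd (v : LabelSet n → ℤˣ) : IsOpen (nbhd v) := by
  have : nbhd v = ⋂ S, {x | -(1 / 2 : ℝ) < sgnR (v S) * coord S x} := by
    ext x; simp [nbhd]
  rw [this]
  exact isOpen_iInter_of_finite fun S =>
    isOpen_lt continuous_const (continuous_const.mul (continuous_coord S))

theorem exists_mem_nbhd (x : (cactusCover n).Space) : ∃ v, x ∈ nbhd v := by
  refine ⟨fun S => if 0 ≤ coord S x then 1 else -1, fun S => ?_⟩
  beta_reduce
  split_ifs with h
  · rw [sgnR_one]; linarith
  · rw [sgnR_neg_one]; linarith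

/-- For a type that does not occur in the forest the coordinate is a sign, and the bound `-1/2`
forces it to agree with `v`. Hence only cubes with the corner `v` meet this neighbourhood. -/
theorem mem_nbhd_iff (τ : PlanarForest n d) (s : LabelSet n → ℤˣ) (t : Cube d)
    (v : LabelSet n → ℤˣ) : point τ s t ∈ nbhd v ↔
      (∀ i, -(1 / 2 : ℝ) < sgnR (v (τ.type i)) * (sgnR (s (τ.type i)) * t.1 i)) ∧
        ∀ S, (∀ i, τ.type i ≠ S) → v S = s S := by
  constructor
  · intro h
    refine ⟨fun i => ?_, fun S hS => ?_⟩
    · have := h (τ.type i)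
      rwa [coord_type] at this
    · have := h S
      rw [coord_not_type _ _ _ hS] at this
      exact eq_of_neg_half_lt this
  · rintro ⟨h1, h2⟩ S
    by_cases hS : ∃ i, τ.type i = S
    · obtain ⟨i, rfl⟩ := hS
      rw [coord_type]
      exact h1 i
    · have hS' : ∀ i, τ.type i ≠ S := fun i h => hS ⟨i, h⟩
      rw [coord_not_type _ _ _ hS', h2 S hS', sgnR_mul_self]
      norm_num

theorem faceMap_refl_apply (σ : Fin d → ℤˣ) (t : Cube d) (i : Fin d) :
    (Cube.faceMap (Function.Embedding.refl _) σ t).1 i = sgnR (σ i) * t.1 i :=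
  faceMap_apply_emb (Function.Embedding.refl _) σ t i

theorem point_flip (τ : PlanarForest n d) (s : LabelSet n → ℤˣ) (σ : Fin d → ℤˣ) (t : Cube d) :
    point (τ.flip σ) (s * shift τ σ) (Cube.faceMap (Function.Embedding.refl _) σ t) =
      point τ s t := by
  refine (point_pull τ s _ σ _).trans (congrArg (point τ s) (Subtype.ext (funext fun i => ?_)))
  rw [faceMap_refl_apply, faceMap_refl_apply, sgnR_mul_mul]

/-- The cube is reflected so that its corner `v` becomes the positive one. -/
theorem exists_eq_point_of_mem_nbhd {v : LabelSet n → ℤˣ} {x : (cactusCover n).Space}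
    (hx : x ∈ nbhd v) : ∃ (d : ℕ) (τ : PlanarForest n d) (t : Cube d), x = point τ v t := by
  obtain ⟨d, τ, s, t, rfl⟩ := exists_eq_point x
  have h : v = s * shift τ fun i => s (τ.type i) * v (τ.type i) := by
    funext S
    by_cases hS : ∃ i, τ.type i = S
    · obtain ⟨i, rfl⟩ := hS
      rw [Pi.mul_apply, shift_type, ← mul_assoc, Int.units_mul_self, one_mul]
    · have hS' : ∀ i, τ.type i ≠ S := fun i h => hS ⟨i, h⟩
      rw [Pi.mul_apply, shift_not_type _ _ hS', mul_one, ((mem_nbhd_iff _ _ _ _).1 hx).2 S hS']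
  have := point_flip τ s (fun i => s (τ.type i) * v (τ.type i)) t
  rw [← h] at this
  exact ⟨_, _, _, this.symm⟩

/-- The forest without internal edges. -/
def emptyForest (n : ℕ) : PlanarForest n 0 where
  ord := Fin.elim0
  two_le i := i.elim0
  carrier_injective i := i.elim0
  compat i := i.elim0

/-- The 0-cube `v` as a point of the space. -/
def vertex (v : LabelSet n → ℤˣ) : (cactusCover n).Space :=
  point (emptyForest n) v ⟨Fin.elim0, fun i => i.elim0⟩

theorem vertex_mem_nbhd (v : LabelSet n → ℤˣ) : vertex v ∈ nbhd v :=
  (mem_nbhd_iff _ _ _ _).2 ⟨fun i => i.elim0, fun _ _ => rfl⟩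

/-! ### The contraction towards a vertex -/

/-- An isotopy of `[-1,1]` from the identity to a map that is equal to `1` above `-1/2`. -/
noncomputable def push (r t : ℝ) : ℝ := min 1 (t + 3 * r * (1 + t))

theorem push_zero {t : ℝ} (h : t ≤ 1) : push 0 t = t := by simp [push, h]

/-- The factor `3` in `push` is chosen for this: `t + 3 * (1 + t)` equals `1` at `t = -1/2`. -/
theorem push_one {t : ℝ} (h : -(1 / 2) ≤ t) : push 1 t = 1 := by
  rw [push, min_eq_left]; linarith

theorem push_of_one {r : ℝ} (h : 0 ≤ r) : push r 1 = 1 := by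
  rw [push, min_eq_left]; linarith

theorem push_of_neg_one (r : ℝ) : push r (-1) = -1 := by norm_num [push]

theorem le_push {r t : ℝ} (hr : 0 ≤ r) (h : -1 ≤ t) (h' : t ≤ 1) : t ≤ push r t :=
  le_min h' (by nlinarith)

theorem push_le_one (r t : ℝ) : push r t ≤ 1 := min_le_left _ _

theorem continuous_push : Continuous fun x : ℝ × ℝ => push x.1 x.2 := by
  unfold push; fun_prop

/-- The motion of a coordinate towards the sign `u`. -/
noncomputable def pushTo (u : ℤˣ) (r t : ℝ) : ℝ := sgnR u * push r (sgnR u * t)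

theorem pushTo_mem_Icc (u : ℤˣ) (r : unitInterval) {t : ℝ} (ht : t ∈ Set.Icc (-1 : ℝ) 1) :
    pushTo u r t ∈ Set.Icc (-1 : ℝ) 1 := by
  rcases Int.units_eq_one_or u with rfl | rfl
  · have h1 := le_push r.2.1 ht.1 ht.2
    have h2 := push_le_one r t
    simp only [pushTo, sgnR_one, one_mul]
    exact ⟨ht.1.trans h1, h2⟩
  · have h1 := le_push (t := -t) r.2.1 (by linarith [ht.2]) (by linarith [ht.1])
    have h2 := push_le_one r (-t)
    simp only [pushTo, sgnR_neg_one, neg_one_mul]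
    constructor <;> linarith [ht.1, ht.2]

theorem pushTo_sgnR (u v : ℤˣ) (r : unitInterval) : pushTo u r (sgnR v) = sgnR v := by
  rcases Int.units_eq_one_or u with rfl | rfl <;> rcases Int.units_eq_one_or v with rfl | rfl <;>
    simp [pushTo, push_of_one r.2.1, push_of_neg_one]

theorem pushTo_mul (u v : ℤˣ) (r t : ℝ) :
    pushTo u r (sgnR v * t) = sgnR v * pushTo (u * v) r t := by
  rw [pushTo, pushTo, sgnR_mul]
  have h := sgnR_mul_self v
  calc sgnR u * push r (sgnR u * (sgnR v * t))
      = (sgnR v * sgnR v) * sgnR u * push r (sgnR u * (sgnR v * t)) := by rw [h, one_mul]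
    _ = _ := by rw [← mul_assoc (sgnR u)]; ring

theorem continuous_pushTo (u : ℤˣ) : Continuous fun x : ℝ × ℝ => pushTo u x.1 x.2 := by
  unfold pushTo
  exact continuous_const.mul (continuous_push.comp
    (continuous_fst.prodMk (continuous_const.mul continuous_snd)))

/-- The motion of the points of a cube towards the vertex `v`. -/
noncomputable def pushCube (v : LabelSet n → ℤˣ) (τ : PlanarForest n d) (s : LabelSet n → ℤˣ)
    (r : unitInterval) (t : Cube d) : Cube d :=
  ⟨fun i => pushTo (s (τ.type i) * v (τ.type i)) r (t.1 i), fun i => pushTo_mem_Icc _ r (t.2 i)⟩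

theorem continuous_pushCube (v : LabelSet n → ℤˣ) (τ : PlanarForest n d) (s : LabelSet n → ℤˣ) :
    Continuous fun x : Cube d × unitInterval => pushCube v τ s x.2 x.1 := by
  refine Continuous.subtype_mk (continuous_pi fun i => ?_) _
  have h : Continuous fun x : Cube d × unitInterval => ((x.2 : ℝ), x.1.1 i) :=
    (continuous_subtype_val.comp continuous_snd).prodMk
      ((continuous_apply i).comp (continuous_subtype_val.comp continuous_fst))
  exact (continuous_pushTo _).comp h

/-- The motion is compatible with gluing for two reasons: it commutes with reflections, once the
target sign is reflected too, and it fixes `1` and `-1`, so coordinates that are constant on a face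
stay so. -/
theorem pushCube_faceMap (v : LabelSet n → ℤˣ) (τ : PlanarForest n d) (s : LabelSet n → ℤˣ)
    (ι : Fin k ↪ Fin d) (σ : Fin d → ℤˣ) (r : unitInterval) (t : Cube k) :
    Cube.faceMap ι σ (pushCube v (τ.pull ι σ) (s * shift τ σ) r t) =
      pushCube v τ s r (Cube.faceMap ι σ t) := by
  refine Subtype.ext (funext fun i => ?_)
  by_cases hi : ∃ j, ι j = i
  · obtain ⟨j, rfl⟩ := hi
    simp only [pushCube, faceMap_apply_emb]
    have h : (τ.pull ι σ).type j = τ.type (ι j) := rfl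
    rw [pushTo_mul, h, Pi.mul_apply, shift_type, mul_right_comm]
  · simp only [pushCube, faceMap_apply_of_notMem _ _ _ hi]
    rw [pushTo_sgnR]

/-- The motion is curried: each point of a cube gives its whole trajectory in `C(unitInterval, _)`.
Continuity can then be tested on the quotient itself, without discussing its product with the
interval. -/
theorem exists_contraction (v : LabelSet n → ℤˣ) :
    ∃ H : (cactusCover n).Space → C(unitInterval, (cactusCover n).Space), Continuous H ∧
      ∀ {d : ℕ} (τ : PlanarForest n d) s t r, H (point τ s t) r = point τ s (pushCube v τ s r t) := by
  have cont : ∀ {d : ℕ} (τ : PlanarForest n d) s,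
      Continuous fun x : Cube d × unitInterval => point τ s (pushCube v τ s x.2 x.1) := fun τ s =>
    (continuous_point τ s).comp (continuous_pushCube v τ s)
  obtain ⟨H, hH⟩ := point_lift (n := n) (A := C(unitInterval, (cactusCover n).Space))
    (fun {d} τ s t => ContinuousMap.curry ⟨_, cont τ s⟩ t) (by
      intro k d τ s ι σ t
      ext r
      change point _ _ _ = point _ _ _
      rw [point_pull, pushCube_faceMap])
  refine ⟨H, continuous_of_point fun τ s => ?_, fun τ s t r => by rw [hH]; rfl⟩
  simp only [hH]
  exact ContinuousMap.continuous _

/-- The motion of the complex towards the vertex `v`. -/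
noncomputable def contraction (v : LabelSet n → ℤˣ) :
    C(unitInterval × (cactusCover n).Space, (cactusCover n).Space) where
  toFun x := (exists_contraction v).choose x.2 x.1
  continuous_toFun := by
    have := (exists_contraction v).choose_spec.1
    fun_prop

theorem contraction_point (v : LabelSet n → ℤˣ) (r : unitInterval) (τ : PlanarForest n d)
    (s : LabelSet n → ℤˣ) (t : Cube d) :
    contraction v (r, point τ s t) = point τ s (pushCube v τ s r t) :=
  (exists_contraction v).choose_spec.2 τ s t r

theorem contraction_zero (v : LabelSet n → ℤˣ) (x : (cactusCover n).Space) :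
    contraction v (0, x) = x := by
  obtain ⟨d, τ, s, t, rfl⟩ := exists_eq_point x
  rw [contraction_point]
  refine congrArg (point τ s) (Subtype.ext (funext fun i => ?_))
  change sgnR _ * push 0 _ = t.1 i
  rw [push_zero, sgnR_mul_mul]
  have := t.2 i
  rcases Int.units_eq_one_or (s (τ.type i) * v (τ.type i)) with h | h <;> rw [h] <;>
    simp only [sgnR_one, sgnR_neg_one] <;> linarith [this.1, this.2]

theorem coord_contraction (v : LabelSet n → ℤˣ) (S : LabelSet n) (r : unitInterval)
    (x : (cactusCover n).Space) :
    sgnR (v S) * coord S (contraction v (r, x)) = push r (sgnR (v S) * coord S x) := by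
  obtain ⟨d, τ, s, t, rfl⟩ := exists_eq_point x
  rw [contraction_point]
  by_cases hS : ∃ i, τ.type i = S
  · obtain ⟨i, rfl⟩ := hS
    rw [coord_type, coord_type]
    simp only [pushCube, pushTo, sgnR_mul]
    have h := sgnR_mul_self (s (τ.type i))
    have h' := sgnR_mul_self (v (τ.type i))
    generalize sgnR (s (τ.type i)) = a at *
    generalize sgnR (v (τ.type i)) = b at *
    have : a * b * t.1 i = b * (a * t.1 i) := by ring
    rw [this]
    calc b * (a * (a * b * push r (b * (a * t.1 i))))
        = (a * a) * (b * b) * push r (b * (a * t.1 i)) := by ring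
      _ = _ := by rw [h, h', one_mul, one_mul]
  · have hS' : ∀ i, τ.type i ≠ S := fun i h => hS ⟨i, h⟩
    rw [coord_not_type _ _ _ hS', coord_not_type _ _ _ hS', ← sgnR_mul]
    rcases Int.units_eq_one_or (v S * s S) with h | h <;> rw [h] <;>
      simp [push_of_one r.2.1, push_of_neg_one]

theorem contraction_mem_nbhd {v : LabelSet n → ℤˣ} {x : (cactusCover n).Space} (hx : x ∈ nbhd v)
    (r : unitInterval) : contraction v (r, x) ∈ nbhd v := by
  intro S
  rw [coord_contraction]
  have h1 := coord_mem_Icc S x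
  refine (hx S).trans_le (le_push r.2.1 ?_ ?_) <;>
  rcases Int.units_eq_one_or (v S) with h | h <;> rw [h] <;>
    simp only [sgnR_one, sgnR_neg_one] <;> linarith [h1.1, h1.2]

/-- Seen from the corner `v`, all coordinates of the point exceed `-1/2`, so each has reached `1` at
the end of the motion. -/
theorem contraction_one {v : LabelSet n → ℤˣ} {x : (cactusCover n).Space} (hx : x ∈ nbhd v) :
    contraction v (1, x) = vertex v := by
  obtain ⟨d, τ, t, rfl⟩ := exists_eq_point_of_mem_nbhd hx
  have ht : pushCube v τ v 1 t =
      Cube.faceMap (Function.Embedding.ofIsEmpty : Fin 0 ↪ Fin d) 1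
        ⟨Fin.elim0, fun i => i.elim0⟩ := by
    refine Subtype.ext (funext fun i => ?_)
    rw [faceMap_apply_of_notMem _ _ _ (fun ⟨j, _⟩ => j.elim0)]
    have h := ((mem_nbhd_iff _ _ _ _).1 hx).1 i
    rw [sgnR_mul_mul] at h
    change pushTo (v (τ.type i) * v (τ.type i)) 1 (t.1 i) = _
    rw [Int.units_mul_self, pushTo, sgnR_one, one_mul, one_mul, push_one h.le]
    simp
  rw [contraction_point, ht, ← point_pull, shift_one, mul_one, vertex]
  congr 1
  exact Subsingleton.elim _ _

/-- This is the naturality square of the homotopy from the identity to `H (1, ·)`, whose last side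
is constant. Only the points of `γ` have to end at `b`, since the motion does not contract the whole
complex. -/
theorem eq_trans_of_square {X : Type} [TopologicalSpace X] (H : C(unitInterval × X, X))
    (h0 : ∀ x, H (0, x) = x) (b : X) {x y : X} (γ : Path x y) (h1 : ∀ t, H (1, γ t) = b)
    (e : Path x b) (e' : Path y b) (he : ∀ r, e r = H (r, x)) (he' : ∀ r, e' r = H (r, y)) :
    (Path.Homotopic.Quotient.mk γ).trans (Path.Homotopic.Quotient.mk e') =
      Path.Homotopic.Quotient.mk e := by
  let g : C(X, X) := ⟨fun x => H (1, x), by fun_prop⟩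
  let F : (ContinuousMap.id X).Homotopy g := ⟨H, h0, fun _ => rfl⟩
  have key := Path.Homotopic.map_trans_evalAt F γ
  -- The trajectories end at `H (1, x)` and `H (1, y)`, equal to `b` only propositionally, so the
  -- end points are generalized before substitution.
  have aux : ∀ {c c' : X} (hc : c = b) (hc' : c' = b) (p : Path c c') (_ : ∀ t, p t = b)
      (f : Path x c) (f' : Path y c') (_ : ∀ r, f r = e r) (_ : ∀ r, f' r = e' r)
      (_ : (γ.trans f').Homotopic (f.trans p)), (Path.Homotopic.Quotient.mk γ).trans
        (Path.Homotopic.Quotient.mk e') = Path.Homotopic.Quotient.mk e := by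
    rintro c c' hc rfl p hp f f' hf hf' hh
    obtain rfl := hc
    have h2 : p = Path.refl _ := Path.ext (funext hp)
    have h3 : f = e := Path.ext (funext hf)
    have h4 : f' = e' := Path.ext (funext hf')
    subst h2 h3 h4
    have := Path.Homotopic.Quotient.eq.2 hh
    rwa [Path.Homotopic.Quotient.mk_trans, Path.Homotopic.Quotient.mk_trans,
      Path.Homotopic.Quotient.mk_refl, Path.Homotopic.Quotient.trans_refl] at this
  refine aux ?_ ?_ (γ.map (map_continuous g)) h1 (F.evalAt x) (F.evalAt y)
    (fun r => (he r).symm) (fun r => (he' r).symm) key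
  · exact (congrArg (fun z => H (1, z)) γ.source.symm).trans (h1 0)
  · exact (congrArg (fun z => H (1, z)) γ.target.symm).trans (h1 1)

/-- The path from a point of `nbhd v` to the vertex `v`. -/
noncomputable def pathToVertex (v : LabelSet n → ℤˣ) (x : (cactusCover n).Space)
    (hx : x ∈ nbhd v) : Path x (vertex v) where
  toFun r := contraction v (r, x)
  continuous_toFun := by fun_prop
  source' := contraction_zero v x
  target' := contraction_one hx

theorem mk_symm_pathToVertex_trans (v : LabelSet n → ℤˣ) (x y : (cactusCover n).Space)
    (hx : x ∈ nbhd v) (hy : y ∈ nbhd v) (γ : Path x y) (h : ∀ t, γ t ∈ nbhd v) :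
    (Path.Homotopic.Quotient.mk (pathToVertex v x hx).symm).trans (Path.Homotopic.Quotient.mk γ) =
      Path.Homotopic.Quotient.mk (pathToVertex v y hy).symm := by
  have key := eq_trans_of_square (contraction v) (contraction_zero v) (vertex v) γ
    (fun t => contraction_one (h t)) (pathToVertex v x hx) (pathToVertex v y hy)
    (fun _ => rfl) (fun _ => rfl)
  rw [Path.Homotopic.Quotient.mk_symm, Path.Homotopic.Quotient.mk_symm, ← key]
  refine Path.Homotopic.Quotient.trans_left_cancel
    (p := (Path.Homotopic.Quotient.mk γ).trans (Path.Homotopic.Quotient.mk (pathToVertex v y hy))) ?_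
  rw [Path.Homotopic.Quotient.trans_symm_cancel, Path.Homotopic.Quotient.trans_assoc,
    Path.Homotopic.Quotient.trans_symm, Path.Homotopic.Quotient.trans_refl]

end cactusCover

/-! ## The fundamental group of the complex -/

namespace cactusCover

variable {n d k : ℕ}

/-- Within a cube the intersection of two neighbourhoods is cut out by linear inequalities on single
coordinates, so it is convex; the last condition says that `w` is a corner of the cube. -/
theorem point_mem_nbhd_iff (τ : PlanarForest n d) (v w : LabelSet n → ℤˣ) (t : Cube d) :
    point τ v t ∈ nbhd v ∩ nbhd w ↔ (∀ i, -(1 / 2 : ℝ) < t.1 i) ∧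
      (∀ i, -(1 / 2 : ℝ) < sgnR (w (τ.type i)) * (sgnR (v (τ.type i)) * t.1 i)) ∧
        w = v * shift τ fun i => v (τ.type i) * w (τ.type i) := by
  rw [Set.mem_inter_iff, mem_nbhd_iff, mem_nbhd_iff]
  simp only [sgnR_mul_mul, implies_true, and_true]
  refine and_congr_right fun _ => and_congr_right fun _ => ⟨fun h => ?_, fun h S hS => ?_⟩
  · funext S
    by_cases hS : ∃ i, τ.type i = S
    · obtain ⟨i, rfl⟩ := hS
      rw [Pi.mul_apply, shift_type, ← mul_assoc, Int.units_mul_self, one_mul]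
    · have hS' : ∀ i, τ.type i ≠ S := fun i h => hS ⟨i, h⟩
      rw [Pi.mul_apply, shift_not_type _ _ hS', mul_one, h S hS']
  · rw [h, Pi.mul_apply, shift_not_type _ _ hS, mul_one]

-- The value on a cube is the product of generators along a path in it from the corner `v` to the
-- corner `w`; the first flip moves the base corner from `s` to `v`. Outside the intersection the
-- value is the irrelevant default `1`.
open Classical in
theorem exists_cocycle (v w : LabelSet n → ℤˣ) :
    ∃ c : (cactusCover n).Space → EdgeGroup n, ∀ {d : ℕ} (τ : PlanarForest n d) s (t : Cube d),
      c (point τ s t) = if point τ s t ∈ nbhd v ∩ nbhd w then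
        EdgeGroup.val (τ.flip fun i => s (τ.type i) * v (τ.type i))
          (fun i => v (τ.type i) * w (τ.type i)) else 1 := by
  refine point_lift (fun τ s t => if point τ s t ∈ nbhd v ∩ nbhd w then
        EdgeGroup.val (τ.flip fun i => s (τ.type i) * v (τ.type i))
          (fun i => v (τ.type i) * w (τ.type i)) else 1) ?_
  intro k d τ s ι σ t
  rw [point_pull]
  by_cases h : point τ s (Cube.faceMap ι σ t) ∈ nbhd v ∩ nbhd w
  · rw [if_pos h, if_pos h]
    have hv := ((mem_nbhd_iff _ _ _ _).1 h.1).1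
    have hw := ((mem_nbhd_iff _ _ _ _).1 h.2).1
    -- A coordinate that is constant on the face is a sign there, and membership in both
    -- neighbourhoods makes `v` and `w` agree with it. So the path from `v` to `w` does not leave
    -- the face.
    have key : ∀ i, ¬ (∃ j, ι j = i) → v (τ.type i) = s (τ.type i) * σ i ∧
        w (τ.type i) = s (τ.type i) * σ i := by
      intro i hi
      have h1 := hv i
      have h2 := hw i
      rw [faceMap_apply_of_notMem _ _ _ hi, ← sgnR_mul] at h1 h2
      exact ⟨eq_of_neg_half_lt h1, eq_of_neg_half_lt h2⟩
    have ht : ∀ j, (τ.pull ι σ).type j = τ.type (ι j) := fun _ => rfl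
    have e1 : ((τ.pull ι σ).flip fun j => (s * shift τ σ) ((τ.pull ι σ).type j) *
        v ((τ.pull ι σ).type j)) = (τ.flip fun i => s (τ.type i) * v (τ.type i)).pull ι 1 := by
      rw [flip_pull, pull_flip]
      congr 1
      funext i
      rw [Pi.mul_apply, mul_one]
      by_cases hi : ∃ j, ι j = i
      · obtain ⟨j, rfl⟩ := hi
        rw [ι.injective.extend_apply, ht, Pi.mul_apply, shift_type, mul_right_comm, mul_comm (σ _),
          mul_assoc, Int.units_mul_self, mul_one]
      · rw [Function.extend_apply' _ _ _ hi, (key i hi).1, ← mul_assoc, Int.units_mul_self,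
          Pi.one_apply, mul_one, one_mul]
    have e2 : Function.extend ι (fun j => v ((τ.pull ι σ).type j) * w ((τ.pull ι σ).type j)) 1 =
        fun i => v (τ.type i) * w (τ.type i) := by
      funext i
      by_cases hi : ∃ j, ι j = i
      · obtain ⟨j, rfl⟩ := hi
        rw [ι.injective.extend_apply, ht]
      · rw [Function.extend_apply' _ _ _ hi, (key i hi).1, (key i hi).2, Int.units_mul_self,
          Pi.one_apply]
    rw [e1, EdgeGroup.val_pull_one, e2]
  · rw [if_neg h, if_neg h]

/-- The cocycle on the intersections of the neighbourhoods of the 0-cubes. -/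
noncomputable def cocycle (v w : LabelSet n → ℤˣ) : (cactusCover n).Space → EdgeGroup n :=
  (exists_cocycle v w).choose

theorem cocycle_point (v w : LabelSet n → ℤˣ) (τ : PlanarForest n d) (s : LabelSet n → ℤˣ)
    (t : Cube d) (h : point τ s t ∈ nbhd v ∩ nbhd w) :
    cocycle v w (point τ s t) = EdgeGroup.val (τ.flip fun i => s (τ.type i) * v (τ.type i))
      (fun i => v (τ.type i) * w (τ.type i)) :=
  ((exists_cocycle v w).choose_spec τ s t).trans (if_pos h)

/-- The formula for the value on a cube does not involve the point. Hence the level set meets each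
cube in all of the intersection or not at all, and is open. -/
theorem cocycle_locally_const (v w : LabelSet n → ℤˣ) (x : (cactusCover n).Space)
    (hx : x ∈ nbhd v ∩ nbhd w) : ∀ᶠ y in 𝓝 x, cocycle v w y = cocycle v w x := by
  have hO : IsOpen (nbhd v ∩ nbhd w) := (isOpen_nbhd v).inter (isOpen_nbhd w)
  have h : IsOpen {y | y ∈ nbhd v ∩ nbhd w ∧ cocycle v w y = cocycle v w x} := by
    refine isOpen_of_point fun τ s => ?_
    by_cases he : EdgeGroup.val (τ.flip fun i => s (τ.type i) * v (τ.type i))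
      (fun i => v (τ.type i) * w (τ.type i)) = cocycle v w x
    · convert hO.preimage (continuous_point τ s) using 1
      ext t
      exact ⟨fun h => h.1, fun h => ⟨h, (cocycle_point v w τ s t h).trans he⟩⟩
    · convert isOpen_empty
      rw [Set.eq_empty_iff_forall_notMem]
      rintro t ⟨h1, h2⟩
      exact he ((cocycle_point v w τ s t h1).symm.trans h2)
  exact Filter.mem_of_superset (h.mem_nhds ⟨hx, rfl⟩) fun y hy => hy.2

theorem cocycle_mul (v w z : LabelSet n → ℤˣ) (x : (cactusCover n).Space)
    (hx : x ∈ nbhd v ∩ nbhd w ∩ nbhd z) : cocycle v w x * cocycle w z x = cocycle v z x := by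
  obtain ⟨d, τ, s, t, rfl⟩ := exists_eq_point x
  rw [cocycle_point v w τ s t hx.1, cocycle_point w z τ s t ⟨hx.1.2, hx.2⟩,
    cocycle_point v z τ s t ⟨hx.1.1, hx.2⟩]
  have e : (τ.flip fun i => s (τ.type i) * w (τ.type i)) =
      (τ.flip fun i => s (τ.type i) * v (τ.type i)).flip
        fun i => v (τ.type i) * w (τ.type i) := by
    rw [flip_mul]
    congr 1
    funext i
    rw [Pi.mul_apply, mul_assoc, ← mul_assoc (v _), Int.units_mul_self, one_mul]
  rw [e, ← EdgeGroup.val_mul]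
  congr 1
  funext i
  rw [Pi.mul_apply, mul_assoc, ← mul_assoc (w _), Int.units_mul_self, one_mul]

/-- The cover of the complex by the neighbourhoods of the 0-cubes. -/
noncomputable def smallCover (n : ℕ) : SmallCover (cactusCover n).Space (EdgeGroup n) where
  V := LabelSet n → ℤˣ
  W := nbhd
  isOpen := isOpen_nbhd
  cover := exists_mem_nbhd
  base := vertex
  base_mem := vertex_mem_nbhd
  r v x hx := (pathToVertex v x hx).symm
  r_mem v x _ t := contraction_mem_nbhd (by assumption) (unitInterval.symm t)
  r_trans := mk_symm_pathToVertex_trans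
  c := cocycle
  c_locally_const := cocycle_locally_const
  c_mul := cocycle_mul

/-- The class of the path from the 0-cube `v` to the 0-cube `w` through `x`. -/
noncomputable def step (v w : LabelSet n → ℤˣ) (x : (cactusCover n).Space)
    (hx : x ∈ nbhd v ∩ nbhd w) : Path.Homotopic.Quotient (vertex v) (vertex w) :=
  (smallCover n).step v w x hx

/-! ### Steps between 0-cubes -/

theorem step_trans (v w z : LabelSet n → ℤˣ) (x : (cactusCover n).Space)
    (hv : x ∈ nbhd v) (hw : x ∈ nbhd w) (hz : x ∈ nbhd z) :
    (step v w x ⟨hv, hw⟩).trans (step w z x ⟨hw, hz⟩) = step v z x ⟨hv, hz⟩ := by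
  have h : ∀ {a b c e : (cactusCover n).Space} (p : Path.Homotopic.Quotient a e)
      (q : Path.Homotopic.Quotient b e) (r : Path.Homotopic.Quotient c e),
      (p.trans q.symm).trans (q.trans r.symm) = p.trans r.symm := by
    intro a b c e p q r
    rw [Path.Homotopic.Quotient.trans_assoc, Path.Homotopic.Quotient.symm_trans_cancel]
  exact h ((smallCover n).R v x hv) ((smallCover n).R w x hw) ((smallCover n).R z x hz)

theorem step_self (v : LabelSet n → ℤˣ) (x : (cactusCover n).Space) (hv : x ∈ nbhd v) :
    step v v x ⟨hv, hv⟩ = Path.Homotopic.Quotient.refl _ :=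
  Path.Homotopic.Quotient.trans_symm ((smallCover n).R v x hv)

/-- Moving the intermediate point along `γ` changes both halves of the step by `γ`, which cancels.
-/
theorem step_eq_of_path (v w : LabelSet n → ℤˣ) {x y : (cactusCover n).Space}
    (hx : x ∈ nbhd v ∩ nbhd w) (hy : y ∈ nbhd v ∩ nbhd w) (γ : Path x y)
    (h : ∀ t, γ t ∈ nbhd v ∩ nbhd w) : step v w x hx = step v w y hy := by
  have h1 := (smallCover n).R_trans (v := v) hx.1 hy.1 γ fun t => (h t).1
  have h2 := (smallCover n).R_trans (v := w) hx.2 hy.2 γ fun t => (h t).2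
  have key : ∀ {a b x y : (cactusCover n).Space} (p : Path.Homotopic.Quotient a x)
      (q : Path.Homotopic.Quotient b x) (g : Path.Homotopic.Quotient x y) (p') (q')
      (_ : p.trans g = p') (_ : q.trans g = q'), p.trans q.symm = p'.trans q'.symm := by
    rintro a b x y p q g _ _ rfl rfl
    have : (q.trans g).symm = g.symm.trans q.symm := by
      refine Path.Homotopic.Quotient.trans_left_cancel (p := q.trans g) ?_
      rw [Path.Homotopic.Quotient.trans_symm, Path.Homotopic.Quotient.trans_assoc,
        Path.Homotopic.Quotient.trans_symm_cancel, Path.Homotopic.Quotient.trans_symm]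
    rw [this, Path.Homotopic.Quotient.trans_assoc, Path.Homotopic.Quotient.trans_symm_cancel]
  exact key _ _ _ _ _ h1 h2

/-- The segment between the two points stays in the convex part of the cube that lies in both
neighbourhoods. The restriction to one cube matters: different 1-cubes may have the same ends, and
steps through them need not be homotopic. -/
theorem step_point_eq (τ : PlanarForest n d) (v w : LabelSet n → ℤˣ) (t t' : Cube d)
    (ht : point τ v t ∈ nbhd v ∩ nbhd w) (ht' : point τ v t' ∈ nbhd v ∩ nbhd w) :
    step v w _ ht = step v w _ ht' := by
  have hc : ∀ r : unitInterval, ∀ i,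
      (1 - (r : ℝ)) * t.1 i + r * t'.1 i ∈ Set.Icc (-1 : ℝ) 1 := by
    intro r i
    exact (convex_Icc (-1 : ℝ) 1) (t.2 i) (t'.2 i) (by linarith [r.2.2]) r.2.1 (by ring)
  let γ : Path (point τ v t) (point τ v t') :=
    { toFun := fun r => point τ v ⟨fun i => (1 - (r : ℝ)) * t.1 i + r * t'.1 i, hc r⟩
      continuous_toFun := by
        refine (continuous_point τ v).comp (Continuous.subtype_mk (continuous_pi fun i => ?_) _)
        fun_prop
      source' := congrArg (point τ v) (Subtype.ext (funext fun i => by simp))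
      target' := congrArg (point τ v) (Subtype.ext (funext fun i => by simp)) }
  refine step_eq_of_path v w ht ht' γ fun r => ?_
  rw [point_mem_nbhd_iff] at ht ht'
  refine (point_mem_nbhd_iff τ v w _).2 ⟨fun i => ?_, fun i => ?_, ht.2.2⟩
  · exact (convex_Ioi (-(1 / 2) : ℝ)) (ht.1 i) (ht'.1 i) (by linarith [r.2.2]) r.2.1 (by ring)
  · have := (convex_Ioi (-(1 / 2) : ℝ)) (ht.2.1 i) (ht'.2.1 i) (a := 1 - (r : ℝ)) (b := r)
      (by linarith [r.2.2]) r.2.1 (by ring)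
    refine lt_of_lt_of_eq this ?_
    simp only [smul_eq_mul]
    ring

/-- The centre of a cube. -/
def origin (d : ℕ) : Cube d := ⟨0, fun i => by simp⟩

/-- The centre of a cube is near all its corners, so every step inside the cube can be taken through
this one point. -/
theorem center_mem_nbhd (τ : PlanarForest n d) (v w : LabelSet n → ℤˣ) (σ : Fin d → ℤˣ)
    (hw : w = v * shift τ σ) : point τ v (origin d) ∈ nbhd w := by
  subst hw
  refine (mem_nbhd_iff _ _ _ _).2 ⟨fun i => ?_, fun S hS => ?_⟩
  · simp [origin]
  · rw [Pi.mul_apply, shift_not_type _ _ hS, mul_one]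

theorem shift_mulSingle (τ : PlanarForest n d) (i : Fin d) (u : ℤˣ) :
    shift τ (Pi.mulSingle i u) = Pi.mulSingle (τ.type i) u := prod_mulSingle_mulSingle τ i u

theorem shift_mul (τ : PlanarForest n d) (σ ρ : Fin d → ℤˣ) :
    shift τ (σ * ρ) = shift τ σ * shift τ ρ := by
  simp only [shift, Pi.mul_apply, Pi.mulSingle_mul, Finset.prod_mul_distrib]

theorem shift_flip (τ : PlanarForest n d) (σ ρ : Fin d → ℤˣ) :
    shift (τ.flip σ) ρ = shift τ ρ := rfl

theorem center_flip (τ : PlanarForest n d) (v : LabelSet n → ℤˣ) (σ : Fin d → ℤˣ) :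
    point (τ.flip σ) (v * shift τ σ) (origin d) = point τ v (origin d) := by
  rw [← point_flip τ v σ]
  congr 1
  refine Subtype.ext (funext fun i => ?_)
  rw [faceMap_refl_apply]
  simp [origin]

/-- The path classes from the 0-cube `1` to the 0-cubes. -/
abbrev Classes (n : ℕ) : Type :=
  Σ v : LabelSet n → ℤˣ, Path.Homotopic.Quotient (vertex (n := n) 1) (vertex v)

/-- The vertex at the other end of an edge from `v`. -/
abbrev moveVertex (e : PlanarForest n 1) (v : LabelSet n → ℤˣ) : LabelSet n → ℤˣ :=
  v * Pi.mulSingle (e.type 0) (-1)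

theorem moveVertex_eq_shift (e : PlanarForest n 1) (v : LabelSet n → ℤˣ) :
    moveVertex e v = v * shift e (Pi.mulSingle 0 (-1)) := by rw [shift_mulSingle]

theorem mem_nbhd_one (τ : PlanarForest n d) (v : LabelSet n → ℤˣ) :
    point τ v (origin d) ∈ nbhd v :=
  center_mem_nbhd τ v v 1 (by rw [shift_one, mul_one])

/-- The extension of a path class along an edge. -/
noncomputable def extendBy (e : PlanarForest n 1) (ω : Classes n) : Classes n :=
  ⟨moveVertex e ω.1, ω.2.trans (step ω.1 (moveVertex e ω.1) (point e ω.1 (origin 1))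
    ⟨mem_nbhd_one e ω.1, center_mem_nbhd e _ _ _ (moveVertex_eq_shift e ω.1)⟩)⟩

/-- The midpoint of the edge may be replaced by the centre of any cube that contains the edge. -/
theorem extendBy_edge (τ : PlanarForest n d) (i : Fin d) (v w : LabelSet n → ℤˣ)
    (hw : w = v * shift τ (Pi.mulSingle i (-1))) (p : Path.Homotopic.Quotient _ (vertex v)) :
    extendBy (τ.edge i) ⟨v, p⟩ = ⟨w, p.trans (step v w (point τ v (origin d))
      ⟨mem_nbhd_one τ v, center_mem_nbhd τ v w _ hw⟩)⟩ := by
  have hw' : w = moveVertex (τ.edge i) v := by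
    rw [hw, shift_mulSingle]; rfl
  subst hw'
  refine congrArg (fun q => (⟨_, Path.Homotopic.Quotient.trans p q⟩ : Classes n)) ?_
  have h : point (τ.edge i) v (origin 1) =
      point τ v (Cube.faceMap (Fin.singleEmb i) 1 (origin 1)) := by
    rw [← point_pull, shift_one, mul_one]; rfl
  have key : ∀ x y (hx : x ∈ nbhd v ∩ nbhd _) (hy : y ∈ nbhd v ∩ nbhd _), x = y →
      step v (moveVertex (τ.edge i) v) x hx = step v _ y hy := by
    rintro x _ hx hy rfl; rfl
  have hm : point (τ.edge i) v (origin 1) ∈ nbhd v ∩ nbhd (moveVertex (τ.edge i) v) :=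
    ⟨mem_nbhd_one _ v, center_mem_nbhd _ _ _ _ (moveVertex_eq_shift _ v)⟩
  exact (key _ _ hm (h ▸ hm) h).trans (step_point_eq τ v _ _ _ _ _)

theorem classes_mk_eq {v w w' : LabelSet n → ℤˣ} {x : (cactusCover n).Space}
    (h : x ∈ nbhd v ∩ nbhd w) (h' : x ∈ nbhd v ∩ nbhd w') (hw : w = w')
    (p : Path.Homotopic.Quotient _ (vertex v)) :
    (⟨w, p.trans (step v w x h)⟩ : Classes n) = ⟨w', p.trans (step v w' x h')⟩ := by
  subst hw; rfl

/-- Taken through the same centre, two consecutive steps compose to one, which depends only on its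
ends. For `i = j` this gives the backtracking relation of the edge group, and for `i ≠ j` the square
relation. -/
theorem extendBy_extendBy (τ : PlanarForest n d) (i j : Fin d) (v w : LabelSet n → ℤˣ)
    (hw : w = v * shift τ (Pi.mulSingle i (-1) * Pi.mulSingle j (-1)))
    (p : Path.Homotopic.Quotient _ (vertex v)) :
    extendBy ((τ.flipAt i).edge j) (extendBy (τ.edge i) ⟨v, p⟩) =
      ⟨w, p.trans (step v w (point τ v (origin d))
        ⟨mem_nbhd_one τ v, center_mem_nbhd τ v w _ hw⟩)⟩ := by
  have hw' : w = v * shift τ (Pi.mulSingle i (-1)) * shift τ (Pi.mulSingle j (-1)) := by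
    rw [hw, shift_mul, mul_assoc]
  have h0 := mem_nbhd_one τ v
  have h1 := center_mem_nbhd τ v _ (Pi.mulSingle i (-1)) rfl
  rw [extendBy_edge τ i v _ rfl, extendBy_edge (τ.flipAt i) j _ w hw']
  have h2 : point (τ.flipAt i) (v * shift τ (Pi.mulSingle i (-1))) (origin d) =
    point τ v (origin d) := center_flip τ v _
  have key : ∀ y (hy : y = point τ v (origin d)) (h : y ∈ nbhd _ ∩ nbhd w),
      (p.trans (step v _ (point τ v (origin d)) ⟨h0, h1⟩)).trans (step _ w y h) =
        p.trans (step v w (point τ v (origin d)) ⟨h0, hy ▸ h.2⟩) := by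
    rintro _ rfl h
    rw [Path.Homotopic.Quotient.trans_assoc, step_trans _ _ _ _ h0 h1 h.2]
  exact congrArg (Sigma.mk w) (key _ h2 _)

theorem edge_zero (e : PlanarForest n 1) : e.edge 0 = e := eq_of_ord_zero (edge_ord _ _ _)

theorem extendBy_flipAt (e : PlanarForest n 1) (ω : Classes n) :
    extendBy (e.flipAt 0) (extendBy e ω) = ω := by
  obtain ⟨v, p⟩ := ω
  have h := extendBy_extendBy e 0 0 v v (by
    rw [← Pi.mulSingle_mul, Int.units_mul_self, Pi.mulSingle_one, shift_one, mul_one]) p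
  rw [edge_zero, edge_zero] at h
  rw [h, step_self _ _ (mem_nbhd_one e v), Path.Homotopic.Quotient.trans_refl]

/-- The extension of path classes along an edge, as a permutation. -/
noncomputable def extendPerm (e : PlanarForest n 1) : Equiv.Perm (Classes n) where
  toFun := extendBy e
  invFun := extendBy (e.flipAt 0)
  left_inv := extendBy_flipAt e
  right_inv ω := by
    have h := extendBy_flipAt (e.flipAt 0) ω
    rwa [flipAt, flipAt, flip_mul, ← Pi.mulSingle_mul, Int.units_mul_self, Pi.mulSingle_one,
      flip_one] at h

/-- The right action of the edge group on path classes. -/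
noncomputable def act (n : ℕ) : EdgeGroup n →* (Equiv.Perm (Classes n))ᵐᵒᵖ :=
  EdgeGroup.lift (fun e => MulOpposite.op (extendPerm e))
    (by
      intro e
      rw [← MulOpposite.op_mul]
      exact congrArg MulOpposite.op (Equiv.ext (extendBy_flipAt e)))
    (by
      intro q
      rw [← MulOpposite.op_mul, ← MulOpposite.op_mul]
      refine congrArg MulOpposite.op (Equiv.ext ?_)
      rintro ⟨v, p⟩
      refine (extendBy_extendBy q 0 1 v _ rfl p).trans ?_
      refine Eq.trans ?_ (extendBy_extendBy q 1 0 v _ rfl p).symm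
      exact classes_mk_eq _ _ (by rw [mul_comm (Pi.mulSingle (0 : Fin 2) _)]) p)

theorem act_of (e : PlanarForest n 1) (ω : Classes n) :
    (act n (EdgeGroup.of e)).unop ω = extendBy e ω := by
  rw [act, EdgeGroup.lift_of]; rfl

theorem act_mul (g h : EdgeGroup n) (ω : Classes n) :
    (act n (g * h)).unop ω = (act n h).unop ((act n g).unop ω) := by
  rw [map_mul, MulOpposite.unop_mul, Equiv.Perm.mul_apply]

theorem act_val (τ : PlanarForest n d) (σ : Fin d → ℤˣ) (v w : LabelSet n → ℤˣ)
    (hw : w = v * shift τ σ) (p : Path.Homotopic.Quotient _ (vertex v)) :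
    (act n (EdgeGroup.val τ σ)).unop ⟨v, p⟩ = ⟨w, p.trans (step v w (point τ v (origin d))
      ⟨mem_nbhd_one τ v, center_mem_nbhd τ v w _ hw⟩)⟩ := by
  induction σ using EdgeGroup.signs_induction generalizing τ v w with
  | h1 =>
    have : v = w := by rw [hw, shift_one, mul_one]
    subst this
    rw [EdgeGroup.val_one, map_one, step_self _ _ (mem_nbhd_one τ v), Path.Homotopic.Quotient.trans_refl]
    rfl
  | h i σ ih =>
    have h0 := mem_nbhd_one τ v
    have h1 := center_mem_nbhd τ v _ (Pi.mulSingle i (-1)) rfl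
    rw [EdgeGroup.val_mul, EdgeGroup.val_mulSingle, act_mul, act_of, extendBy_edge τ i v _ rfl,
      ih (τ.flip _) (v * shift τ (Pi.mulSingle i (-1))) w (by
        rw [hw, shift_flip, shift_mul, mul_assoc])]
    have h2 : point (τ.flipAt i) (v * shift τ (Pi.mulSingle i (-1))) (origin d) =
      point τ v (origin d) := center_flip τ v _
    have key : ∀ y (hy : y = point τ v (origin d)) (h : y ∈ nbhd _ ∩ nbhd w),
        (p.trans (step v _ (point τ v (origin d)) ⟨h0, h1⟩)).trans (step _ w y h) =
          p.trans (step v w (point τ v (origin d)) ⟨h0, hy ▸ h.2⟩) := by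
      rintro _ rfl h
      rw [Path.Homotopic.Quotient.trans_assoc, step_trans _ _ _ _ h0 h1 h.2]
    exact congrArg (Sigma.mk w) (key _ h2 _)

theorem cocycle_point_self (v w : LabelSet n → ℤˣ) (τ : PlanarForest n d) (t : Cube d)
    (h : point τ v t ∈ nbhd v ∩ nbhd w) :
    cocycle v w (point τ v t) = EdgeGroup.val τ fun i => v (τ.type i) * w (τ.type i) := by
  rw [cocycle_point v w τ v t h]
  have : (fun i => v (τ.type i) * v (τ.type i)) = 1 := funext fun i => Int.units_mul_self _
  rw [this, flip_one]

/-- In a cube whose positive corner is `v`, the cocycle is a product of generators along edges;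
these act by consecutive steps that amount to the step through the centre, and hence through `x`. -/
theorem act_cocycle (v w : LabelSet n → ℤˣ) (x : (cactusCover n).Space)
    (hx : x ∈ nbhd v ∩ nbhd w) (p : Path.Homotopic.Quotient _ (vertex v)) :
    (act n (cocycle v w x)).unop ⟨v, p⟩ = ⟨w, p.trans (step v w x hx)⟩ := by
  obtain ⟨d, τ, t, rfl⟩ := exists_eq_point_of_mem_nbhd hx.1
  have hw := ((point_mem_nbhd_iff _ _ _ _).1 hx).2.2
  rw [cocycle_point_self v w τ t hx, act_val τ _ v w hw]
  exact congrArg (fun q => (⟨w, p.trans q⟩ : Classes n)) (step_point_eq τ v w _ t _ hx)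

/-- The homomorphism from the edge group to `(ℤ/2)^L`. -/
def types (n : ℕ) : EdgeGroup n →* (LabelSet n → ℤˣ) :=
  EdgeGroup.lift (fun e => Pi.mulSingle (e.type 0) (-1))
    (by
      intro e
      have : (e.flipAt 0).type 0 = e.type 0 := rfl
      rw [this, ← Pi.mulSingle_mul, Int.units_mul_self, Pi.mulSingle_one])
    (by
      intro q
      have h : ∀ i j, ((q.flipAt i).edge j).type 0 = q.type j := fun _ _ => rfl
      have h' : ∀ j, (q.edge j).type 0 = q.type j := fun _ => rfl
      rw [h, h, h', h', mul_comm])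

/-- On end points the action is translation by `types`, so the kernel of `types` consists of the
elements that bring the trivial path back to its 0-cube. -/
theorem act_fst (g : EdgeGroup n) (ω : Classes n) :
    ((act n g).unop ω).1 = ω.1 * types n g := by
  have hg : g ∈ Subgroup.closure (Set.range EdgeGroup.of) := by
    rw [EdgeGroup.closure_range_of]; trivial
  induction hg using Subgroup.closure_induction generalizing ω with
  | mem a ha =>
    obtain ⟨e, rfl⟩ := ha
    rw [act_of, types, EdgeGroup.lift_of]; rfl
  | one => rw [map_one, map_one, mul_one]; rfl
  | mul g h _ _ hg hh => rw [act_mul, hh, hg, map_mul, mul_assoc]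
  | inv g _ hg =>
    have := hg ((act n g⁻¹).unop ω)
    rw [← act_mul, inv_mul_cancel, map_one] at this
    rw [map_inv (types n), eq_mul_inv_iff_mul_eq, ← this]; rfl

theorem fundamentalGroup_equiv_ker (n : ℕ) :
    Nonempty (FundamentalGroup (cactusCover n).Space (vertex 1) ≃* (types n).ker) := by
  refine (smallCover n).fundamentalGroup_equiv (1 : LabelSet n → ℤˣ) (act n) act_cocycle
    (Set.range EdgeGroup.of) EdgeGroup.closure_range_of ?_ _ ?_
  -- Every generator is a value of the cocycle at every 0-cube: it is attained at the midpoint of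
  -- the 1-cube `e` starting at `v`.
  · rintro _ ⟨e, rfl⟩ v
    have hx : point e v (origin 1) ∈ nbhd v ∩ nbhd (moveVertex e v) :=
      ⟨mem_nbhd_one e v, center_mem_nbhd e _ _ _ (moveVertex_eq_shift e v)⟩
    refine ⟨moveVertex e v, point e v (origin 1), hx, ?_⟩
    refine (cocycle_point_self _ _ _ _ hx).trans ?_
    have h : (fun i => v (e.type i) * moveVertex e v (e.type i)) = Pi.mulSingle 0 (-1) := by
      funext i
      obtain rfl := Subsingleton.elim i 0
      change v (e.type 0) * (v (e.type 0) * Pi.mulSingle (M := fun _ => ℤˣ) (e.type 0) (-1) _) = _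
      rw [Pi.mulSingle_eq_same, Pi.mulSingle_eq_same, ← mul_assoc, Int.units_mul_self, one_mul]
    rw [h, EdgeGroup.val_mulSingle, edge_zero]
  · intro g
    have := act_fst g ⟨1, Path.Homotopic.Quotient.refl _⟩
    rw [one_mul] at this
    rw [MonoidHom.mem_ker, ← this]
    rfl

/-! ### Compactness and connectedness -/

instance : Finite (OrdSubset n) :=
  Finite.of_injective (fun A : OrdSubset n => (A.carrier, A.lt)) fun _ _ h =>
    OrdSubset.ext (congrArg Prod.fst h) (congrArg Prod.snd h)

instance : Finite (PlanarForest n d) :=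
  Finite.of_injective (fun τ : PlanarForest n d => τ.ord) fun _ _ h =>
    PlanarForest.ext h

/-- The internal edges of a forest have distinct types, which bounds the dimension by the size of
`L`; so there are finitely many compact cubes. -/
theorem compactSpace (n : ℕ) : CompactSpace (cactusCover n).Space := by
  let N := Fintype.card (LabelSet n)
  have hd : ∀ {d : ℕ}, PlanarForest n d → d ≤ N := fun τ => by
    simpa using Fintype.card_le_of_injective _ τ.type_injective
  have hfin : ∀ d, Finite ((cactusCover n).cell d) := fun d =>
    inferInstanceAs (Finite (PlanarForest n d × (LabelSet n → ℤˣ)))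
  have : Finite (Σ d : ℕ, (cactusCover n).cell d) := by
    refine Finite.of_injective (β := Σ d : Fin (N + 1), (cactusCover n).cell d)
      (fun c => ⟨⟨c.1, Nat.lt_succ_of_le (hd c.2.1)⟩, c.2⟩) ?_
    rintro ⟨d, c⟩ ⟨d', c'⟩ h
    simp only [Sigma.mk.injEq, Fin.mk.injEq] at h
    obtain ⟨rfl, h⟩ := h
    rw [eq_of_heq h]
  have hc : ∀ d, CompactSpace (Cube d) := by
    intro d
    have : IsCompact {t : Fin d → ℝ | ∀ i, t i ∈ Set.Icc (-1 : ℝ) 1} := by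
      have := isCompact_univ_pi (fun _ : Fin d => isCompact_Icc (a := (-1 : ℝ)) (b := 1))
      convert this using 1
      ext t
      simp [Pi.le_def, forall_and]
    exact isCompact_iff_compactSpace.1 this
  exact Quot.compactSpace

/-- The forest with a single internal edge with the given set of leaves above it. -/
def singleForest (S : LabelSet n) : PlanarForest n 1 where
  ord _ :=
    { carrier := S.1
      lt := fun a b => a ∈ S.1 ∧ b ∈ S.1 ∧ a < b
      mem_left := fun _ _ h => h.1
      mem_right := fun _ _ h => h.2.1
      irrefl := fun _ h => lt_irrefl _ h.2.2
      trans := fun _ _ _ h h' => ⟨h.1, h'.2.1, h.2.2.trans h'.2.2⟩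
      total := fun _ ha _ hb hab => (lt_or_gt_of_ne hab).imp (fun h => ⟨ha, hb, h⟩)
        fun h => ⟨hb, ha, h⟩ }
  two_le _ := S.2
  carrier_injective _ _ _ := Subsingleton.elim _ _
  compat _ _ := Or.inr (Or.inl ⟨subset_rfl, fun _ _ _ _ => Iff.rfl, fun _ _ _ _ _ h _ => h.2.1⟩)

theorem joined_vertex (v : LabelSet n → ℤˣ) : Joined (vertex 1) (vertex v) := by
  have h1 : ∀ (v : LabelSet n → ℤˣ) (S : LabelSet n),
      Joined (vertex v) (vertex (v * Pi.mulSingle S (-1))) := by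
    intro v S
    obtain ⟨p⟩ := Path.Homotopic.Quotient.mk_surjective (step v (v * Pi.mulSingle S (-1))
      (point (singleForest S) v (origin 1)) ⟨mem_nbhd_one _ v,
        center_mem_nbhd _ _ _ _ (moveVertex_eq_shift (singleForest S) v)⟩)
    exact ⟨p⟩
  have key : ∀ s : Finset (LabelSet n), Joined (vertex 1) (vertex (∏ S ∈ s, Pi.mulSingle S (v S))) := by
    intro s
    induction s using Finset.induction_on with
    | empty => exact Joined.refl _
    | insert S s hS ih =>
      rw [Finset.prod_insert hS, mul_comm]
      rcases Int.units_eq_one_or (v S) with h | h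
      · rwa [h, Pi.mulSingle_one, mul_one]
      · rw [h]
        exact ih.trans (h1 _ S)
  have := key Finset.univ
  rwa [Finset.univ_prod_mulSingle] at this

theorem pathConnectedSpace (n : ℕ) : PathConnectedSpace (cactusCover n).Space := by
  have key : ∀ x : (cactusCover n).Space, Joined (vertex 1) x := by
    intro x
    obtain ⟨v, hv⟩ := exists_mem_nbhd x
    exact (joined_vertex v).trans ⟨(pathToVertex v x hv).symm⟩
  exact ⟨⟨vertex 1⟩, fun x y => (key x).symm.trans (key y)⟩

end cactusCover

/-! ## Frames of planar forests -/

variable {n d k : ℕ}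

theorem revInterval_inv (p : CactusIndex n) : (revInterval p)⁻¹ = revInterval p :=
  inv_eq_of_mul_eq_one_left (VCactus.revInterval_mul_self p)

theorem revInterval_lt_iff (p : CactusIndex n) (a b : Fin n) :
    revInterval p a < revInterval p b ↔
      if (p.1.1 ≤ a ∧ a ≤ p.1.2) ∧ p.1.1 ≤ b ∧ b ≤ p.1.2 then b < a else a < b := by
  have hp : (p.1.1 : ℕ) < p.1.2 := p.2
  simp only [Fin.lt_def, Fin.le_def, revInterval_val]
  split_ifs <;> omega

theorem mem_imageInterval (w : Equiv.Perm (Fin n)) (p : CactusIndex n) (a : Fin n) :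
    a ∈ (imageInterval w p).1 ↔ p.1.1 ≤ w⁻¹ a ∧ w⁻¹ a ≤ p.1.2 := by
  rw [imageInterval, Finset.mem_map_equiv, Finset.mem_Icc]; rfl

/-- A permutation is viewed as a list of the labels. Multiplying by `revInterval p` on the right
reverses the entries in the positions `p`; this lemma and the next ones track which labels the
intervals of positions then contain. -/
theorem imageInterval_mul_revInterval_self (w : Equiv.Perm (Fin n)) (p : CactusIndex n) :
    imageInterval (w * revInterval p) p = imageInterval w p := by
  refine Subtype.ext (Finset.ext fun a => ?_)
  rw [mem_imageInterval, mem_imageInterval, mul_inv_rev, revInterval_inv, Equiv.Perm.mul_apply]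
  simp only [Fin.le_def, revInterval_val]
  split_ifs <;> omega

theorem imageInterval_mul_revInterval_of_disjoint (w : Equiv.Perm (Fin n)) {p q : CactusIndex n}
    (h : Disjoint (Set.Icc p.1.1 p.1.2) (Set.Icc q.1.1 q.1.2)) :
    imageInterval (w * revInterval p) q = imageInterval w q := by
  have hp : (p.1.1 : ℕ) < p.1.2 := p.2
  have hq : (q.1.1 : ℕ) < q.1.2 := q.2
  have h' : ∀ m : Fin n, ¬ (((p.1.1 : ℕ) ≤ m ∧ (m : ℕ) ≤ p.1.2) ∧ (q.1.1 : ℕ) ≤ m ∧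
      (m : ℕ) ≤ q.1.2) := fun m hm => Set.disjoint_left.1 h hm.1 hm.2
  refine Subtype.ext (Finset.ext fun a => ?_)
  rw [mem_imageInterval, mem_imageInterval, mul_inv_rev, revInterval_inv, Equiv.Perm.mul_apply]
  have h1 := h' p.1.1
  have h2 := h' q.1.1
  simp only [Fin.le_def, revInterval_val]
  split_ifs <;> omega

theorem imageInterval_mul_revInterval_of_subset (w : Equiv.Perm (Fin n)) {p q : CactusIndex n}
    (h : Set.Icc q.1.1 q.1.2 ⊆ Set.Icc p.1.1 p.1.2) :
    imageInterval (w * revInterval q) p = imageInterval w p := by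
  have hq : (q.1.1 : ℕ) < q.1.2 := q.2
  have ha : (p.1.1 : ℕ) ≤ q.1.1 := (h (Set.left_mem_Icc.2 hq.le)).1
  have hb : (q.1.2 : ℕ) ≤ p.1.2 := (h (Set.right_mem_Icc.2 hq.le)).2
  refine Subtype.ext (Finset.ext fun a => ?_)
  rw [mem_imageInterval, mem_imageInterval, mul_inv_rev, revInterval_inv, Equiv.Perm.mul_apply]
  simp only [Fin.le_def, revInterval_val]
  split_ifs <;> omega

theorem imageInterval_mul_revInterval_of_nest (w : Equiv.Perm (Fin n)) {p q r : CactusIndex n}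
    (h : Set.Icc q.1.1 q.1.2 ⊆ Set.Icc p.1.1 p.1.2)
    (h₁ : r.1.1 = revInterval p q.1.2) (h₂ : r.1.2 = revInterval p q.1.1) :
    imageInterval (w * revInterval p) q = imageInterval w r := by
  have hq : (q.1.1 : ℕ) < q.1.2 := q.2
  have ha : (p.1.1 : ℕ) ≤ q.1.1 := (h (Set.left_mem_Icc.2 hq.le)).1
  have hb : (q.1.2 : ℕ) ≤ p.1.2 := (h (Set.right_mem_Icc.2 hq.le)).2
  have e₁ := congrArg Fin.val h₁
  have e₂ := congrArg Fin.val h₂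
  rw [revInterval_val, if_pos (by omega)] at e₁ e₂
  refine Subtype.ext (Finset.ext fun a => ?_)
  rw [mem_imageInterval, mem_imageInterval, mul_inv_rev, revInterval_inv, Equiv.Perm.mul_apply]
  simp only [Fin.le_def, revInterval_val]
  split_ifs <;> omega

/-- The reflection of the interval `q` in the interval `p`. -/
theorem exists_reflection {p q : CactusIndex n} (h : Set.Icc q.1.1 q.1.2 ⊆ Set.Icc p.1.1 p.1.2) :
    ∃ r : CactusIndex n, Set.Icc r.1.1 r.1.2 ⊆ Set.Icc p.1.1 p.1.2 ∧
      r.1.1 = revInterval p q.1.2 ∧ r.1.2 = revInterval p q.1.1 ∧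
      q.1.1 = revInterval p r.1.2 ∧ q.1.2 = revInterval p r.1.1 := by
  have hq : (q.1.1 : ℕ) < q.1.2 := q.2
  have ha : (p.1.1 : ℕ) ≤ q.1.1 := (h (Set.left_mem_Icc.2 hq.le)).1
  have hb : (q.1.2 : ℕ) ≤ p.1.2 := (h (Set.right_mem_Icc.2 hq.le)).2
  have e₁ := revInterval_val p q.1.2
  have e₂ := revInterval_val p q.1.1
  rw [if_pos (by omega)] at e₁ e₂
  have hinv : ∀ m, revInterval p (revInterval p m) = m := fun m => by
    rw [← Equiv.Perm.mul_apply, VCactus.revInterval_mul_self, Equiv.Perm.one_apply]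
  refine ⟨⟨(revInterval p q.1.2, revInterval p q.1.1), by
      change (revInterval p q.1.2 : ℕ) < revInterval p q.1.1
      omega⟩, fun m hm => ?_, rfl, rfl, (hinv _).symm, (hinv _).symm⟩
  have h1 : (revInterval p q.1.2 : ℕ) ≤ m := hm.1
  have h2 : (m : ℕ) ≤ revInterval p q.1.1 := hm.2
  exact ⟨by rw [Fin.le_def]; omega, by rw [Fin.le_def]; omega⟩

/-- The ordered set `(w(i), …, w(j))`. -/
def ordInterval (w : Equiv.Perm (Fin n)) (p : CactusIndex n) : OrdSubset n where
  carrier := (imageInterval w p).1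
  lt a b := a ∈ (imageInterval w p).1 ∧ b ∈ (imageInterval w p).1 ∧ w⁻¹ a < w⁻¹ b
  mem_left _ _ h := h.1
  mem_right _ _ h := h.2.1
  irrefl _ h := lt_irrefl _ h.2.2
  trans _ _ _ h h' := ⟨h.1, h'.2.1, h.2.2.trans h'.2.2⟩
  total a ha b hb hab := by
    rcases lt_or_gt_of_ne ((w⁻¹).injective.ne hab) with h | h
    · exact Or.inl ⟨ha, hb, h⟩
    · exact Or.inr ⟨hb, ha, h⟩

/-- The forest with a single internal edge and with the leaves `w(i), …, w(j)` above it. -/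
def ordForest (w : Equiv.Perm (Fin n)) (p : CactusIndex n) : PlanarForest n 1 where
  ord _ := ordInterval w p
  two_le _ := (imageInterval w p).2
  carrier_injective _ _ _ := Subsingleton.elim _ _
  compat _ _ := Or.inr (Or.inl ⟨subset_rfl, fun _ _ _ _ => Iff.rfl,
    fun _ _ _ _ _ h _ => h.2.1⟩)

/-- The order of `A` is the one of the positions of its elements in `w`. -/
def OrdSubset.Follows (A : OrdSubset n) (w : Equiv.Perm (Fin n)) : Prop :=
  ∀ a ∈ A.carrier, ∀ b ∈ A.carrier, (A.lt a b ↔ w⁻¹ a < w⁻¹ b)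

theorem OrdSubset.eq_ordInterval {A : OrdSubset n} {w : Equiv.Perm (Fin n)} {p : CactusIndex n}
    (hc : A.carrier = (imageInterval w p).1) (h : A.Follows w) : A = ordInterval w p := by
  ext a b
  · rw [hc]; rfl
  · constructor
    · intro hab
      have ha := A.mem_left _ _ hab
      have hb := A.mem_right _ _ hab
      exact ⟨hc ▸ ha, hc ▸ hb, (h a ha b hb).1 hab⟩
    · rintro ⟨ha, hb, hab⟩
      exact (h a (hc ▸ ha) b (hc ▸ hb)).2 hab

/-- In a frame, a flip is the reversal of the entries in the positions `p`: both exchange the order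
of two labels exactly when both labels lie there. -/
theorem flipAt_ord_eq_ordInterval (τ : PlanarForest n d) (i j : Fin d) {w : Equiv.Perm (Fin n)}
    {p q q' : CactusIndex n} (hi : (τ.ord i).carrier = (imageInterval w p).1)
    (hj : τ.ord j = ordInterval w q)
    (hq : imageInterval (w * revInterval p) q' = imageInterval w q) :
    (τ.flipAt i).ord j = ordInterval (w * revInterval p) q' := by
  have hc : ((τ.flipAt i).ord j).carrier = (imageInterval w q).1 := congrArg OrdSubset.carrier hj
  refine OrdSubset.eq_ordInterval (hc.trans (congrArg Subtype.val hq).symm) fun a ha b hb => ?_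
  rw [hc] at ha hb
  rw [flipAt_lt, hi, hj, mul_inv_rev, revInterval_inv, Equiv.Perm.mul_apply, Equiv.Perm.mul_apply,
    revInterval_lt_iff]
  simp only [← mem_imageInterval]
  have h : ∀ x y, x ∈ (imageInterval w q).1 → y ∈ (imageInterval w q).1 →
      ((ordInterval w q).lt x y ↔ w⁻¹ x < w⁻¹ y) := fun x y hx hy =>
    ⟨fun h => h.2.2, fun h => ⟨hx, hy, h⟩⟩
  rw [h a b ha hb, h b a hb ha]

theorem flipAt_edge_eq_ordForest (τ : PlanarForest n d) (i j : Fin d) {w : Equiv.Perm (Fin n)}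
    {p q q' : CactusIndex n} (hi : (τ.ord i).carrier = (imageInterval w p).1)
    (hj : τ.ord j = ordInterval w q)
    (hq : imageInterval (w * revInterval p) q' = imageInterval w q) :
    (τ.flipAt i).edge j = ordForest (w * revInterval p) q' :=
  eq_of_ord_zero ((edge_ord _ _ _).trans (flipAt_ord_eq_ordInterval τ i j hi hj hq))

theorem flipAt_ordForest (w : Equiv.Perm (Fin n)) (p : CactusIndex n) :
    (ordForest w p).flipAt 0 = ordForest (w * revInterval p) p :=
  eq_of_ord_zero (flipAt_ord_eq_ordInterval _ 0 0 rfl rfl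
    (imageInterval_mul_revInterval_self w p))

/-! ### Existence of frames -/

open Classical in
/-- The number of the elements of `A` before `a`. -/
noncomputable def OrdSubset.rank (A : OrdSubset n) (a : Fin n) : ℕ :=
  (A.carrier.filter fun b => A.lt b a).card

theorem OrdSubset.rank_lt (A : OrdSubset n) {a b : Fin n} (h : A.lt a b) :
    A.rank a < A.rank b := by
  classical
  refine Finset.card_lt_card ⟨fun c hc => ?_, fun hc => ?_⟩
  · rw [Finset.mem_filter] at hc ⊢
    exact ⟨hc.1, A.trans _ _ _ hc.2 h⟩
  · have := hc (Finset.mem_filter.2 ⟨A.mem_left _ _ h, h⟩)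
    exact A.irrefl a (Finset.mem_filter.1 this).2

theorem OrdSubset.rank_lt_iff (A : OrdSubset n) {a b : Fin n} (ha : a ∈ A.carrier)
    (hb : b ∈ A.carrier) : A.rank a < A.rank b ↔ A.lt a b := by
  refine ⟨fun h => ?_, A.rank_lt⟩
  by_cases hab : a = b
  · subst hab
    exact absurd h (lt_irrefl _)
  · exact (A.total a ha b hb hab).resolve_right fun h' => (A.rank_lt h').not_gt h

theorem OrdSubset.rank_lt_card (A : OrdSubset n) {a : Fin n} (ha : a ∈ A.carrier) :
    A.rank a < n := by
  classical
  have : (A.carrier.filter fun b => A.lt b a).card < A.carrier.card :=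
    Finset.card_lt_card ⟨Finset.filter_subset _ _,
      fun hc => A.irrefl a (Finset.mem_filter.1 (hc ha)).2⟩
  exact this.trans_le ((Finset.card_le_univ _).trans_eq (Fintype.card_fin n))

theorem exists_sorting (f : Fin n → ℕ) (hf : Function.Injective f) :
    ∃ w : Equiv.Perm (Fin n), ∀ a b, w⁻¹ a < w⁻¹ b ↔ f a < f b := by
  refine ⟨Tuple.sort f, fun a b => ?_⟩
  have h : StrictMono (f ∘ Tuple.sort f) :=
    (Tuple.monotone_sort f).strictMono_of_injective (hf.comp (Tuple.sort f).injective)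
  rw [← h.lt_iff_lt]
  simp

/-- `A` consists of consecutive elements of `w`, in the same order. -/
def OrdSubset.IsFramedBy (A : OrdSubset n) (w : Equiv.Perm (Fin n)) : Prop :=
  A.Follows w ∧ ∀ a ∈ A.carrier, ∀ b ∈ A.carrier, ∀ c, w⁻¹ a < w⁻¹ c → w⁻¹ c < w⁻¹ b →
    c ∈ A.carrier

theorem OrdSubset.IsFramedBy.exists_eq {A : OrdSubset n} {w : Equiv.Perm (Fin n)}
    (h : A.IsFramedBy w) (hA : 2 ≤ A.carrier.card) : ∃ p, A = ordInterval w p := by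
  obtain ⟨x, hx, y, hy, hxy⟩ := Finset.one_lt_card.1 hA
  obtain ⟨a, ha, ha'⟩ := A.carrier.exists_min_image (fun a => w⁻¹ a) ⟨x, hx⟩
  obtain ⟨b, hb, hb'⟩ := A.carrier.exists_max_image (fun a => w⁻¹ a) ⟨x, hx⟩
  have hab : w⁻¹ a < w⁻¹ b := by
    rcases lt_or_gt_of_ne ((w⁻¹).injective.ne hxy) with h | h
    · exact (ha' x hx).trans_lt (h.trans_le (hb' y hy))
    · exact (ha' y hy).trans_lt (h.trans_le (hb' x hx))
  refine ⟨⟨(w⁻¹ a, w⁻¹ b), hab⟩, OrdSubset.eq_ordInterval (Finset.ext fun c => ?_) h.1⟩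
  rw [mem_imageInterval]
  refine ⟨fun hc => ⟨ha' c hc, hb' c hc⟩, fun hc => ?_⟩
  rcases hc.1.eq_or_lt with h1 | h1
  · exact (w⁻¹).injective h1 ▸ ha
  rcases hc.2.eq_or_lt with h2 | h2
  · exact (w⁻¹).injective h2 ▸ hb
  exact h.2 a ha b hb c h1 h2

/-- The labels are listed with `A` first, then the rest of `B`, then everything else, with `A` and
`B` in their own orders. -/
theorem OrdSubset.exists_frame (A B : OrdSubset n) : ∃ w : Equiv.Perm (Fin n), A.IsFramedBy w ∧
    (Disjoint A.carrier B.carrier → B.IsFramedBy w) := by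
  classical
  -- Ranks and labels are below `n`, so the three groups take values in the separate ranges starting
  -- at `0`, `n` and `2 * n`.
  let f : Fin n → ℕ := fun a =>
    if a ∈ A.carrier then A.rank a else if a ∈ B.carrier then n + B.rank a else 2 * n + a
  have hf : Function.Injective f := by
    intro a b hab
    by_contra hne
    by_cases ha : a ∈ A.carrier
    · have := A.rank_lt_card ha
      by_cases hb : b ∈ A.carrier
      · simp only [f, ha, hb, if_true] at hab
        rcases A.total a ha b hb hne with h | h <;> have := A.rank_lt h <;> omega
      · simp only [f, ha, hb, if_true, if_false] at hab
        split_ifs at hab <;> omega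
    · by_cases hb : b ∈ A.carrier
      · have := A.rank_lt_card hb
        simp only [f, ha, hb, if_true, if_false] at hab
        split_ifs at hab <;> omega
      · simp only [f, ha, hb, if_false] at hab
        by_cases ha' : a ∈ B.carrier
        · have := B.rank_lt_card ha'
          by_cases hb' : b ∈ B.carrier
          · simp only [ha', hb', if_true] at hab
            rcases B.total a ha' b hb' hne with h | h <;> have := B.rank_lt h <;> omega
          · simp only [ha', hb', if_true, if_false] at hab
            omega
        · by_cases hb' : b ∈ B.carrier
          · have := B.rank_lt_card hb'
            simp only [ha', hb', if_true, if_false] at hab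
            omega
          · simp only [ha', hb', if_false] at hab
            exact hne (Fin.ext (by omega))
  obtain ⟨w, hw⟩ := exists_sorting f hf
  refine ⟨w, ⟨fun a ha b hb => ?_, fun a ha b hb c h1 h2 => ?_⟩, fun hAB => ?_⟩
  · rw [hw, ← A.rank_lt_iff ha hb]
    simp only [f, ha, hb, if_true]
  · rw [hw] at h1 h2
    by_contra hc
    have := A.rank_lt_card hb
    simp only [f, hb, hc, if_true, if_false] at h2
    split_ifs at h2 <;> omega
  · have hd : ∀ a ∈ B.carrier, a ∉ A.carrier := fun a ha ha' =>
      Finset.disjoint_left.1 hAB ha' ha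
    refine ⟨fun a ha b hb => ?_, fun a ha b hb c h1 h2 => ?_⟩
    · rw [hw, ← B.rank_lt_iff ha hb]
      simp only [f, ha, hb, hd a ha, hd b hb, if_true, if_false]
      omega
    · rw [hw] at h1 h2
      by_contra hc
      have := B.rank_lt_card hb
      by_cases hc' : c ∈ A.carrier
      · have := A.rank_lt_card hc'
        simp only [f, ha, hd a ha, hc', if_true, if_false] at h1
        omega
      · simp only [f, hb, hd b hb, hc, hc', if_true, if_false] at h2
        omega

theorem OrdSubset.IsFramedBy.of_isIntervalOf {A B : OrdSubset n} {w : Equiv.Perm (Fin n)}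
    (hA : A.IsFramedBy w) (h : B.IsIntervalOf A) : B.IsFramedBy w := by
  refine ⟨fun a ha b hb => ?_, fun a ha b hb c h1 h2 => ?_⟩
  · rw [h.lt_iff a ha b hb, hA.1 a (h.subset ha) b (h.subset hb)]
  · have ha' := h.subset ha
    have hb' := h.subset hb
    have hc := hA.2 a ha' b hb' c h1 h2
    exact h.convex a ha b hb c ((hA.1 a ha' c hc).2 h1) ((hA.1 c hc b hb').2 h2)

theorem exists_ordForest_eq (e : PlanarForest n 1) : ∃ w p, ordForest w p = e := by
  obtain ⟨w, hw, -⟩ := (e.ord 0).exists_frame (e.ord 0)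
  obtain ⟨p, hp⟩ := hw.exists_eq (e.two_le 0)
  exact ⟨w, p, eq_of_ord_zero hp.symm⟩

/-- Disjoint sets can be listed one after the other; a frame of the larger of two nested sets is
also a frame of its intervals. -/
theorem exists_common_frame (τ : PlanarForest n d) (i j : Fin d)
    (h : Disjoint (τ.ord i).carrier (τ.ord j).carrier ∨ (τ.ord j).IsIntervalOf (τ.ord i)) :
    ∃ w p q, τ.ord i = ordInterval w p ∧ τ.ord j = ordInterval w q := by
  obtain ⟨w, hw, hw'⟩ := (τ.ord i).exists_frame (τ.ord j)
  obtain ⟨p, hp⟩ := hw.exists_eq (τ.two_le i)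
  obtain ⟨q, hq⟩ := (h.elim hw' hw.of_isIntervalOf).exists_eq (τ.two_le j)
  exact ⟨w, p, q, hp, hq⟩

/-! ### Uniqueness of frames -/

/-- The rank is intrinsic to the ordered set, so its positions in any two frames differ by a
translation. -/
theorem rank_ordInterval (w : Equiv.Perm (Fin n)) (p : CactusIndex n) {a : Fin n}
    (ha : a ∈ (imageInterval w p).1) :
    (ordInterval w p).rank a + p.1.1 = (w⁻¹ a : Fin n) := by
  classical
  have h1 := (mem_imageInterval w p a).1 ha
  have h : ((ordInterval w p).carrier.filter fun b => (ordInterval w p).lt b a) =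
      (Finset.Ico p.1.1 (w⁻¹ a)).map w.toEmbedding := by
    ext b
    rw [Finset.mem_filter, Finset.mem_map_equiv, Finset.mem_Ico]
    constructor
    · rintro ⟨hb, -, -, hab⟩
      exact ⟨((mem_imageInterval w p b).1 hb).1, hab⟩
    · rintro ⟨h2, h3⟩
      have hb : b ∈ (imageInterval w p).1 := (mem_imageInterval w p b).2 ⟨h2, (h3.trans_le h1.2).le⟩
      exact ⟨hb, hb, ha, h3⟩
  rw [OrdSubset.rank]
  have h2 : (p.1.1 : ℕ) ≤ (w⁻¹ a : Fin n) := h1.1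
  have h3 := congrArg Finset.card h
  rw [Finset.card_map, Fin.card_Ico] at h3
  have h4 : ∀ x y z : ℕ, y ≤ z → x = z - y → x + y = z := by omega
  refine h4 _ _ _ h2 (Eq.trans ?_ h3)
  congr

/-- The conclusion is the hypothesis of the mixed relation of `vC_n` for `w'⁻¹ * w`: two frames of
one ordered set differ by a permutation that translates an interval. -/
theorem ordInterval_eq_iff {w w' : Equiv.Perm (Fin n)} {p p' : CactusIndex n}
    (h : ordInterval w p = ordInterval w' p') :
    (∀ m ∈ Set.Icc p.1.1 p.1.2,
      ((w'⁻¹ * w) m : ℕ) + p.1.1 = (w'⁻¹ * w) p.1.1 + m) ∧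
    p'.1.1 = (w'⁻¹ * w) p.1.1 ∧ p'.1.2 = (w'⁻¹ * w) p.1.2 := by
  have hp : (p.1.1 : ℕ) < p.1.2 := p.2
  have hp' : (p'.1.1 : ℕ) < p'.1.2 := p'.2
  have hc : (imageInterval w p).1 = (imageInterval w' p').1 := congrArg OrdSubset.carrier h
  have key : ∀ a ∈ (imageInterval w p).1,
      ((w'⁻¹ a : Fin n) : ℕ) + p.1.1 = (w⁻¹ a : Fin n) + p'.1.1 := by
    intro a ha
    have h1 := rank_ordInterval w p ha
    have h2 := rank_ordInterval w' p' (hc ▸ ha)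
    rw [← h] at h2
    omega
  have hmem : ∀ m : Fin n, p.1.1 ≤ m ∧ m ≤ p.1.2 → w m ∈ (imageInterval w p).1 := fun m hm => by
    rw [mem_imageInterval]; simpa using hm
  have key' : ∀ m : Fin n, p.1.1 ≤ m ∧ m ≤ p.1.2 →
      (((w'⁻¹ * w) m : Fin n) : ℕ) + p.1.1 = m + p'.1.1 := by
    intro m hm
    have := key (w m) (hmem m hm)
    simpa using this
  have h1 := key' p.1.1 ⟨le_rfl, p.2.le⟩
  have h2 := key' p.1.2 ⟨p.2.le, le_rfl⟩
  have h3 := (mem_imageInterval w' p' (w p.1.2)).1 (hc ▸ hmem p.1.2 ⟨p.2.le, le_rfl⟩)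
  have hmem' : w' p'.1.2 ∈ (imageInterval w' p').1 := by
    rw [mem_imageInterval]; simpa using p'.2.le
  have h4 := key (w' p'.1.2) (hc ▸ hmem')
  have h5 : (((w⁻¹ (w' p'.1.2)) : Fin n) : ℕ) ≤ p.1.2 :=
    ((mem_imageInterval w p (w' p'.1.2)).1 (hc ▸ hmem')).2
  have h6 : w'⁻¹ (w' p'.1.2) = p'.1.2 := by simp
  have h7 : ((w'⁻¹ (w p.1.2) : Fin n) : ℕ) ≤ p'.1.2 := h3.2
  rw [h6] at h4
  rw [Equiv.Perm.mul_apply] at h2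
  refine ⟨fun m hm => ?_, Fin.ext ?_, Fin.ext ?_⟩
  · have := key' m hm
    omega
  · omega
  · rw [Equiv.Perm.mul_apply]
    omega

theorem ordInterval_eq_of_shift {w : Equiv.Perm (Fin n)} {p r : CactusIndex n}
    (h : ∀ m ∈ Set.Icc p.1.1 p.1.2, (w m : ℕ) + p.1.1 = w p.1.1 + m)
    (h₁ : r.1.1 = w p.1.1) (h₂ : r.1.2 = w p.1.2) : ordInterval w p = ordInterval 1 r := by
  have hp : (p.1.1 : ℕ) < p.1.2 := p.2
  have hc : (imageInterval w p).1 = (imageInterval 1 r).1 := by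
    refine Finset.eq_of_subset_of_card_le (fun a ha => ?_) ?_
    · rw [mem_imageInterval] at ha ⊢
      have h3 := h _ ha
      have h4 := h p.1.2 ⟨hp.le, le_rfl⟩
      have h5 : w (w⁻¹ a) = a := by simp
      rw [h5] at h3
      have h6 : (p.1.1 : ℕ) ≤ (w⁻¹ a : Fin n) := ha.1
      have h7 : ((w⁻¹ a : Fin n) : ℕ) ≤ p.1.2 := ha.2
      rw [inv_one, Equiv.Perm.one_apply, h₁, h₂, Fin.le_def, Fin.le_def]
      omega
    · have h4 := h p.1.2 ⟨hp.le, le_rfl⟩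
      rw [imageInterval, imageInterval, Finset.card_map, Finset.card_map, Fin.card_Icc,
        Fin.card_Icc, h₁, h₂]
      omega
  refine OrdSubset.eq_ordInterval hc fun a ha b hb => ?_
  have hlt : (ordInterval w p).lt a b ↔ w⁻¹ a < w⁻¹ b := ⟨fun h => h.2.2, fun h => ⟨ha, hb, h⟩⟩
  have ha := h _ ((mem_imageInterval w p a).1 ha)
  have hb := h _ ((mem_imageInterval w p b).1 hb)
  have e : ∀ c, w (w⁻¹ c) = c := fun c => by simp
  rw [e] at ha hb
  rw [hlt, inv_one, Equiv.Perm.one_apply, Equiv.Perm.one_apply, Fin.lt_def, Fin.lt_def]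
  omega

/-! ## The pure virtual cactus group and the edge group -/

/-- The action of permutations of the labels on ordered sets. -/
def OrdSubset.relabel (u : Equiv.Perm (Fin n)) (A : OrdSubset n) : OrdSubset n where
  carrier := A.carrier.map u.toEmbedding
  lt a b := A.lt (u⁻¹ a) (u⁻¹ b)
  mem_left _ _ h := Finset.mem_map_equiv.2 (A.mem_left _ _ h)
  mem_right _ _ h := Finset.mem_map_equiv.2 (A.mem_right _ _ h)
  irrefl _ h := A.irrefl _ h
  trans _ _ _ h h' := A.trans _ _ _ h h'
  total _ ha _ hb hab :=
    A.total _ (Finset.mem_map_equiv.1 ha) _ (Finset.mem_map_equiv.1 hb) ((u⁻¹).injective.ne hab)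

theorem OrdSubset.mem_relabel {u : Equiv.Perm (Fin n)} {A : OrdSubset n} {a : Fin n} :
    a ∈ (A.relabel u).carrier ↔ u⁻¹ a ∈ A.carrier := Finset.mem_map_equiv

theorem OrdSubset.relabel_one (A : OrdSubset n) : A.relabel 1 = A := by
  ext a b
  · rw [mem_relabel]; rfl
  · rfl

theorem OrdSubset.relabel_mul (u v : Equiv.Perm (Fin n)) (A : OrdSubset n) :
    A.relabel (u * v) = (A.relabel v).relabel u := by
  ext a b
  · rw [mem_relabel, mem_relabel, mem_relabel, mul_inv_rev]; rfl
  · change A.lt ((u * v)⁻¹ a) ((u * v)⁻¹ b) ↔ A.lt (v⁻¹ (u⁻¹ a)) (v⁻¹ (u⁻¹ b))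
    rw [mul_inv_rev]; rfl

theorem OrdSubset.relabel_ordInterval (u w : Equiv.Perm (Fin n)) (p : CactusIndex n) :
    (ordInterval w p).relabel u = ordInterval (u * w) p := by
  have hm : ∀ a, u⁻¹ a ∈ (imageInterval w p).1 ↔ a ∈ (imageInterval (u * w) p).1 := fun a => by
    rw [mem_imageInterval, mem_imageInterval, mul_inv_rev]; rfl
  ext a b
  · rw [mem_relabel]; exact hm a
  · change (_ ∧ _ ∧ _) ↔ (_ ∧ _ ∧ _)
    rw [hm, hm, mul_inv_rev]; rfl

theorem OrdSubset.IsIntervalOf.relabel (u : Equiv.Perm (Fin n)) {A B : OrdSubset n}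
    (h : A.IsIntervalOf B) : (A.relabel u).IsIntervalOf (B.relabel u) where
  subset _ ha := mem_relabel.2 (h.subset (mem_relabel.1 ha))
  lt_iff _ ha _ hb := h.lt_iff _ (mem_relabel.1 ha) _ (mem_relabel.1 hb)
  convex _ ha _ hb _ h1 h2 :=
    mem_relabel.2 (h.convex _ (mem_relabel.1 ha) _ (mem_relabel.1 hb) _ h1 h2)

namespace PlanarForest

/-- The action of permutations of the labels on planar forests. -/
def relabel (u : Equiv.Perm (Fin n)) (τ : PlanarForest n d) : PlanarForest n d where
  ord i := (τ.ord i).relabel u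
  two_le i := (τ.two_le i).trans_eq (Finset.card_map _).symm
  carrier_injective _ _ h := τ.carrier_injective (Finset.map_injective _ h)
  compat i j := by
    rcases τ.compat i j with h | h | h
    · exact Or.inl ((Finset.disjoint_map _).2 h)
    · exact Or.inr (Or.inl (h.relabel u))
    · exact Or.inr (Or.inr (h.relabel u))

theorem relabel_pull (u : Equiv.Perm (Fin n)) (τ : PlanarForest n d) (ι : Fin k ↪ Fin d)
    (σ : Fin d → ℤˣ) : (τ.pull ι σ).relabel u = (τ.relabel u).pull ι σ := by
  have hs : ∀ a b, (τ.relabel u).sgn σ a b = τ.sgn σ (u⁻¹ a) (u⁻¹ b) := fun a b =>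
    Finset.prod_congr rfl fun i _ => if_congr
      (and_congr OrdSubset.mem_relabel OrdSubset.mem_relabel) rfl rfl
  ext j a b
  · rfl
  · change τ.flipLt σ (ι j) (u⁻¹ a) (u⁻¹ b) ↔ (τ.relabel u).flipLt σ (ι j) a b
    rw [flipLt, flipLt, hs]
    rfl

theorem relabel_flipAt (u : Equiv.Perm (Fin n)) (τ : PlanarForest n d) (i : Fin d) :
    (τ.flipAt i).relabel u = (τ.relabel u).flipAt i := relabel_pull _ _ _ _

theorem relabel_edge (u : Equiv.Perm (Fin n)) (τ : PlanarForest n d) (i : Fin d) :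
    (τ.edge i).relabel u = (τ.relabel u).edge i := relabel_pull _ _ _ _

theorem relabel_one (τ : PlanarForest n d) : τ.relabel 1 = τ :=
  ext_ord fun i => (τ.ord i).relabel_one

theorem relabel_mul (u v : Equiv.Perm (Fin n)) (τ : PlanarForest n d) :
    τ.relabel (u * v) = (τ.relabel v).relabel u :=
  ext_ord fun i => (τ.ord i).relabel_mul u v

theorem relabel_ordForest (u w : Equiv.Perm (Fin n)) (p : CactusIndex n) :
    (ordForest w p).relabel u = ordForest (u * w) p :=
  ext_ord fun _ => OrdSubset.relabel_ordInterval u w p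

end PlanarForest

namespace EdgeGroup

theorem hom_ext_ordForest {G : Type*} [Group G] {f g : EdgeGroup n →* G}
    (h : ∀ w p, f (of (ordForest w p)) = g (of (ordForest w p))) : f = g :=
  hom_ext fun e => by
    obtain ⟨w, p, rfl⟩ := exists_ordForest_eq e
    exact h w p

/-- The endomorphism of the edge group given by a permutation of the labels. -/
def relabel (u : Equiv.Perm (Fin n)) : EdgeGroup n →* EdgeGroup n :=
  lift (fun e => of (e.relabel u))
    (fun e => by rw [relabel_flipAt, of_mul_of_flipAt])
    (fun q => by
      simp only [relabel_edge, relabel_flipAt]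
      exact of_square_two (q.relabel u))

theorem relabel_of (u : Equiv.Perm (Fin n)) (e : PlanarForest n 1) :
    relabel u (of e) = of (e.relabel u) := lift_of _ _ _ _

/-- The action of the permutations of the labels on the edge group. -/
def relabelAut (n : ℕ) : Equiv.Perm (Fin n) →* MulAut (EdgeGroup n) where
  toFun u := MonoidHom.toMulEquiv (relabel u) (relabel u⁻¹)
    (hom_ext fun e => by
      rw [MonoidHom.comp_apply, relabel_of, relabel_of, ← relabel_mul, inv_mul_cancel,
        relabel_one]; rfl)
    (hom_ext fun e => by
      rw [MonoidHom.comp_apply, relabel_of, relabel_of, ← relabel_mul, mul_inv_cancel,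
        relabel_one]; rfl)
  map_one' := MulEquiv.toMonoidHom_injective <| hom_ext fun e => by
    change relabel 1 (of e) = of e
    rw [relabel_of, relabel_one]
  map_mul' u v := MulEquiv.toMonoidHom_injective <| hom_ext fun e => by
    change relabel (u * v) (of e) = relabel u (relabel v (of e))
    rw [relabel_of, relabel_of, relabel_of, relabel_mul]

theorem relabelAut_of (u w : Equiv.Perm (Fin n)) (p : CactusIndex n) :
    relabelAut n u (of (ordForest w p)) = of (ordForest (u * w) p) := by
  change relabel u (of (ordForest w p)) = _
  rw [relabel_of, relabel_ordForest]

theorem of_ordForest_mul_self (w : Equiv.Perm (Fin n)) (p : CactusIndex n) :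
    of (ordForest w p) * of (ordForest (w * revInterval p) p) = 1 := by
  rw [← flipAt_ordForest, of_mul_of_flipAt]

theorem of_ordForest_square (w : Equiv.Perm (Fin n)) {p q p' q' : CactusIndex n}
    (hne : imageInterval w p ≠ imageInterval w q)
    (h : Disjoint (imageInterval w p).1 (imageInterval w q).1 ∨
      (ordInterval w q).IsIntervalOf (ordInterval w p))
    (hp : imageInterval (w * revInterval q) p' = imageInterval w p)
    (hq : imageInterval (w * revInterval p) q' = imageInterval w q) :
    of (ordForest w p) * of (ordForest (w * revInterval p) q') =
      of (ordForest w q) * of (ordForest (w * revInterval q) p') := by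
  have hc : Compat (ordForest w p) (ordForest w q) :=
    ⟨fun h' => hne (Subtype.ext h'), h.imp_right Or.inr⟩
  have hc' : Compat (ordForest w q) (ordForest w p) :=
    ⟨fun h' => hne (Subtype.ext h'.symm), h.elim (fun h => Or.inl h.symm) fun h => Or.inr (Or.inl h)⟩
  have hcompat : ∀ i j, i ≠ j →
      Compat (![ordForest w p, ordForest w q] i) (![ordForest w p, ordForest w q] j) := by
    intro i j hij
    fin_cases i <;> fin_cases j <;> first | exact absurd rfl hij | assumption
  have := of_square_two (ofEdges _ hcompat)
  rwa [ofEdges_edge, ofEdges_edge, flipAt_edge_eq_ordForest (ofEdges _ hcompat) 0 1 rfl rfl hq,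
    flipAt_edge_eq_ordForest (ofEdges _ hcompat) 1 0 rfl rfl hp] at this

end EdgeGroup

theorem imageInterval_disjoint (w : Equiv.Perm (Fin n)) {p q : CactusIndex n} :
    Disjoint (imageInterval w p).1 (imageInterval w q).1 ↔
      Disjoint (Set.Icc p.1.1 p.1.2) (Set.Icc q.1.1 q.1.2) := by
  rw [imageInterval, imageInterval, Finset.disjoint_map, ← Finset.disjoint_coe, Finset.coe_Icc,
    Finset.coe_Icc]

theorem imageInterval_subset (w : Equiv.Perm (Fin n)) {p q : CactusIndex n} :
    (imageInterval w p).1 ⊆ (imageInterval w q).1 ↔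
      Set.Icc p.1.1 p.1.2 ⊆ Set.Icc q.1.1 q.1.2 := by
  rw [imageInterval, imageInterval, Finset.map_subset_map, ← Finset.coe_subset, Finset.coe_Icc,
    Finset.coe_Icc]

theorem imageInterval_injective (w : Equiv.Perm (Fin n)) :
    Function.Injective (imageInterval w) := by
  intro p q h
  have h1 := (imageInterval_subset w).1 (congrArg Subtype.val h).subset
  have h2 := (imageInterval_subset w).1 (congrArg Subtype.val h).symm.subset
  have hp := p.2.le
  have hq := q.2.le
  exact Subtype.ext (Prod.ext
    (le_antisymm (h2 (Set.left_mem_Icc.2 hq)).1 (h1 (Set.left_mem_Icc.2 hp)).1)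
    (le_antisymm (h1 (Set.right_mem_Icc.2 hp)).2 (h2 (Set.right_mem_Icc.2 hq)).2))

theorem ordInterval_isIntervalOf (w : Equiv.Perm (Fin n)) {p q : CactusIndex n}
    (h : Set.Icc q.1.1 q.1.2 ⊆ Set.Icc p.1.1 p.1.2) :
    (ordInterval w q).IsIntervalOf (ordInterval w p) where
  subset := (imageInterval_subset w).2 h
  lt_iff a ha b hb := by
    have hs := (imageInterval_subset w).2 h
    exact ⟨fun h => ⟨hs ha, hs hb, h.2.2⟩, fun h => ⟨ha, hb, h.2.2⟩⟩
  convex a ha b hb c h1 h2 := (mem_imageInterval w q c).2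
    ⟨((mem_imageInterval w q a).1 ha).1.trans h1.2.2.le,
      h2.2.2.le.trans ((mem_imageInterval w q b).1 hb).2⟩

/-! ### From the virtual cactus group to the semidirect product -/

namespace VCactus

/-- The homomorphism `C_n → vC_n`. -/
def ofCactus (n : ℕ) : Cactus n →* VCactus n := (QuotientGroup.mk' _).comp Monoid.Coprod.inl

theorem s_mul_self (p : CactusIndex n) : s p * s p = 1 := by
  have h := PresentedGroup.one_of_mem (rels := {r | CactusRel n r}) (CactusRel.sq p)
  have h' := congrArg (ofCactus n) h
  rwa [map_mul, map_mul, map_one] at h'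

theorem s_comm {p q : CactusIndex n}
    (h : Disjoint (Set.Icc p.1.1 p.1.2) (Set.Icc q.1.1 q.1.2)) : s p * s q = s q * s p := by
  have h := PresentedGroup.one_of_mem (rels := {r | CactusRel n r}) (CactusRel.comm p q h)
  rw [map_mul, map_inv, mul_inv_eq_one, map_mul, map_mul] at h
  have h' := congrArg (ofCactus n) h
  rwa [map_mul, map_mul] at h'

theorem s_nest {p q r : CactusIndex n} (h : Set.Icc q.1.1 q.1.2 ⊆ Set.Icc p.1.1 p.1.2)
    (h₁ : r.1.1 = revInterval p q.1.2) (h₂ : r.1.2 = revInterval p q.1.1) :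
    s p * s q = s r * s p := by
  have h := PresentedGroup.one_of_mem (rels := {r | CactusRel n r}) (CactusRel.nest p q r h h₁ h₂)
  rw [map_mul, map_inv, mul_inv_eq_one, map_mul, map_mul] at h
  have h' := congrArg (ofCactus n) h
  rwa [map_mul, map_mul] at h'

theorem perm_mul (u v : Equiv.Perm (Fin n)) : perm (u * v) = perm u * perm v :=
  congrArg QuotientGroup.mk (map_mul Monoid.Coprod.inr u v)

/-- The homomorphism `S_n → vC_n`. -/
def permHom (n : ℕ) : Equiv.Perm (Fin n) →* VCactus n := MonoidHom.mk' perm perm_mul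

theorem perm_inv (u : Equiv.Perm (Fin n)) : perm u⁻¹ = (perm u)⁻¹ := map_inv (permHom n) u

theorem perm_conj_s {w : Equiv.Perm (Fin n)} {p r : CactusIndex n}
    (h : ∀ m ∈ Set.Icc p.1.1 p.1.2, (w m : ℕ) + p.1.1 = w p.1.1 + m)
    (h₁ : r.1.1 = w p.1.1) (h₂ : r.1.2 = w p.1.2) :
    perm w * s p = s r * perm w := by
  have : (QuotientGroup.mk (Monoid.Coprod.inr w * Monoid.Coprod.inl (Cactus.s p) *
      (Monoid.Coprod.inr w)⁻¹ * (Monoid.Coprod.inl (Cactus.s r))⁻¹) : VCactus n) = 1 :=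
    (QuotientGroup.eq_one_iff _).2 (Subgroup.subset_normalClosure (VCactusRel.mk w p r h h₁ h₂))
  rw [← mul_inv_eq_iff_eq_mul, ← mul_inv_eq_one]
  exact this

/-- The homomorphisms from `vC_n` are determined by the values at the generators. -/
theorem hom_ext {G : Type*} [Group G] {f g : VCactus n →* G} (hs : ∀ p, f (s p) = g (s p))
    (hw : ∀ w, f (perm w) = g (perm w)) : f = g :=
  QuotientGroup.monoidHom_ext _ (Monoid.Coprod.hom_ext (PresentedGroup.ext hs)
    (MonoidHom.ext hw))

open EdgeGroup in
/-- The homomorphism from the cactus group to the semidirect product of the edge group and the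
symmetric group. -/
def cactusToSemidirect (n : ℕ) :
    Cactus n →* EdgeGroup n ⋊[relabelAut n] Equiv.Perm (Fin n) :=
  PresentedGroup.toGroup (f := fun p => ⟨of (ordForest 1 p), revInterval p⟩) (by
    -- Commutation and nesting both have the form `s_p s_q = s_r s_p`, with `r = q` for commutation.
    -- In the edge group component this is the square relation for the intervals `p` and `r` in the
    -- identity frame.
    have hr : ∀ {p q r : CactusIndex n}, revInterval p * revInterval q =
        revInterval r * revInterval p → r ≠ p →
        (Disjoint (imageInterval 1 p).1 (imageInterval 1 r).1 ∨
          (ordInterval 1 r).IsIntervalOf (ordInterval 1 p)) →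
        imageInterval (1 * revInterval r) p = imageInterval 1 p →
        imageInterval (1 * revInterval p) q = imageInterval 1 r →
        (⟨of (ordForest 1 p), revInterval p⟩ * ⟨of (ordForest 1 q), revInterval q⟩ :
          EdgeGroup n ⋊[relabelAut n] Equiv.Perm (Fin n)) =
        ⟨of (ordForest 1 r), revInterval r⟩ * ⟨of (ordForest 1 p), revInterval p⟩ := by
      intro p q r h hne hd h1 h2
      refine SemidirectProduct.ext ?_ h
      rw [SemidirectProduct.mul_left, SemidirectProduct.mul_left, relabelAut_of, relabelAut_of,
        mul_one, mul_one]
      have := of_ordForest_square 1 (fun h => hne (imageInterval_injective 1 h).symm) hd h1 h2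
      rwa [one_mul, one_mul] at this
    rintro _ (⟨p⟩ | ⟨p, q, h⟩ | ⟨p, q, r, h, h₁, h₂⟩)
    · rw [map_mul, FreeGroup.lift_apply_of]
      refine SemidirectProduct.ext ?_ (revInterval_mul_self p)
      rw [SemidirectProduct.mul_left, relabelAut_of, mul_one]
      exact of_ordForest_mul_self 1 p
    · rw [map_mul, map_inv, map_mul, map_mul, FreeGroup.lift_apply_of, FreeGroup.lift_apply_of,
        mul_inv_eq_one]
      refine hr (revInterval_comm p q h) ?_ (Or.inl ((imageInterval_disjoint 1).2 h))
        (imageInterval_mul_revInterval_of_disjoint 1 h.symm)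
        (imageInterval_mul_revInterval_of_disjoint 1 h)
      rintro rfl
      exact Set.disjoint_left.1 h (Set.left_mem_Icc.2 q.2.le) (Set.left_mem_Icc.2 q.2.le)
    · rw [map_mul, map_inv, map_mul, map_mul, FreeGroup.lift_apply_of, FreeGroup.lift_apply_of,
        FreeGroup.lift_apply_of, mul_inv_eq_one]
      have hi := imageInterval_mul_revInterval_of_nest 1 h h₁ h₂
      -- Nesting allows `q = p`. Then `r = p` too and the relation is trivial, but there is no
      -- square, as a square needs two different sets.
      by_cases hrp : r = p
      · subst hrp
        obtain rfl : q = r := imageInterval_injective (1 * revInterval r)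
          (hi.trans (imageInterval_mul_revInterval_self 1 r).symm)
        rfl
      · obtain ⟨r', hr', hr1, hr2, -⟩ := exists_reflection h
        obtain rfl : r = r' := Subtype.ext (Prod.ext (h₁.trans hr1.symm) (h₂.trans hr2.symm))
        exact hr (revInterval_nest p q r h h₁ h₂) hrp (Or.inr (ordInterval_isIntervalOf 1 hr'))
          (imageInterval_mul_revInterval_of_subset 1 hr') hi)

open EdgeGroup in
/-- The homomorphism from the virtual cactus group to the semidirect product of the edge group and
the symmetric group. -/
def toSemidirect (n : ℕ) : VCactus n →* EdgeGroup n ⋊[relabelAut n] Equiv.Perm (Fin n) :=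
  QuotientGroup.lift _ (Monoid.Coprod.lift (cactusToSemidirect n) SemidirectProduct.inr) (by
    intro x hx
    refine Subgroup.normalClosure_le_normal ?_ hx
    rintro _ ⟨w, p, r, h, h₁, h₂⟩
    simp only [SetLike.mem_coe, MonoidHom.mem_ker, map_mul, map_inv, Monoid.Coprod.lift_apply_inl,
      Monoid.Coprod.lift_apply_inr, cactusToSemidirect, Cactus.s, PresentedGroup.toGroup.of]
    rw [mul_inv_eq_one, mul_inv_eq_iff_eq_mul]
    have hp : ordForest w p = ordForest 1 r :=
      eq_of_ord_zero (ordInterval_eq_of_shift h h₁ h₂)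
    refine SemidirectProduct.ext ?_ (revInterval_conj w p r h h₁ h₂)
    rw [SemidirectProduct.mul_left, SemidirectProduct.mul_left, SemidirectProduct.left_inr,
      SemidirectProduct.right_inr, map_one, one_mul, mul_one,
      relabelAut_of, mul_one, hp])

theorem toSemidirect_s (p : CactusIndex n) :
    toSemidirect n (s p) = ⟨EdgeGroup.of (ordForest 1 p), revInterval p⟩ := by
  simp only [toSemidirect, s, QuotientGroup.lift_mk, Monoid.Coprod.lift_apply_inl,
    cactusToSemidirect, Cactus.s, PresentedGroup.toGroup.of]

theorem toSemidirect_perm (w : Equiv.Perm (Fin n)) :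
    toSemidirect n (perm w) = SemidirectProduct.inr w := by
  simp only [toSemidirect, perm, QuotientGroup.lift_mk, Monoid.Coprod.lift_apply_inr]

theorem toSemidirect_right (g : VCactus n) : (toSemidirect n g).right = toPerm n g := by
  have : SemidirectProduct.rightHom.comp (toSemidirect n) = toPerm n := by
    refine hom_ext (fun p => ?_) fun w => ?_
    · rw [MonoidHom.comp_apply, toSemidirect_s, toPerm_s]; rfl
    · rw [MonoidHom.comp_apply, toSemidirect_perm, toPerm_perm]; rfl
  exact DFunLike.congr_fun this g

end VCactus

/-! ### From the edge group to the pure virtual cactus group -/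

namespace PVCactus

open VCactus

theorem gen_val (w : Equiv.Perm (Fin n)) (p : CactusIndex n) :
    (gen w p : VCactus n) = perm w * s p * perm (revInterval p) * (perm w)⁻¹ := rfl

theorem gen_mul_gen_self (w : Equiv.Perm (Fin n)) (p : CactusIndex n) :
    gen w p * gen (w * revInterval p) p = 1 := by
  refine Subtype.ext ?_
  rw [Subgroup.coe_mul, gen_val, gen_val, perm_mul]
  have h := s_mul_self p
  calc _ = perm w * (s p * (perm (revInterval p) * perm (revInterval p)) * s p) *
        (perm w)⁻¹ := by group
    _ = 1 := by
      rw [← perm_mul, revInterval_mul_self]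
      change perm w * (s p * permHom n 1 * s p) * (perm w)⁻¹ = 1
      rw [map_one, mul_one, h]
      group

/-- The inner permutations cancel in a product of two generators along a path of frames. What
remains is `w` times `s_p s_q'` times the inverse of `w_p w_q'` times `w⁻¹`, so a relation valid
both for the `s` and for their permutations gives a square. -/
theorem gen_square (w : Equiv.Perm (Fin n)) {p q p' q' : CactusIndex n}
    (hs : s p * s q' = s q * s p')
    (hr : revInterval p * revInterval q' = revInterval q * revInterval p') :
    gen w p * gen (w * revInterval p) q' = gen w q * gen (w * revInterval q) p' := by
  have key : ∀ p q', ((gen w p * gen (w * revInterval p) q' : PVCactus n) : VCactus n) =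
      perm w * (s p * s q') * (perm (revInterval p * revInterval q'))⁻¹ * (perm w)⁻¹ := by
    intro p q'
    have e : (perm (revInterval p * revInterval q'))⁻¹ =
        perm (revInterval q') * (perm (revInterval p))⁻¹ := by
      rw [← perm_inv, mul_inv_rev, revInterval_inv, perm_mul, perm_inv]
    rw [Subgroup.coe_mul, gen_val, gen_val, e, perm_mul]
    have : perm (revInterval p) * perm (revInterval p) = 1 := by
      rw [← perm_mul, revInterval_mul_self]
      exact map_one (permHom n)
    calc _ = perm w * s p * (perm (revInterval p) * perm (revInterval p)) * s q' *
          perm (revInterval q') * (perm (revInterval p))⁻¹ * (perm w)⁻¹ := by group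
      _ = _ := by rw [this]; group
  refine Subtype.ext ?_
  rw [key, key, hs, hr]

theorem perm_conj_gen (u w : Equiv.Perm (Fin n)) (p : CactusIndex n) :
    (gen (u * w) p : VCactus n) = perm u * gen w p * (perm u)⁻¹ := by
  rw [gen_val, gen_val, perm_mul]
  group

/-- The element `s_A` is independent of the frame: the mixed relations cover exactly the difference
between two frames of `A`. -/
theorem gen_eq_of_ordForest_eq {w w' : Equiv.Perm (Fin n)} {p p' : CactusIndex n}
    (h : ordForest w p = ordForest w' p') : gen w p = gen w' p' := by
  obtain ⟨h1, h2, h3⟩ := ordInterval_eq_iff (congrArg (fun e => e.ord 0) h)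
  have hs := perm_conj_s h1 h2 h3
  have hr := revInterval_conj _ _ _ h1 h2 h3
  have hw : w = w' * (w'⁻¹ * w) := by group
  generalize w'⁻¹ * w = u at *
  subst hw
  have hr' : revInterval p' = u * revInterval p * u⁻¹ := by rw [hr]; group
  have hs' : s p' = perm u * s p * (perm u)⁻¹ := by rw [hs]; group
  refine Subtype.ext ?_
  rw [gen_val, gen_val, hs', hr', perm_mul, perm_mul, perm_mul, perm_inv]
  group

/-- The element `s_A`, where `A` is the ordered set of the leaves above the edge. -/
noncomputable def ofForest (e : PlanarForest n 1) : PVCactus n :=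
  gen (exists_ordForest_eq e).choose (exists_ordForest_eq e).choose_spec.choose

theorem ofForest_ordForest (w : Equiv.Perm (Fin n)) (p : CactusIndex n) :
    ofForest (ordForest w p) = gen w p :=
  gen_eq_of_ordForest_eq (exists_ordForest_eq (ordForest w p)).choose_spec.choose_spec

/-- In a common frame the square is the commutation relation for disjoint intervals and the nesting
relation for nested ones. In the nested case `r` is the mirror image of `q` in `p`, the position of
the smaller set after the flip. -/
theorem ofForest_square (τ : PlanarForest n d) (i j : Fin d)
    (h : Disjoint (τ.ord i).carrier (τ.ord j).carrier ∨ (τ.ord j).IsIntervalOf (τ.ord i)) :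
    ofForest (τ.edge i) * ofForest ((τ.flipAt i).edge j) =
      ofForest (τ.edge j) * ofForest ((τ.flipAt j).edge i) := by
  obtain ⟨w, p, q, hp, hq⟩ := exists_common_frame τ i j h
  have ei : τ.edge i = ordForest w p := eq_of_ord_zero ((edge_ord _ _ _).trans hp)
  have ej : τ.edge j = ordForest w q := eq_of_ord_zero ((edge_ord _ _ _).trans hq)
  have hp' : (τ.ord i).carrier = (imageInterval w p).1 := congrArg OrdSubset.carrier hp
  have hq' : (τ.ord j).carrier = (imageInterval w q).1 := congrArg OrdSubset.carrier hq
  rcases h with h | h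
  · rw [hp', hq', imageInterval_disjoint] at h
    rw [ei, ej, flipAt_edge_eq_ordForest τ i j hp' hq
        (imageInterval_mul_revInterval_of_disjoint w h),
      flipAt_edge_eq_ordForest τ j i hq' hp
        (imageInterval_mul_revInterval_of_disjoint w h.symm)]
    simp only [ofForest_ordForest]
    exact gen_square w (s_comm h) (revInterval_comm p q h)
  · have hs := h.subset
    rw [hp', hq', imageInterval_subset] at hs
    obtain ⟨r, hr, h1, h2, h3, h4⟩ := exists_reflection hs
    rw [ei, ej, flipAt_edge_eq_ordForest τ i j hp' hq
        (imageInterval_mul_revInterval_of_nest w hr h3 h4),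
      flipAt_edge_eq_ordForest τ j i hq' hp
        (imageInterval_mul_revInterval_of_subset w hs)]
    simp only [ofForest_ordForest]
    exact gen_square w (s_nest hr h3 h4) (revInterval_nest p r q hr h3 h4)

/-- The homomorphism from the edge group to the pure virtual cactus group. -/
noncomputable def ofEdgeGroup (n : ℕ) : EdgeGroup n →* PVCactus n :=
  EdgeGroup.lift ofForest
    (fun e => by
      obtain ⟨w, p, rfl⟩ := exists_ordForest_eq e
      rw [flipAt_ordForest, ofForest_ordForest, ofForest_ordForest, gen_mul_gen_self])
    (fun q => by
      rcases q.compat 0 1 with h | h | h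
      · exact ofForest_square q 0 1 (Or.inl h)
      · exact (ofForest_square q 1 0 (Or.inr h)).symm
      · exact ofForest_square q 0 1 (Or.inr h))

theorem ofEdgeGroup_of (w : Equiv.Perm (Fin n)) (p : CactusIndex n) :
    ofEdgeGroup n (EdgeGroup.of (ordForest w p)) = gen w p := by
  rw [ofEdgeGroup, EdgeGroup.lift_of, ofForest_ordForest]

/-- The factor `w_{ij}` in `s_A` cancels the permutation component of `s_{ij}`, and conjugation by
`w` relabels `(i, …, j)` to `A`. -/
theorem toSemidirect_gen (w : Equiv.Perm (Fin n)) (p : CactusIndex n) :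
    toSemidirect n (gen w p) = SemidirectProduct.inl (EdgeGroup.of (ordForest w p)) := by
  have h1 : (SemidirectProduct.inl (EdgeGroup.of (ordForest w p)) :
      EdgeGroup n ⋊[EdgeGroup.relabelAut n] Equiv.Perm (Fin n)) =
      SemidirectProduct.inr w * SemidirectProduct.inl (EdgeGroup.of (ordForest 1 p)) *
        SemidirectProduct.inr w⁻¹ := by
    rw [← SemidirectProduct.inl_aut, EdgeGroup.relabelAut_of, mul_one]
  have h2 : (SemidirectProduct.inr (revInterval p) * SemidirectProduct.inr (revInterval p) :
      EdgeGroup n ⋊[EdgeGroup.relabelAut n] Equiv.Perm (Fin n)) = 1 := by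
    rw [← map_mul, revInterval_mul_self, map_one]
  rw [gen_val, map_mul, map_mul, map_mul, map_inv, toSemidirect_s, toSemidirect_perm,
    toSemidirect_perm, SemidirectProduct.mk_eq_inl_mul_inr, h1, map_inv, mul_assoc _ (_ * _),
    mul_assoc _ _ (SemidirectProduct.inr (revInterval p)), h2, mul_one]

theorem toSemidirect_ofEdgeGroup (g : EdgeGroup n) :
    toSemidirect n (ofEdgeGroup n g) = SemidirectProduct.inl g := by
  have : (toSemidirect n).comp ((PVCactus n).subtype.comp (ofEdgeGroup n)) =
      SemidirectProduct.inl := EdgeGroup.hom_ext_ordForest fun w p => by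
    rw [MonoidHom.comp_apply, MonoidHom.comp_apply, ofEdgeGroup_of]
    exact toSemidirect_gen w p
  exact DFunLike.congr_fun this g

/-- The homomorphism from the semidirect product of the edge group and the symmetric group to the
virtual cactus group. -/
noncomputable def ofSemidirect (n : ℕ) :
    EdgeGroup n ⋊[EdgeGroup.relabelAut n] Equiv.Perm (Fin n) →* VCactus n :=
  SemidirectProduct.lift ((PVCactus n).subtype.comp (ofEdgeGroup n)) (permHom n) fun u =>
    EdgeGroup.hom_ext_ordForest fun w p => by
      have h : ∀ w, (PVCactus n).subtype (ofEdgeGroup n (EdgeGroup.of (ordForest w p))) =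
          gen w p := fun w => by rw [ofEdgeGroup_of]; rfl
      change (PVCactus n).subtype (ofEdgeGroup n (EdgeGroup.relabelAut n u
        (EdgeGroup.of (ordForest w p)))) = permHom n u * (PVCactus n).subtype (ofEdgeGroup n
          (EdgeGroup.of (ordForest w p))) * (permHom n u)⁻¹
      rw [EdgeGroup.relabelAut_of, h, h]
      exact perm_conj_gen u w p

theorem ofSemidirect_toSemidirect (g : VCactus n) :
    ofSemidirect n (toSemidirect n g) = g := by
  have : (ofSemidirect n).comp (toSemidirect n) = MonoidHom.id _ := by
    refine VCactus.hom_ext (fun p => ?_) fun w => ?_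
    · rw [MonoidHom.comp_apply, toSemidirect_s, SemidirectProduct.mk_eq_inl_mul_inr, map_mul,
        ofSemidirect, SemidirectProduct.lift_inl, SemidirectProduct.lift_inr,
        MonoidHom.comp_apply, ofEdgeGroup_of]
      change permHom n 1 * s p * permHom n (revInterval p) * (permHom n 1)⁻¹ *
        permHom n (revInterval p) = s p
      rw [map_one, one_mul, inv_one, mul_one, mul_assoc, ← map_mul, revInterval_mul_self, map_one,
        mul_one]
    · rw [MonoidHom.comp_apply, toSemidirect_perm, ofSemidirect, SemidirectProduct.lift_inr]
      rfl
  exact DFunLike.congr_fun this g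

theorem ofEdgeGroup_injective (n : ℕ) : Function.Injective (ofEdgeGroup n) := by
  intro g h hgh
  refine SemidirectProduct.inl_injective (φ := EdgeGroup.relabelAut n) ?_
  rw [← toSemidirect_ofEdgeGroup, ← toSemidirect_ofEdgeGroup, hgh]

/-- An element of `vC_n` is recovered from its image in the semidirect product. If its permutation
is trivial, only the edge group component is left. -/
theorem ofEdgeGroup_surjective (n : ℕ) : Function.Surjective (ofEdgeGroup n) := by
  intro g
  refine ⟨(toSemidirect n g).left, Subtype.ext ?_⟩
  have h1 : (toSemidirect n (g : VCactus n)).right = 1 := (toSemidirect_right _).trans g.2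
  have h2 := ofSemidirect_toSemidirect (g : VCactus n)
  rw [← SemidirectProduct.inl_left_mul_inr_right (toSemidirect n (g : VCactus n)), h1, map_one,
    mul_one, ofSemidirect, SemidirectProduct.lift_inl] at h2
  exact h2

/-- The pure virtual cactus group is isomorphic to the edge group. -/
noncomputable def equivEdgeGroup (n : ℕ) : EdgeGroup n ≃* PVCactus n :=
  MulEquiv.ofBijective (ofEdgeGroup n) ⟨ofEdgeGroup_injective n, ofEdgeGroup_surjective n⟩

theorem equivEdgeGroup_symm_gen (w : Equiv.Perm (Fin n)) (p : CactusIndex n) :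
    (equivEdgeGroup n).symm (gen w p) = EdgeGroup.of (ordForest w p) :=
  (equivEdgeGroup n).symm_apply_eq.2 (ofEdgeGroup_of w p).symm

theorem closure_range_gen (n : ℕ) : Subgroup.closure
    (Set.range fun x : Equiv.Perm (Fin n) × CactusIndex n => gen x.1 x.2) = ⊤ := by
  rw [eq_top_iff, ← MonoidHom.range_eq_top.2 (ofEdgeGroup_surjective n), MonoidHom.range_eq_map,
    ← EdgeGroup.closure_range_of, MonoidHom.map_closure]
  refine Subgroup.closure_mono ?_
  rintro _ ⟨_, ⟨e, rfl⟩, rfl⟩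
  obtain ⟨w, p, rfl⟩ := exists_ordForest_eq e
  exact ⟨(w, p), (ofEdgeGroup_of w p).symm⟩

end PVCactus

/-! ## The corollary -/

theorem corollary2 (n : ℕ) :
    VirtuallySpecialCompact (VCactus n) ∧
    Subgroup.closure
      (Set.range fun x : Equiv.Perm (Fin n) × CactusIndex n => PVCactus.gen x.1 x.2) = ⊤ ∧
    ∃ φ : PVCactus n →* (LabelSet n → ℤˣ),
      (∀ (w : Equiv.Perm (Fin n)) (p : CactusIndex n),
        φ (PVCactus.gen w p) = Pi.mulSingle (imageInterval w p) (-1)) ∧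
      (φ.ker.map (PVCactus n).subtype).FiniteIndex ∧
      (cactusCover n).IsSpecial ∧
      CompactSpace (cactusCover n).Space ∧
      PathConnectedSpace (cactusCover n).Space ∧
      ∀ x : (cactusCover n).Space,
        Nonempty (FundamentalGroup (cactusCover n).Space x ≃*
          φ.ker.map (PVCactus n).subtype) := by
  let e := PVCactus.equivEdgeGroup n
  let φ : PVCactus n →* (LabelSet n → ℤˣ) := (cactusCover.types n).comp e.symm.toMonoidHom
  have hφ : ∀ (w : Equiv.Perm (Fin n)) (p : CactusIndex n),
      φ (PVCactus.gen w p) = Pi.mulSingle (imageInterval w p) (-1) := by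
    intro w p
    change cactusCover.types n (e.symm (PVCactus.gen w p)) = _
    rw [PVCactus.equivEdgeGroup_symm_gen, cactusCover.types, EdgeGroup.lift_of]
    rfl
  have hfin : (φ.ker.map (PVCactus n).subtype).FiniteIndex := by
    constructor
    -- The index in `vC_n` is the product of the index of the kernel in `PvC_n` and that of `PvC_n`
    -- in `vC_n`. Both are finite because `(ℤ/2)^L` and `S_n` are.
    rw [Subgroup.index_map_subtype]
    exact mul_ne_zero (Subgroup.FiniteIndex.index_ne_zero (H := φ.ker))
      (Subgroup.FiniteIndex.index_ne_zero (H := (VCactus.toPerm n).ker))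
  have hker : (cactusCover.types n).ker.map e.toMonoidHom = φ.ker := by
    ext g
    rw [Subgroup.mem_map_equiv]
    rfl
  have hpc := cactusCover.pathConnectedSpace n
  have hπ : ∀ x : (cactusCover n).Space, Nonempty (FundamentalGroup (cactusCover n).Space x ≃*
      φ.ker.map (PVCactus n).subtype) := by
    intro x
    obtain ⟨f⟩ := cactusCover.fundamentalGroup_equiv_ker n
    exact ⟨(FundamentalGroup.fundamentalGroupMulEquivOfPathConnected x _).trans <| f.trans <|
      (e.subgroupMap _).trans <| (MulEquiv.subgroupCongr hker).trans <|
        φ.ker.equivMapOfInjective _ (PVCactus n).subtype_injective⟩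
  exact ⟨⟨_, hfin, cactusCover n, cactusCover.isSpecial n, cactusCover.compactSpace n, hpc,
    cactusCover.vertex 1, hπ _⟩, PVCactus.closure_range_gen n, φ, hφ, hfin,
    cactusCover.isSpecial n, cactusCover.compactSpace n, hpc, hπ⟩
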